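/- **Setting.** Let $(\Omega,\mathcal F,\mathbb F=\{\mathcal F_t\},\mathbb P)$ satisfy the usual conditions and carry an $n$-dimensional $\mathbb F$-Brownian motion $W$ on $[0,T]$, $T>0$. The coefficients $r,\rho\in\mathbb R$, $\mu\in\mathbb R^m$, $\sigma\in\mathbb R^{m\times n}$ are predictable and bounded, and $\sigma(t)\sigma(t)^\top$ is invertible. Put $B=\mu-r\mathbf 1$, $\theta=\sigma^\top(\sigma\sigma^\top)^{-1}B$, $\Gamma(t)=\sigma(t)^\top\Pi$ with $\Pi\subset\mathbb R^m$ closed and convex, $\mathscr C=[\underline c,\overline c]\cap[0,\infty)$ with $0\le\underline c<\infty$, $\underline c\le\overline c\le\infty$, $H=\mathrm{diag}(\eta_1,\dots,\eta_n)$ with $\eta_i>0$, $U_1(y)=\frac{y^{1-\gamma}}{1-\gamma}$ (with $U_1(0)=-\infty$ if $\gamma>1$) and $U_2=\beta U_1$, where $\gamma\in(0,1)\cup(1,\infty)$, $\beta>0$. Fix an initial pair $(t_0,x_0)\in[0,T]\times(0,\infty)$ (for instance $t_0=0$). For a distortion process $\phi$ let $\Lambda(t)=\exp\{-\frac12\int_{t_0}^t|\phi|^2ds+\int_{t_0}^t\phi^\top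 dW\}$, $d\mathbb Q(\phi)/d\mathbb P=\Lambda(T)$, $W^{\mathbb Q}=W-\int_{t_0}^{\cdot}\phi\,ds$. The wealth $X=X^{u,\phi}$ of $u=(p,c)$ solves, on $[t_0,T]$, $$dX=X\,[\,r+p^\top(\theta+\phi)-c\,]\,dt+X\,p^\top dW^{\mathbb Q},\qquad X(t_0)=x_0 .$$ A pair $(u,\phi)$ is admissible if: (1) $p,c,\phi$ are predictable with values in $\Gamma$, $\mathscr C$, $\mathbb R^n$; (2) the wealth equation has a unique non-negative solution, and $\mathbb E^{\mathbb Q(\phi)}[\sup_{t\in[t_0,T]}|X(t)|^q]<\infty$ for every real $q\le2$ (negative $q$ included); (3) $\Lambda$ is well defined and a $\mathbb P$-martingale; (4) $\mathbb E^{\mathbb Q(\phi)}\int_{t_0}^T|pX|^2ds<\infty$, $\mathbb E^{\mathbb Q(\phi)}[(\int_{t_0}^T|cX|^2ds)^{1/2}]<\infty$, $\mathbb E^{\mathbb Q(\phi)}\int_{t_0}^T|\phi|^2ds<\infty$. Let $\mathcal B(u)$ be the set of all $\phi$ with $(u,\phi)$ admissible and $\mathcal A$ the set of all $u$ with $\mathcal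 B(u)\ne\emptyset$. For a random field $V(t,x)$ let $\Psi_i(s)=\frac{\eta_i}{(1-\gamma)V(s,X(s))}$. The robust problem with normaliser $V$, at time $t\in[t_0,T]$ and for a wealth $\xi$ at time $t$, is $$\operatorname*{ess\,sup}_{u}\ \operatorname*{ess\,inf}_{\phi}\ \mathbb E^{\mathbb Q(\phi)}\Big[\int_t^Te^{-\int_t^s\rho}\Big(U_1(cX)+\sum_{i=1}^n\frac{\phi_i^2}{2\Psi_i}\Big)ds+e^{-\int_t^T\rho}U_2(X(T))\,\Big|\,\mathcal F_t\Big],$$ over $u\in\mathcal A$, $\phi\in\mathcal B(u)$ with $X^{u,\phi}(t)=\xi$ almost surely (at $t=t_0$ this means $\xi=x_0$). Integrals and expectations are extended-real valued, with $\infty-\infty=-\infty$. Since the penalty contains the value function itself, *$V$ is a value function* means that, for all $(t,x)\in[0,T]\times(0,\infty)$, $V(t,x)$ is almost surely the value at $(t,x)$ of the problem started at $(t,x)$ with normaliser $V$. **Proposition.** Let $v(t,x)$, $t\in[0,T]$, $x>0$, be a real random field which is twice continuously differentiable in $x$, for each $x$ a continuous adapted process in $t$, and satisfies $v(T,x)=U_2(x)$.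 For an initial pair $(t_0,x_0)$ and $(u,\phi)$ admissible put $$N^{u,\phi}(t)=\int_{t_0}^te^{-\int_{t_0}^s\rho}R(s)\,ds+e^{-\int_{t_0}^t\rho}\,v(t,X^{u,\phi}(t)),\quad R(s)=\tfrac{1-\gamma}2\phi^\top H^{-1}\phi\;v(s,X^{u,\phi}(s))+U_1(c(s)X^{u,\phi}(s)).$$ Suppose that 1. for every $u\in\mathcal A$ there is $\phi\in\mathcal B(u)$ such that $N^{u,\phi}$ is a $\mathbb Q(\phi)$-supermartingale on $[t_0,T]$; 2. $u^*\in\mathcal A$ and $\phi^*\in\mathcal B(u^*)$ are such that $N^{u^*,\phi^*}$ is a $\mathbb Q(\phi^*)$-martingale on $[t_0,T]$ and $\phi^*$ attains $$\inf_{\phi\in\mathcal B(u^*)}\mathbb E^{\mathbb Q(\phi)}\Big[\int_{t_0}^Te^{-\int_{t_0}^s\rho}R(s)\,ds+e^{-\int_{t_0}^T\rho}U_2(X^{u^*,\phi}(T))\Big].$$ Then, for every $t\in[t_0,T]$ and with $X^*=X^{u^*,\phi^*}$, the value at time $t$ and wealth $X^*(t)$ of the robust problem with normaliser $v$ is almost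 surely $v(t,X^*(t))$; $u^*$ attains the outer supremum and $\phi^*$ attains the inner infimum for $u^*$. In particular, since $X^*(t_0)=x_0$, $(u^*,\phi^*)$ is optimal for the problem started at $(t_0,x_0)$ and its value is $v(t_0,x_0)$. Consequently, if for every $(t_0,x_0)\in[0,T]\times(0,\infty)$ there are such $(u^*,\phi^*)$ and Condition 1 holds, then $v$ is a value function: $V(t,x)=v(t,x)$ for all $(t,x)$. -/

import Mathlib

open MeasureTheory ProbabilityTheory Filter Topology
open scoped NNReal ENNReal Matrix

noncomputable section

namespace RobustMerton

/-! ### Extended-real integrals, conditional expectations, essential bounds -/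

/-- Lebesgue measure on the time axis `[0, ∞)`. -/
def timeVol : Measure ℝ≥0 := Measure.comap ((↑) : ℝ≥0 → ℝ) volume

/-- Lebesgue integral of an extended-real function: integral of the positive part minus integral of
the negative part, with the convention `∞ - ∞ = -∞` (the convention of `EReal`). -/
def eintegral {α : Type*} [MeasurableSpace α] (ν : Measure α) (f : α → EReal) : EReal :=
  ((∫⁻ a, (f a).toENNReal ∂ν : ℝ≥0∞) : EReal) - ((∫⁻ a, (-f a).toENNReal ∂ν : ℝ≥0∞) : EReal)

/-- Conditional expectation, under `Q` given `𝒢`, of an extended-real random variable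
(same convention). -/
def econdExp {Ω : Type*} [mΩ : MeasurableSpace Ω] (Q : Measure Ω) (𝒢 : MeasurableSpace Ω)
    (Y : Ω → EReal) (ω : Ω) : EReal :=
  ((condLExp 𝒢 Q (fun ω => (Y ω).toENNReal) ω : ℝ≥0∞) : EReal)
    - ((condLExp 𝒢 Q (fun ω => (-Y ω).toENNReal) ω : ℝ≥0∞) : EReal)

/-- `Z` is (a version of) the `𝒢`-measurable essential infimum of the family `S`. -/
structure IsEssInf {Ω : Type*} [mΩ : MeasurableSpace Ω] (P : Measure Ω) (𝒢 : MeasurableSpace Ω)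
    (S : Set (Ω → EReal)) (Z : Ω → EReal) : Prop where
  measurable : Measurable[𝒢] Z
  le : ∀ Y ∈ S, Z ≤ᵐ[P] Y
  greatest : ∀ Z' : Ω → EReal, Measurable[𝒢] Z' → (∀ Y ∈ S, Z' ≤ᵐ[P] Y) → Z' ≤ᵐ[P] Z

/-- `Z` is (a version of) the `𝒢`-measurable essential supremum of the family `S`. -/
structure IsEssSup {Ω : Type*} [mΩ : MeasurableSpace Ω] (P : Measure Ω) (𝒢 : MeasurableSpace Ω)
    (S : Set (Ω → EReal)) (Z : Ω → EReal) : Prop where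
  measurable : Measurable[𝒢] Z
  le : ∀ Y ∈ S, Y ≤ᵐ[P] Z
  least : ∀ Z' : Ω → EReal, Measurable[𝒢] Z' → (∀ Y ∈ S, Y ≤ᵐ[P] Z') → Z ≤ᵐ[P] Z'

/-- The filtration `F` with the time set restricted to `[a, b]`. -/
def filtrationOn {Ω : Type*} [mΩ : MeasurableSpace Ω] (F : Filtration ℝ≥0 mΩ) (a b : ℝ≥0) :
    Filtration (Set.Icc a b) mΩ where
  seq t := F t
  mono' _ _ h := F.mono h
  le' t := F.le t

/-- An extended-real process is a supermartingale on `[a, b]` if it is almost surely finite at each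
time and is a supermartingale as a real process. -/
def IsSupermartingaleOn {Ω : Type*} [mΩ : MeasurableSpace Ω] (Q : Measure Ω)
    (F : Filtration ℝ≥0 mΩ) (a b : ℝ≥0) (N : ℝ≥0 → Ω → EReal) : Prop :=
  (∀ t ∈ Set.Icc a b, ∀ᵐ ω ∂Q, N t ω ≠ ⊤ ∧ N t ω ≠ ⊥) ∧
    Supermartingale (fun (t : Set.Icc a b) ω => (N t ω).toReal) (filtrationOn F a b) Q

/-- An extended-real process is a martingale on `[a, b]` if it is almost surely finite at each
time and is a martingale as a real process. -/
def IsMartingaleOn {Ω : Type*} [mΩ : MeasurableSpace Ω] (Q : Measure Ω)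
    (F : Filtration ℝ≥0 mΩ) (a b : ℝ≥0) (N : ℝ≥0 → Ω → EReal) : Prop :=
  (∀ t ∈ Set.Icc a b, ∀ᵐ ω ∂Q, N t ω ≠ ⊤ ∧ N t ω ≠ ⊥) ∧
    Martingale (fun (t : Set.Icc a b) ω => (N t ω).toReal) (filtrationOn F a b) Q

/-! ### Brownian motion and the Itô integral -/

/-- `W` is an `n`-dimensional standard Brownian motion on `[0, T]` relative to `F`. -/
structure IsBrownianMotion {Ω : Type*} [mΩ : MeasurableSpace Ω] {n : ℕ} (P : Measure Ω)
    (F : Filtration ℝ≥0 mΩ) (T : ℝ≥0) (W : ℝ≥0 → Ω → Fin n → ℝ) : Prop where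
  adapted : ∀ t ≤ T, StronglyMeasurable[F t] (W t)
  zero : ∀ᵐ ω ∂P, W 0 ω = 0
  continuous : ∀ᵐ ω ∂P, ContinuousOn (fun t => W t ω) (Set.Icc 0 T)
  law : ∀ s t, s ≤ t → t ≤ T →
    HasLaw (fun ω => W t ω - W s ω) (Measure.pi fun _ : Fin n => gaussianReal 0 (t - s)) P
  indep : ∀ s t, s ≤ t → t ≤ T →
    Indep (MeasurableSpace.comap (fun ω => W t ω - W s ω) inferInstance) (F s) P

/-- A bounded simple predictable integrand on `(a, b]`: the process
`∑_{j < k} ξ_j 1_{(τ_j, τ_{j+1}]}` with deterministic times and bounded, `F_{τ_j}`-measurable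
`ξ_j`. -/
structure SimpleIntegrand {Ω : Type*} [mΩ : MeasurableSpace Ω] (n : ℕ)
    (F : Filtration ℝ≥0 mΩ) (a b : ℝ≥0) where
  k : ℕ
  τ : ℕ → ℝ≥0
  τ_mono : Monotone τ
  τ_mem : ∀ j, τ j ∈ Set.Icc a b
  ξ : ℕ → Ω → Fin n → ℝ
  ξ_meas : ∀ j, StronglyMeasurable[F (τ j)] (ξ j)
  ξ_bdd : ∃ C : ℝ, ∀ j ω i, |ξ j ω i| ≤ C

/-- The process defined by a simple integrand. -/
def SimpleIntegrand.eval {Ω : Type*} [mΩ : MeasurableSpace Ω] {n : ℕ}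
    {F : Filtration ℝ≥0 mΩ} {a b : ℝ≥0} (S : SimpleIntegrand n F a b)
    (s : ℝ≥0) (ω : Ω) : Fin n → ℝ :=
  ∑ j ∈ Finset.range S.k, Set.indicator (Set.Ioc (S.τ j) (S.τ (j + 1))) (fun _ => S.ξ j ω) s

/-- The elementary stochastic integral `∫_a^t S dW` of a simple integrand. -/
def SimpleIntegrand.integral {Ω : Type*} [mΩ : MeasurableSpace Ω] {n : ℕ}
    {F : Filtration ℝ≥0 mΩ} {a b : ℝ≥0} (S : SimpleIntegrand n F a b)
    (W : ℝ≥0 → Ω → Fin n → ℝ) (t : ℝ≥0) (ω : Ω) : ℝ :=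
  ∑ j ∈ Finset.range S.k,
    S.ξ j ω ⬝ᵥ (W (min (S.τ (j + 1)) t) ω - W (min (S.τ j) t) ω)

/-- `I` is (a version of) the Itô integral process `I(t) = ∫_a^t f(s)ᵀ dW(s)`, `t ∈ [a, b]`: an
adapted, continuous process that is the limit in probability of the integrals of simple integrands
`S k` with `∫_a^b |f - S k|² ds → 0` in probability. -/
def IsItoIntegral {Ω : Type*} [mΩ : MeasurableSpace Ω] {n : ℕ} (P : Measure Ω)
    (F : Filtration ℝ≥0 mΩ) (W : ℝ≥0 → Ω → Fin n → ℝ) (a b : ℝ≥0)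
    (f : ℝ≥0 → Ω → Fin n → ℝ) (I : ℝ≥0 → Ω → ℝ) : Prop :=
  (∀ t ∈ Set.Icc a b, StronglyMeasurable[F t] (I t)) ∧
  (∀ᵐ ω ∂P, ContinuousOn (fun t => I t ω) (Set.Icc a b)) ∧
  ∃ S : ℕ → SimpleIntegrand n F a b,
    (∀ ε : ℝ≥0∞, 0 < ε → Tendsto (fun k => P {ω | ε ≤ ∫⁻ s in Set.Ioc a b,
        ENNReal.ofReal ((f s ω - (S k).eval s ω) ⬝ᵥ (f s ω - (S k).eval s ω)) ∂timeVol})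
      atTop (𝓝 0)) ∧
    ∀ t ∈ Set.Icc a b, TendstoInMeasure P (fun k => (S k).integral W t) atTop (I t)

open scoped Classical in
/-- The Itô integral process `t ↦ ∫_a^t f(s)ᵀ dW(s)` on `[a, b]`. -/
def itoIntegral {Ω : Type*} [mΩ : MeasurableSpace Ω] {n : ℕ} (P : Measure Ω)
    (F : Filtration ℝ≥0 mΩ) (W : ℝ≥0 → Ω → Fin n → ℝ) (a b : ℝ≥0)
    (f : ℝ≥0 → Ω → Fin n → ℝ) : ℝ≥0 → Ω → ℝ :=
  if h : ∃ I, IsItoIntegral P F W a b f I then h.choose else 0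

/-! ### The market -/

/-- The data of the model: the filtered probability space with its Brownian motion, the horizon
`T`, the coefficients `r, ρ, μ, σ` of the market with `m` stocks and `n` Brownian motions, the
portfolio constraint set `K` (for the vector of wealth proportions), the bounds
`cLow ≤ cHigh ≤ ∞` on the consumption rate, the relative risk aversion `γ`, the weight `β` of
terminal utility and the ambiguity aversion coefficients `η`. -/
structure Market (Ω : Type*) [mΩ : MeasurableSpace Ω] (m n : ℕ) where
  P : Measure Ω
  F : Filtration ℝ≥0 mΩ
  T : ℝ≥0
  W : ℝ≥0 → Ω → Fin n → ℝ
  r : ℝ≥0 → Ω → ℝ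
  ρ : ℝ≥0 → Ω → ℝ
  μ : ℝ≥0 → Ω → Fin m → ℝ
  σ : ℝ≥0 → Ω → Matrix (Fin m) (Fin n) ℝ
  K : Set (Fin m → ℝ)
  cLow : ℝ≥0
  cHigh : ℝ≥0∞
  γ : ℝ
  β : ℝ
  η : Fin n → ℝ

/-- An investment-consumption strategy `u = (p, c)`. -/
structure Strategy (Ω : Type*) (n : ℕ) where
  p : ℝ≥0 → Ω → Fin n → ℝ
  c : ℝ≥0 → Ω → ℝ

namespace Market

variable {Ω : Type*} [mΩ : MeasurableSpace Ω] {m n : ℕ} (M : Market Ω m n)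

/-- The standing assumptions on the model. -/
structure Standing : Prop where
  prob : IsProbabilityMeasure M.P
  /-- usual conditions -/
  complete : ∀ s : Set Ω, M.P s = 0 → MeasurableSet[M.F 0] s
  rightCont : M.F.IsRightContinuous
  brownian : IsBrownianMotion M.P M.F M.T M.W
  T_pos : 0 < M.T
  r_pred : IsStronglyPredictable M.F M.r
  ρ_pred : IsStronglyPredictable M.F M.ρ
  μ_pred : IsStronglyPredictable M.F M.μ
  σ_pred : IsStronglyPredictable M.F M.σ
  bounded : ∃ C : ℝ, ∀ t ≤ M.T, ∀ ω, |M.r t ω| ≤ C ∧ |M.ρ t ω| ≤ C ∧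
    (∀ i, |M.μ t ω i| ≤ C) ∧ ∀ i j, |M.σ t ω i j| ≤ C
  cov_invertible : ∀ t ≤ M.T, ∀ ω, IsUnit (M.σ t ω * (M.σ t ω)ᵀ)
  K_closed : IsClosed M.K
  K_convex : Convex ℝ M.K
  c_le : (M.cLow : ℝ≥0∞) ≤ M.cHigh
  γ_pos : 0 < M.γ
  γ_ne : M.γ ≠ 1
  β_pos : 0 < M.β
  η_pos : ∀ i, 0 < M.η i

/-- Risk premium vector `B = μ - r 1`. -/
def B (t : ℝ≥0) (ω : Ω) : Fin m → ℝ := fun i => M.μ t ω i - M.r t ω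

/-- Market price of risk `θ = σᵀ (σ σᵀ)⁻¹ B`. -/
def θ (t : ℝ≥0) (ω : Ω) : Fin n → ℝ :=
  (M.σ t ω)ᵀ *ᵥ ((M.σ t ω * (M.σ t ω)ᵀ)⁻¹ *ᵥ M.B t ω)

/-- The constraint set `Γ(t) = σ(t)ᵀ K` for the risk exposure. -/
def Γ (t : ℝ≥0) (ω : Ω) : Set (Fin n → ℝ) := (fun π => (M.σ t ω)ᵀ *ᵥ π) '' M.K

/-- `H = diag(η₁, …, ηₙ)`. -/
def H : Matrix (Fin n) (Fin n) ℝ := Matrix.diagonal M.η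

/-- Discount factor `exp(-∫_t^s ρ)`. -/
def disc (t s : ℝ≥0) (ω : Ω) : ℝ :=
  Real.exp (-∫ v in Set.Ioc t s, M.ρ v ω ∂timeVol)

/-- Power utility `y^(1-γ)/(1-γ)` on `[0, ∞)`, with value `-∞` at `0` if `γ > 1`. -/
def U₁ (y : ℝ) : EReal :=
  if y = 0 ∧ 1 < M.γ then ⊥ else ((y ^ (1 - M.γ) / (1 - M.γ) : ℝ) : EReal)

/-- Utility of terminal wealth. -/
def U₂ (x : ℝ) : EReal := (M.β : EReal) * M.U₁ x

/-! ### Distorted measures and wealth processes, for the problem started at time `t₀` -/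

/-- `Λ(t) = exp(∫_{t₀}^t φᵀ dW - ½ ∫_{t₀}^t |φ|² ds)`. -/
def density (t₀ : ℝ≥0) (φ : ℝ≥0 → Ω → Fin n → ℝ) (t : ℝ≥0) (ω : Ω) : ℝ :=
  Real.exp (itoIntegral M.P M.F M.W t₀ M.T φ t ω
    - 1 / 2 * ∫ s in Set.Ioc t₀ t, φ s ω ⬝ᵥ φ s ω ∂timeVol)

/-- The alternative measure `Q(φ)`, with `dQ(φ)/dP = Λ(T)`. -/
def Q (t₀ : ℝ≥0) (φ : ℝ≥0 → Ω → Fin n → ℝ) : Measure Ω :=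
  M.P.withDensity fun ω => ENNReal.ofReal (M.density t₀ φ M.T ω)

/-- `J(t) = ∫_{t₀}^t f(s)ᵀ dW^Q(s)` with respect to the distorted Brownian motion
`W^Q(t) = W(t) - ∫ φ ds`. -/
def IsItoIntegralQ (t₀ : ℝ≥0) (φ f : ℝ≥0 → Ω → Fin n → ℝ) (J : ℝ≥0 → Ω → ℝ) : Prop :=
  (∀ᵐ ω ∂M.P, IntegrableOn (fun s => f s ω ⬝ᵥ φ s ω) (Set.Ioc t₀ M.T) timeVol) ∧
  ∃ I, IsItoIntegral M.P M.F M.W t₀ M.T f I ∧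
    ∀ t ω, J t ω = I t ω - ∫ s in Set.Ioc t₀ t, f s ω ⬝ᵥ φ s ω ∂timeVol

/-- `X` is a non-negative solution on `[t₀, T]` of the wealth equation
`dX = X [r + pᵀ(θ + φ) - c] dt + X pᵀ dW^Q`, `X(t₀) = x₀`. -/
structure IsWealth (t₀ : ℝ≥0) (x₀ : ℝ) (u : Strategy Ω n) (φ : ℝ≥0 → Ω → Fin n → ℝ)
    (X : ℝ≥0 → Ω → ℝ) : Prop where
  adapted : ∀ t ∈ Set.Icc t₀ M.T, StronglyMeasurable[M.F t] (X t)
  continuous : ∀ᵐ ω ∂M.P, ContinuousOn (fun t => X t ω) (Set.Icc t₀ M.T)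
  nonneg : ∀ᵐ ω ∂M.P, ∀ t ∈ Set.Icc t₀ M.T, 0 ≤ X t ω
  drift_integrable : ∀ᵐ ω ∂M.P, IntegrableOn
    (fun s => X s ω * (M.r s ω + u.p s ω ⬝ᵥ (M.θ s ω + φ s ω) - u.c s ω))
    (Set.Ioc t₀ M.T) timeVol
  equation : ∃ J, M.IsItoIntegralQ t₀ φ (fun s ω => X s ω • u.p s ω) J ∧
    ∀ᵐ ω ∂M.P, ∀ t ∈ Set.Icc t₀ M.T,
      X t ω = x₀ + (∫ s in Set.Ioc t₀ t,
        X s ω * (M.r s ω + u.p s ω ⬝ᵥ (M.θ s ω + φ s ω) - u.c s ω) ∂timeVol) + J t ω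

open scoped Classical in
/-- The wealth process `X^{u,φ}` of the problem started at `(t₀, x₀)`. -/
def wealth (t₀ : ℝ≥0) (x₀ : ℝ) (u : Strategy Ω n) (φ : ℝ≥0 → Ω → Fin n → ℝ) : ℝ≥0 → Ω → ℝ :=
  if h : ∃ X, M.IsWealth t₀ x₀ u φ X then h.choose else 0

/-- `f ∈ L^q_Q(t₀, T; ℝ^k)`: `f` is adapted and `E^Q[(∫ |f|² ds)^{q/2}] < ∞`. -/
def MemLQ (t₀ : ℝ≥0) (Q : Measure Ω) (q : ℝ) {k : ℕ} (f : ℝ≥0 → Ω → Fin k → ℝ) : Prop :=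
  (∀ t ∈ Set.Icc t₀ M.T, StronglyMeasurable[M.F t] (f t)) ∧
  ∫⁻ ω, (∫⁻ s in Set.Ioc t₀ M.T, ENNReal.ofReal (f s ω ⬝ᵥ f s ω) ∂timeVol) ^ (q / 2) ∂Q < ⊤

/-- Admissibility of an investment-consumption strategy `u = (p, c)` together with a distortion
process `φ`, for the problem started at `(t₀, x₀)`. -/
structure Admissible (t₀ : ℝ≥0) (x₀ : ℝ) (u : Strategy Ω n) (φ : ℝ≥0 → Ω → Fin n → ℝ) :
    Prop where
  p_pred : IsStronglyPredictable M.F u.p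
  c_pred : IsStronglyPredictable M.F u.c
  φ_pred : IsStronglyPredictable M.F φ
  p_mem : ∀ t ∈ Set.Icc t₀ M.T, ∀ ω, u.p t ω ∈ M.Γ t ω
  c_mem : ∀ t ∈ Set.Icc t₀ M.T, ∀ ω, (M.cLow : ℝ) ≤ u.c t ω ∧ ENNReal.ofReal (u.c t ω) ≤ M.cHigh
  /-- existence and uniqueness of the non-negative wealth process -/
  wealth_exists : ∃ X, M.IsWealth t₀ x₀ u φ X
  wealth_unique : ∀ X Y, M.IsWealth t₀ x₀ u φ X → M.IsWealth t₀ x₀ u φ Y →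
    ∀ᵐ ω ∂M.P, ∀ t ∈ Set.Icc t₀ M.T, X t ω = Y t ω
  /-- `E^Q[sup |X|^q] < ∞` for all real `q ≤ 2`, negative `q` included (`0^q = ∞` for `q < 0`);
  the case `q = 2` says `X ∈ S²_Q` -/
  wealth_moments : ∀ q : ℝ, q ≤ 2 → ∫⁻ ω, ⨆ t ∈ Set.Icc t₀ M.T,
    ENNReal.ofReal |M.wealth t₀ x₀ u φ t ω| ^ q ∂(M.Q t₀ φ) < ⊤
  /-- the stochastic exponential `Λ` is well defined and a `P`-martingale -/
  ito_exists : ∃ I, IsItoIntegral M.P M.F M.W t₀ M.T φ I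
  density_martingale : Martingale (fun (t : Set.Icc t₀ M.T) ω => M.density t₀ φ t ω)
    (filtrationOn M.F t₀ M.T) M.P
  pX_mem : M.MemLQ t₀ (M.Q t₀ φ) 2 (fun s ω => M.wealth t₀ x₀ u φ s ω • u.p s ω)
  cX_mem : M.MemLQ t₀ (M.Q t₀ φ) 1
    (fun s ω => fun _ : Fin 1 => u.c s ω * M.wealth t₀ x₀ u φ s ω)
  φ_mem : M.MemLQ t₀ (M.Q t₀ φ) 2 φ

/-- The set `𝒜` of admissible investment-consumption strategies. -/
def 𝒜 (t₀ : ℝ≥0) (x₀ : ℝ) : Set (Strategy Ω n) := {u | ∃ φ, M.Admissible t₀ x₀ u φ}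

/-- The set `ℬ` of admissible distortion processes (facing the strategy `u`). -/
def ℬ (t₀ : ℝ≥0) (x₀ : ℝ) (u : Strategy Ω n) : Set (ℝ≥0 → Ω → Fin n → ℝ) :=
  {φ | M.Admissible t₀ x₀ u φ}

/-! ### The robust control problem -/

/-- Discounted payoff `∫_t^T e^{-∫_t^s ρ} q(s) ds + e^{-∫_t^T ρ} U₂(X(T))` with running reward
`q`. -/
def payoff (q : ℝ≥0 → Ω → EReal) (X : ℝ≥0 → Ω → ℝ) (t : ℝ≥0) (ω : Ω) : EReal :=
  eintegral (timeVol.restrict (Set.Ioc t M.T)) (fun s => (M.disc t s ω : EReal) * q s ω)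
    + (M.disc t M.T ω : EReal) * M.U₂ (X M.T ω)

/-- The normaliser `Ψ_i = η_i / ((1 - γ) V(s, X(s)))` of the penalty. -/
def Ψ (V : ℝ≥0 → Ω → ℝ → ℝ) (X : ℝ≥0 → Ω → ℝ) (i : Fin n) (s : ℝ≥0) (ω : Ω) : ℝ :=
  M.η i / ((1 - M.γ) * V s ω (X s ω))

/-- The running reward of the robust problem: utility of consumption plus the penalty. -/
def reward (V : ℝ≥0 → Ω → ℝ → ℝ) (u : Strategy Ω n) (φ : ℝ≥0 → Ω → Fin n → ℝ)
    (X : ℝ≥0 → Ω → ℝ) (s : ℝ≥0) (ω : Ω) : EReal :=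
  M.U₁ (u.c s ω * X s ω) + ((∑ i, φ s ω i ^ 2 / (2 * M.Ψ V X i s ω) : ℝ) : EReal)

/-- The conditional objective at time `t ≥ t₀`:
`E^{Q(φ)}[∫_t^T e^{-∫_t^s ρ} (U₁(c X) + ∑ φ_i²/(2Ψ_i)) ds + e^{-∫_t^T ρ} U₂(X(T)) | F_t]`. -/
def objective (V : ℝ≥0 → Ω → ℝ → ℝ) (t₀ : ℝ≥0) (x₀ : ℝ) (u : Strategy Ω n)
    (φ : ℝ≥0 → Ω → Fin n → ℝ) (t : ℝ≥0) : Ω → EReal :=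
  econdExp (M.Q t₀ φ) (M.F t)
    (M.payoff (M.reward V u φ (M.wealth t₀ x₀ u φ)) (M.wealth t₀ x₀ u φ) t)

/-- Admissible pairs whose wealth at time `t` is `ξ`. -/
def pairsAt (t₀ : ℝ≥0) (x₀ : ℝ) (t : ℝ≥0) (ξ : Ω → ℝ) :
    Set (Strategy Ω n × (ℝ≥0 → Ω → Fin n → ℝ)) :=
  {a | a.1 ∈ M.𝒜 t₀ x₀ ∧ a.2 ∈ M.ℬ t₀ x₀ a.1 ∧ M.wealth t₀ x₀ a.1 a.2 t =ᵐ[M.P] ξ}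

/-- `Z` is the inner infimum, over distortion processes, of the objective of `u` given `F_t` and
`X(t) = ξ`. -/
def IsWorstCase (V : ℝ≥0 → Ω → ℝ → ℝ) (t₀ : ℝ≥0) (x₀ : ℝ) (t : ℝ≥0) (ξ : Ω → ℝ)
    (u : Strategy Ω n) (Z : Ω → EReal) : Prop :=
  IsEssInf M.P (M.F t)
    {Y | ∃ φ, (u, φ) ∈ M.pairsAt t₀ x₀ t ξ ∧ Y = M.objective V t₀ x₀ u φ t} Z

/-- `Z` is the sup-inf value given `F_t` and `X(t) = ξ` of the robust problem whose penalty
is normalised with `V`. -/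
def IsRobustValue (V : ℝ≥0 → Ω → ℝ → ℝ) (t₀ : ℝ≥0) (x₀ : ℝ) (t : ℝ≥0) (ξ : Ω → ℝ)
    (Z : Ω → EReal) : Prop :=
  ∃ I : Strategy Ω n → Ω → EReal,
    (∀ u φ, (u, φ) ∈ M.pairsAt t₀ x₀ t ξ → M.IsWorstCase V t₀ x₀ t ξ u (I u)) ∧
    IsEssSup M.P (M.F t) {Y | ∃ u φ, (u, φ) ∈ M.pairsAt t₀ x₀ t ξ ∧ Y = I u} Z

/-- `V` is a value function of the robust problem: `V(t, x)` is the sup-inf value of the problem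
started at `(t, x)`, the penalty being normalised with `V` itself. -/
def IsValueFunction (V : ℝ≥0 → Ω → ℝ → ℝ) : Prop :=
  ∀ t ≤ M.T, ∀ x : ℝ, 0 < x →
    M.IsRobustValue V t x t (fun _ => x) (fun ω => (V t ω x : EReal))

/-! ### The martingale optimality conditions -/

/-- `R(s, X, u, φ) = (1-γ)/2 φᵀ H⁻¹ φ v(s, X(s)) + U₁(c X)`. -/
def R (v : ℝ≥0 → Ω → ℝ → ℝ) (u : Strategy Ω n) (φ : ℝ≥0 → Ω → Fin n → ℝ)
    (X : ℝ≥0 → Ω → ℝ) (s : ℝ≥0) (ω : Ω) : EReal :=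
  (((1 - M.γ) / 2 * (φ s ω ⬝ᵥ (M.H⁻¹ *ᵥ φ s ω)) * v s ω (X s ω) : ℝ) : EReal)
    + M.U₁ (u.c s ω * X s ω)

/-- The cost process
`N(t) = ∫_{t₀}^t e^{-∫_{t₀}^s ρ} R ds + e^{-∫_{t₀}^t ρ} v(t, X(t))`. -/
def N (v : ℝ≥0 → Ω → ℝ → ℝ) (t₀ : ℝ≥0) (x₀ : ℝ) (u : Strategy Ω n)
    (φ : ℝ≥0 → Ω → Fin n → ℝ) (t : ℝ≥0) (ω : Ω) : EReal :=
  eintegral (timeVol.restrict (Set.Ioc t₀ t))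
      (fun s => (M.disc t₀ s ω : EReal) * M.R v u φ (M.wealth t₀ x₀ u φ) s ω)
    + ((M.disc t₀ t ω * v t ω (M.wealth t₀ x₀ u φ t ω) : ℝ) : EReal)

/-- `E^{Q(φ)}[∫_{t₀}^T e^{-∫_{t₀}^s ρ} R ds + e^{-∫_{t₀}^T ρ} U₂(X(T))]`. -/
def cost (v : ℝ≥0 → Ω → ℝ → ℝ) (t₀ : ℝ≥0) (x₀ : ℝ) (u : Strategy Ω n)
    (φ : ℝ≥0 → Ω → Fin n → ℝ) : EReal :=
  eintegral (M.Q t₀ φ)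
    (M.payoff (M.R v u φ (M.wealth t₀ x₀ u φ)) (M.wealth t₀ x₀ u φ) t₀)

/-- Regularity of the random field `v` on `[0, T] × (0, ∞)` and its terminal condition. -/
structure Regular (v : ℝ≥0 → Ω → ℝ → ℝ) : Prop where
  smooth : ∀ᵐ ω ∂M.P, ∀ t ≤ M.T, ContDiffOn ℝ 2 (v t ω) (Set.Ioi 0)
  adapted : ∀ x : ℝ, 0 < x → ∀ t ≤ M.T, StronglyMeasurable[M.F t] (fun ω => v t ω x)
  continuous : ∀ x : ℝ, 0 < x → ∀ᵐ ω ∂M.P, ContinuousOn (fun t => v t ω x) (Set.Icc 0 M.T)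
  terminal : ∀ x : ℝ, 0 < x → ∀ᵐ ω ∂M.P, (v M.T ω x : EReal) = M.U₂ x

/-- The two conditions of the martingale optimality principle, for the problem started at
`(t₀, x₀)`. -/
structure OptimalityConditions (v : ℝ≥0 → Ω → ℝ → ℝ) (t₀ : ℝ≥0) (x₀ : ℝ)
    (uStar : Strategy Ω n) (φStar : ℝ≥0 → Ω → Fin n → ℝ) : Prop where
  supermartingale : ∀ u ∈ M.𝒜 t₀ x₀, ∃ φ ∈ M.ℬ t₀ x₀ u,
    IsSupermartingaleOn (M.Q t₀ φ) M.F t₀ M.T (M.N v t₀ x₀ u φ)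
  uStar_mem : uStar ∈ M.𝒜 t₀ x₀
  φStar_mem : φStar ∈ M.ℬ t₀ x₀ uStar
  attained : ⨅ φ ∈ M.ℬ t₀ x₀ uStar, M.cost v t₀ x₀ uStar φ = M.cost v t₀ x₀ uStar φStar
  martingale : IsMartingaleOn (M.Q t₀ φStar) M.F t₀ M.T (M.N v t₀ x₀ uStar φStar)

end Market

end RobustMerton

end

/-!
Along an admissible pair `(u, φ)` the wealth `X` does not depend on `φ`, because the drift
`p ⬝ᵥ φ` and the change from `W` to `W^Q` cancel (`Market.Admissible.wealth_eq`), and it is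
strictly positive by the negative moments (`Market.Admissible.wealth_pos`). Where the cost process
`N` is finite, the total payoff splits as `N(T) = G + D Y`, with `Y` the payoff from `t` on, `D > 0`
the discount factor and `G` the reward accrued up to `t`, both known at time `t`, while
`N(t) = G + D v(t, X(t))`. Taking conditional expectations, which for extended-real payoffs commute
with affine maps of known coefficients (`econdExp_affine`), a supermartingale `N` gives
`objective ≤ v(t, X(t))` and a martingale `N` gives equality
(`Market.objective_le_of_supermartingale`, `Market.objective_eq_of_martingale`). So no strategy has
a worst case above `v(t, X(t))`.

What remains is that `φStar`, assumed to be optimal only for the expectation at time `t₀`, is a worst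
case for `uStar` conditionally on `F_t` as well (`Market.field_le_objective`). If another admissible
`φ` had a smaller conditional objective on an event of positive probability, then switching from
`φStar` to `φ` at time `t` on a part `A` of that event would lower the cost, contradicting the
minimality of `φStar`. The switched distortion has to be admissible. This holds when, on `A`, the
ratio of the two density processes at time `t` and the energy of `φStar` up to `t` are bounded
(`Market.Admissible.paste`), which is no loss as `A` may be shrunk. Its Itô integral is the pasted
integral of the two distortions (`IsItoIntegral.paste`, `IsItoIntegral.ae_eq`): simple integrands are
pasted on a common partition, and uniqueness of the Itô integral rests on the isometry for simple
integrands and a stopping argument (`SimpleIntegrand.measure_integral_ge_le`). The conditional payoff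
may be `-∞`, with the convention `∞ - ∞ = -∞`, so the case where its negative part has infinite
conditional expectation is treated separately: then already the cost of the switched distortion
is `-∞`.

The worst-case values of the strategies other than `uStar` exist as essential infima
(`exists_isEssInf`) and lie below the objective of the distortion given by the supermartingale
condition.
-/

noncomputable section

namespace RobustMerton

/-! ### The time axis -/

lemma timeVol_apply {s : Set ℝ≥0} : timeVol s = volume (((↑) : ℝ≥0 → ℝ) '' s) :=
  (MeasurableEmbedding.subtype_coe measurableSet_Ici).comap_apply _ s

lemma timeVol_Ioc (a b : ℝ≥0) : timeVol (Set.Ioc a b) = ENNReal.ofReal (b - a) := by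
  rw [timeVol_apply]
  have : ((↑) : ℝ≥0 → ℝ) '' Set.Ioc a b = Set.Ioc (a : ℝ) b := by
    ext x
    constructor
    · rintro ⟨y, hy, rfl⟩
      exact ⟨by exact_mod_cast hy.1, by exact_mod_cast hy.2⟩
    · intro hx
      exact ⟨⟨x, a.2.trans hx.1.le⟩, ⟨NNReal.coe_lt_coe.1 hx.1, NNReal.coe_le_coe.1 hx.2⟩, rfl⟩
  rw [this, Real.volume_Ioc]

instance : IsLocallyFiniteMeasure timeVol := by
  refine ⟨fun x => ⟨Set.Iio (x + 1), Iio_mem_nhds (by simp), ?_⟩⟩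
  rw [timeVol_apply]
  refine (measure_mono (t := Set.Icc (0 : ℝ) (x + 1)) ?_).trans_lt (by simp)
  rintro _ ⟨y, hy, rfl⟩
  exact ⟨y.2, by exact_mod_cast (Set.mem_Iio.1 hy).le⟩

/-! ### Algebra of simple integrands -/

namespace SimpleIntegrand

variable {Ω : Type*} [mΩ : MeasurableSpace Ω] {n : ℕ} {F : Filtration ℝ≥0 mΩ} {a b : ℝ≥0}

/-- The sum `∑ⱼ (Ψ(τⱼ₊₁) - Ψ(τⱼ)) ξⱼ` for a family `Ψ` of additive maps. Both the value of a simple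
integrand at a time and its stochastic integral are of this form. -/
def incSum {E : Type*} [AddCommGroup E] (S : SimpleIntegrand n F a b)
    (Ψ : ℝ≥0 → (Fin n → ℝ) →+ E) (ω : Ω) : E :=
  ∑ j ∈ Finset.range S.k, (Ψ (S.τ (j + 1)) - Ψ (S.τ j)) (S.ξ j ω)

/-- The maps `Ψ` for which `incSum` is the value at time `s`. -/
def evalInc (n : ℕ) (s x : ℝ≥0) : (Fin n → ℝ) →+ (Fin n → ℝ) :=
  if s ≤ x then AddMonoidHom.id _ else 0

/-- The maps `Ψ` for which `incSum` is the stochastic integral up to time `t` at `ω`. -/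
def integralInc (W : ℝ≥0 → Ω → Fin n → ℝ) (t : ℝ≥0) (ω : Ω) (x : ℝ≥0) : (Fin n → ℝ) →+ ℝ :=
  AddMonoidHom.mk' (fun ξ => ξ ⬝ᵥ W (min x t) ω) fun _ _ => add_dotProduct _ _ _

lemma eval_eq_incSum (S : SimpleIntegrand n F a b) (s : ℝ≥0) (ω : Ω) :
    S.eval s ω = S.incSum (evalInc n s) ω := by
  refine Finset.sum_congr rfl fun j _ => ?_
  have := S.τ_mono (Nat.le_succ j)
  simp only [evalInc, AddMonoidHom.sub_apply, Set.indicator_apply, Set.mem_Ioc]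
  by_cases h1 : s ≤ S.τ j
  · have h2 : s ≤ S.τ (j + 1) := h1.trans this
    simp [h1, h2]
  · by_cases h2 : s ≤ S.τ (j + 1) <;> simp [h1, h2, not_le.1 h1]

lemma integral_eq_incSum (S : SimpleIntegrand n F a b) (W : ℝ≥0 → Ω → Fin n → ℝ) (t : ℝ≥0) (ω : Ω) :
    S.integral W t ω = S.incSum (integralInc W t ω) ω := by
  refine Finset.sum_congr rfl fun j _ => ?_
  simp [integralInc, dotProduct_sub]

/-- The increasing enumeration of the finite set `G`, continued by the constant `b`. -/
def enum (G : Finset ℝ≥0) (b : ℝ≥0) (j : ℕ) : ℝ≥0 :=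
  if h : j < G.card then G.orderEmbOfFin rfl ⟨j, h⟩ else b

lemma enum_of_lt {G : Finset ℝ≥0} {j : ℕ} (h : j < G.card) :
    enum G b j = G.orderEmbOfFin rfl ⟨j, h⟩ := dif_pos h

lemma enum_mem {G : Finset ℝ≥0} (hG : ∀ x ∈ G, x ∈ Set.Icc a b) (hab : a ≤ b) (j : ℕ) :
    enum G b j ∈ Set.Icc a b := by
  unfold enum
  split_ifs with h
  · exact hG _ (G.orderEmbOfFin_mem rfl _)
  · exact ⟨hab, le_rfl⟩

lemma enum_mono {G : Finset ℝ≥0} (hG : ∀ x ∈ G, x ∈ Set.Icc a b) : Monotone (enum G b) := by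
  intro i j hij
  unfold enum
  split_ifs with h1 h2 h2
  · simpa using hij
  · exact (hG _ (G.orderEmbOfFin_mem rfl _)).2
  · omega
  · exact le_rfl

lemma enum_lt_iff {G : Finset ℝ≥0} {i j : ℕ} (hi : i < G.card) (hj : j < G.card) :
    enum G b i < enum G b j ↔ i < j := by
  rw [enum_of_lt hi, enum_of_lt hj]
  simp

lemma enum_le_iff {G : Finset ℝ≥0} {i j : ℕ} (hi : i < G.card) (hj : j < G.card) :
    enum G b i ≤ enum G b j ↔ i ≤ j := by
  rw [enum_of_lt hi, enum_of_lt hj]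
  simp

lemma exists_enum_eq {G : Finset ℝ≥0} {x : ℝ≥0} (hx : x ∈ G) :
    ∃ p, p < G.card ∧ enum G b p = x := by
  have : x ∈ Set.range (G.orderEmbOfFin rfl) := by rw [Finset.range_orderEmbOfFin]; exact hx
  obtain ⟨p, hp⟩ := this
  exact ⟨p, p.2, by rw [enum_of_lt p.2]; exact hp⟩

/-- Refining the partition of a simple integrand does not change the sums `incSum`. -/
lemma incSum_refine {E : Type*} [AddCommGroup E] (S : SimpleIntegrand n F a b) {G : Finset ℝ≥0}
    (hS : ∀ i ≤ S.k, S.τ i ∈ G) (Ψ : ℝ≥0 → (Fin n → ℝ) →+ E) (ω : Ω) :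
    ∑ j ∈ Finset.range (G.card - 1),
      (Ψ (enum G b (j + 1)) - Ψ (enum G b j)) (S.eval (enum G b (j + 1)) ω) = S.incSum Ψ ω := by
  simp only [eval, map_sum, incSum]
  rw [Finset.sum_comm]
  refine Finset.sum_congr rfl fun i hi => ?_
  have hi' := Finset.mem_range.1 hi
  obtain ⟨p, hp, hpe⟩ := exists_enum_eq (b := b) (hS i hi'.le)
  obtain ⟨q, hq, hqe⟩ := exists_enum_eq (b := b) (hS (i + 1) hi')
  have hpq : p ≤ q := by
    rw [← enum_le_iff (b := b) hp hq, hpe, hqe]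
    exact S.τ_mono (Nat.le_succ i)
  have key : ∀ j ∈ Finset.range (G.card - 1),
      (Ψ (enum G b (j + 1)) - Ψ (enum G b j))
        ((Set.Ioc (S.τ i) (S.τ (i + 1))).indicator (fun _ => S.ξ i ω) (enum G b (j + 1)))
      = if j ∈ Finset.Ico p q then Ψ (enum G b (j + 1)) (S.ξ i ω) - Ψ (enum G b j) (S.ξ i ω)
        else 0 := by
    intro j hj
    have hj' : j + 1 < G.card := by have := Finset.mem_range.1 hj; omega
    have hmem : enum G b (j + 1) ∈ Set.Ioc (S.τ i) (S.τ (i + 1)) ↔ j ∈ Finset.Ico p q := by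
      rw [← hpe, ← hqe, Set.mem_Ioc, enum_lt_iff hp hj', enum_le_iff hj' hq, Finset.mem_Ico]
      omega
    by_cases h : j ∈ Finset.Ico p q
    · rw [Set.indicator_of_mem (hmem.2 h), if_pos h, AddMonoidHom.sub_apply]
    · rw [Set.indicator_of_notMem (fun h' => h (hmem.1 h')), if_neg h, map_zero]
  rw [Finset.sum_congr rfl key, ← Finset.sum_filter, AddMonoidHom.sub_apply, ← hpe, ← hqe]
  have : (Finset.range (G.card - 1)).filter (fun j => j ∈ Finset.Ico p q) = Finset.Ico p q := by
    ext j
    simp only [Finset.mem_filter, Finset.mem_range, Finset.mem_Ico]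
    omega
  rw [this, Finset.sum_Ico_sub (fun j => Ψ (enum G b j) (S.ξ i ω)) hpq]

lemma stronglyMeasurable_eval_enum (S : SimpleIntegrand n F a b) {G : Finset ℝ≥0}
    (hS : ∀ i ≤ S.k, S.τ i ∈ G) {j : ℕ} (hj : j + 1 < G.card) :
    StronglyMeasurable[F (enum G b j)] (S.eval (enum G b (j + 1))) := by
  have : S.eval (enum G b (j + 1)) = ∑ i ∈ Finset.range S.k, fun ω =>
      (Set.Ioc (S.τ i) (S.τ (i + 1))).indicator (fun _ => S.ξ i ω) (enum G b (j + 1)) := by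
    ext1 ω
    rw [Finset.sum_apply]
    rfl
  rw [this]
  refine Finset.stronglyMeasurable_sum _ fun i hi => ?_
  by_cases h : enum G b (j + 1) ∈ Set.Ioc (S.τ i) (S.τ (i + 1))
  · simp only [Set.indicator_of_mem h]
    obtain ⟨p, hp, hpe⟩ := exists_enum_eq (b := b) (hS i (Finset.mem_range.1 hi).le)
    have hpj : S.τ i ≤ enum G b j := by
      rw [← hpe, Set.mem_Ioc, enum_lt_iff hp hj] at h
      rw [← hpe, enum_le_iff hp (by omega)]
      omega
    exact (S.ξ_meas i).mono (F.mono hpj)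
  · simp only [Set.indicator_of_notMem h]
    exact stronglyMeasurable_const

lemma abs_eval_le (S : SimpleIntegrand n F a b) {C : ℝ} (hC : ∀ j ω i, |S.ξ j ω i| ≤ C)
    (s : ℝ≥0) (ω : Ω) (i : Fin n) : |S.eval s ω i| ≤ S.k * C := by
  rw [eval, Finset.sum_apply]
  refine (Finset.abs_sum_le_sum_abs _ _).trans ?_
  refine (Finset.sum_le_card_nsmul _ _ C fun j _ => ?_).trans (by simp)
  rw [Set.indicator_apply]
  split_ifs
  · exact hC j ω i
  · simpa using (abs_nonneg _).trans (hC j ω i)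

/-- The partition points of two simple integrands. -/
def commonGrid (S S' : SimpleIntegrand n F a b) : Finset ℝ≥0 :=
  (Finset.range (S.k + 1)).image S.τ ∪ (Finset.range (S'.k + 1)).image S'.τ

lemma mem_commonGrid_left (S S' : SimpleIntegrand n F a b) (i : ℕ) (hi : i ≤ S.k) :
    S.τ i ∈ commonGrid S S' :=
  Finset.mem_union_left _ (Finset.mem_image_of_mem _ (Finset.mem_range.2 (by omega)))

lemma mem_commonGrid_right (S S' : SimpleIntegrand n F a b) (i : ℕ) (hi : i ≤ S'.k) :
    S'.τ i ∈ commonGrid S S' :=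
  Finset.mem_union_right _ (Finset.mem_image_of_mem _ (Finset.mem_range.2 (by omega)))

lemma commonGrid_subset (S S' : SimpleIntegrand n F a b) :
    ∀ x ∈ commonGrid S S', x ∈ Set.Icc a b := by
  intro x hx
  rcases Finset.mem_union.1 hx with h | h
  · obtain ⟨i, -, rfl⟩ := Finset.mem_image.1 h
    exact S.τ_mem i
  · obtain ⟨i, -, rfl⟩ := Finset.mem_image.1 h
    exact S'.τ_mem i

open scoped Classical in
/-- The sum of two simple integrands, on the common refinement of their partitions. -/
def add (S S' : SimpleIntegrand n F a b) : SimpleIntegrand n F a b where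
  k := (commonGrid S S').card - 1
  τ := enum (commonGrid S S') b
  τ_mono := enum_mono (commonGrid_subset S S')
  τ_mem := enum_mem (commonGrid_subset S S') ((S.τ_mem 0).1.trans (S.τ_mem 0).2)
  ξ j ω := if j + 1 < (commonGrid S S').card then
    S.eval (enum (commonGrid S S') b (j + 1)) ω + S'.eval (enum (commonGrid S S') b (j + 1)) ω else 0
  ξ_meas j := by
    by_cases h : j + 1 < (commonGrid S S').card
    · simp only [if_pos h]
      exact (S.stronglyMeasurable_eval_enum (mem_commonGrid_left S S') h).add
        (S'.stronglyMeasurable_eval_enum (mem_commonGrid_right S S') h)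
    · simp only [if_neg h]
      exact stronglyMeasurable_const
  ξ_bdd := by
    obtain ⟨C, hC⟩ := S.ξ_bdd
    obtain ⟨C', hC'⟩ := S'.ξ_bdd
    refine ⟨|S.k * C| + |S'.k * C'|, fun j ω i => ?_⟩
    split_ifs
    · exact (abs_add_le _ _).trans (add_le_add ((S.abs_eval_le hC _ _ _).trans (le_abs_self _))
        ((S'.abs_eval_le hC' _ _ _).trans (le_abs_self _)))
    · simp only [Pi.zero_apply, abs_zero]
      positivity

lemma incSum_add {E : Type*} [AddCommGroup E] (S S' : SimpleIntegrand n F a b)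
    (Ψ : ℝ≥0 → (Fin n → ℝ) →+ E) (ω : Ω) :
    (S.add S').incSum Ψ ω = S.incSum Ψ ω + S'.incSum Ψ ω := by
  rw [← S.incSum_refine (mem_commonGrid_left S S'), ← S'.incSum_refine (mem_commonGrid_right S S'),
    ← Finset.sum_add_distrib]
  refine Finset.sum_congr rfl fun j hj => ?_
  have hj' : j + 1 < (commonGrid S S').card := by
    have : j < (commonGrid S S').card - 1 := Finset.mem_range.1 hj
    omega
  rw [← map_add]
  simp only [add, if_pos hj']

/-- The difference of two simple integrands. -/
def sub (S S' : SimpleIntegrand n F a b) : SimpleIntegrand n F a b :=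
  S.add { S' with
    ξ := fun j ω => -S'.ξ j ω
    ξ_meas := fun j => (S'.ξ_meas j).neg
    ξ_bdd := by simpa using S'.ξ_bdd }

lemma incSum_sub {E : Type*} [AddCommGroup E] (S S' : SimpleIntegrand n F a b)
    (Ψ : ℝ≥0 → (Fin n → ℝ) →+ E) (ω : Ω) :
    (S.sub S').incSum Ψ ω = S.incSum Ψ ω - S'.incSum Ψ ω := by
  rw [sub, incSum_add, sub_eq_add_neg]
  simp only [incSum, map_neg, Finset.sum_neg_distrib]

open scoped Classical in
/-- The simple integrand `1_{(t, b]} 1_A S`. -/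
def restrict (S : SimpleIntegrand n F a b) {t : ℝ≥0} (ht : t ∈ Set.Icc a b) {A : Set Ω}
    (hA : MeasurableSet[F t] A) : SimpleIntegrand n F a b where
  k := S.k
  τ j := max (S.τ j) t
  τ_mono i j hij := max_le_max_right _ (S.τ_mono hij)
  τ_mem j := ⟨ht.1.trans (le_max_right _ _), max_le (S.τ_mem j).2 ht.2⟩
  ξ j := A.indicator (S.ξ j)
  ξ_meas j := ((S.ξ_meas j).mono (F.mono (le_max_left _ _))).indicator
    (F.mono (le_max_right _ _) _ hA)
  ξ_bdd := by
    obtain ⟨C, hC⟩ := S.ξ_bdd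
    refine ⟨|C|, fun j ω i => ?_⟩
    by_cases h : ω ∈ A
    · rw [Set.indicator_of_mem h]
      exact (hC j ω i).trans (le_abs_self C)
    · simp [Set.indicator_of_notMem h]

lemma eval_restrict (S : SimpleIntegrand n F a b) {t : ℝ≥0} (ht : t ∈ Set.Icc a b) {A : Set Ω}
    (hA : MeasurableSet[F t] A) (s : ℝ≥0) (ω : Ω) :
    (S.restrict ht hA).eval s ω = A.indicator (fun ω => if t < s then S.eval s ω else 0) ω := by
  by_cases h : ω ∈ A
  · by_cases hs : t < s
    · simp only [eval, restrict, h, Set.indicator_of_mem, hs, if_true]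
      refine Finset.sum_congr rfl fun j _ => ?_
      simp [Set.indicator_apply, hs, hs.not_ge]
    · simp [eval, restrict, h, hs]
  · simp [eval, restrict, h]

lemma integral_restrict (S : SimpleIntegrand n F a b) {t : ℝ≥0} (ht : t ∈ Set.Icc a b) {A : Set Ω}
    (hA : MeasurableSet[F t] A) (W : ℝ≥0 → Ω → Fin n → ℝ) (s : ℝ≥0) (ω : Ω) :
    (S.restrict ht hA).integral W s ω
      = A.indicator (fun ω => S.integral W (max s t) ω - S.integral W t ω) ω := by
  by_cases h : ω ∈ A
  · simp only [integral, restrict, h, Set.indicator_of_mem]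
    rw [← Finset.sum_sub_distrib]
    refine Finset.sum_congr rfl fun j _ => ?_
    have key : ∀ x : ℝ≥0, W (min (max x t) s) ω
        = W (min x (max s t)) ω - W (min x t) ω + W (min t s) ω := by
      intro x
      rcases le_total x t with hx | hx
      · rw [max_eq_right hx, min_eq_left hx, min_eq_left (hx.trans (le_max_right _ _))]
        simp
      · rw [max_eq_left hx, min_eq_right hx]
        rcases le_total s t with hs | hs
        · rw [max_eq_right hs, min_eq_right hx, min_eq_right (hs.trans hx), min_eq_right hs]
          simp
        · rw [max_eq_left hs, min_eq_left hs]
          simp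
    rw [← dotProduct_sub, key, key]
    congr 1
    abel
  · simp [integral, restrict, h]

lemma eval_sub (S S' : SimpleIntegrand n F a b) (s : ℝ≥0) (ω : Ω) :
    (S.sub S').eval s ω = S.eval s ω - S'.eval s ω := by
  simp only [eval_eq_incSum, incSum_sub]

lemma integral_sub (S S' : SimpleIntegrand n F a b) (W : ℝ≥0 → Ω → Fin n → ℝ) (t : ℝ≥0) (ω : Ω) :
    (S.sub S').integral W t ω = S.integral W t ω - S'.integral W t ω := by
  simp only [integral_eq_incSum, incSum_sub]

/-- The simple integrand that follows `S` up to time `t`, and after `t` follows `S'` on `A` and `S`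
off `A`. -/
def paste (S S' : SimpleIntegrand n F a b) {t : ℝ≥0} (ht : t ∈ Set.Icc a b) {A : Set Ω}
    (hA : MeasurableSet[F t] A) : SimpleIntegrand n F a b :=
  S.add ((S'.sub S).restrict ht hA)

lemma eval_paste (S S' : SimpleIntegrand n F a b) {t : ℝ≥0} (ht : t ∈ Set.Icc a b) {A : Set Ω}
    (hA : MeasurableSet[F t] A) (s : ℝ≥0) (ω : Ω) [Decidable (t < s ∧ ω ∈ A)] :
    (S.paste S' ht hA).eval s ω = if t < s ∧ ω ∈ A then S'.eval s ω else S.eval s ω := by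
  have : (S.paste S' ht hA).eval s ω = S.eval s ω + ((S'.sub S).restrict ht hA).eval s ω := by
    simp only [eval_eq_incSum, paste, incSum_add]
  rw [this, eval_restrict]
  by_cases h : ω ∈ A <;> by_cases hs : t < s <;> simp [h, hs, eval_sub]

lemma integral_paste (S S' : SimpleIntegrand n F a b) {t : ℝ≥0} (ht : t ∈ Set.Icc a b) {A : Set Ω}
    (hA : MeasurableSet[F t] A) (W : ℝ≥0 → Ω → Fin n → ℝ) (s : ℝ≥0) (ω : Ω) :
    (S.paste S' ht hA).integral W s ω = S.integral W s ω + A.indicator (fun ω =>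
      (S'.integral W (max s t) ω - S.integral W (max s t) ω)
        - (S'.integral W t ω - S.integral W t ω)) ω := by
  have : (S.paste S' ht hA).integral W s ω
      = S.integral W s ω + ((S'.sub S).restrict ht hA).integral W s ω := by
    simp only [integral_eq_incSum, paste, incSum_add]
  rw [this, integral_restrict]
  by_cases h : ω ∈ A <;> simp [h, integral_sub]

lemma measurable_eval (S : SimpleIntegrand n F a b) (ω : Ω) : Measurable fun s => S.eval s ω := by
  unfold eval
  exact Finset.measurable_fun_sum _ fun j _ => measurable_const.indicator measurableSet_Ioc

end SimpleIntegrand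

/-! ### The Itô isometry for simple integrands -/

section Isometry

variable {Ω : Type*} [mΩ : MeasurableSpace Ω] {n : ℕ} {P : Measure Ω} {F : Filtration ℝ≥0 mΩ}
  {T : ℝ≥0} {W : ℝ≥0 → Ω → Fin n → ℝ}

namespace IsBrownianMotion

variable (hW : IsBrownianMotion P F T W) {s t : ℝ≥0} (hst : s ≤ t) (htT : t ≤ T)
include hW hst htT

lemma hasLaw_coord (i : Fin n) :
    HasLaw (fun ω => W t ω i - W s ω i) (gaussianReal 0 (t - s)) P :=
  (measurePreserving_eval (fun _ : Fin n => gaussianReal 0 (t - s)) i).hasLaw.comp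
    (hW.law s t hst htT)

lemma memLp_coord (i : Fin n) : MemLp (fun ω => W t ω i - W s ω i) 2 P := by
  have h := (hW.hasLaw_coord hst htT i)
  have h2 := memLp_id_gaussianReal (μ := 0) (v := t - s) 2
  rw [← h.map_eq] at h2
  exact (memLp_map_measure_iff h2.1 h.aemeasurable).1 h2

lemma integral_coord (i : Fin n) : ∫ ω, (W t ω i - W s ω i) ∂P = 0 := by
  rw [(hW.hasLaw_coord hst htT i).integral_eq]
  simp

lemma integral_coord_mul (i j : Fin n) :
    ∫ ω, (W t ω i - W s ω i) * (W t ω j - W s ω j) ∂P = if i = j then ((t : ℝ) - s) else 0 := by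
  split_ifs with h
  · subst h
    have h := (hW.hasLaw_coord hst htT i)
    have := h.variance_eq
    rw [variance_id_gaussianReal, variance_of_integral_eq_zero h.aemeasurable
      (hW.integral_coord hst htT i), NNReal.coe_sub hst] at this
    rw [← this]
    simp [pow_two]
  · have hl := hW.law s t hst htT
    have hp : iIndepFun (fun (i : Fin n) (x : Fin n → ℝ) => x i)
        (Measure.pi fun _ : Fin n => gaussianReal 0 (t - s)) :=
      iIndepFun_pi (X := fun _ x => x) fun _ => aemeasurable_id
    have h2 : ∫ x : Fin n → ℝ, x i * x j ∂(Measure.pi fun _ : Fin n => gaussianReal 0 (t - s))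
        = 0 := by
      rw [(hp.indepFun h).integral_fun_mul_eq_mul_integral
        (measurable_pi_apply i).aestronglyMeasurable (measurable_pi_apply j).aestronglyMeasurable]
      have := (measurePreserving_eval (fun _ : Fin n => gaussianReal 0 (t - s)) i).hasLaw.integral_eq
      simp only [Function.eval] at this
      rw [this]
      simp
    rw [← hl.map_eq, integral_map hl.aemeasurable (by fun_prop)] at h2
    exact h2

lemma indepFun_coord {Y : Ω → ℝ} (hY : Measurable[F s] Y) (i : Fin n) :
    IndepFun Y (fun ω => W t ω i - W s ω i) P := by
  have h := hW.indep s t hst htT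
  refine (IndepFun_iff_Indep _ _ _).2 ?_
  refine indep_of_indep_of_le_left (indep_of_indep_of_le_right h.symm ?_) hY.comap_le
  have : (fun ω => W t ω i - W s ω i) = (fun x : Fin n → ℝ => x i) ∘ fun ω => W t ω - W s ω := rfl
  rw [this, ← MeasurableSpace.comap_comp]
  exact MeasurableSpace.comap_mono (measurable_pi_apply i).comap_le

variable {ξ : Ω → Fin n → ℝ} (hξ : StronglyMeasurable[F s] ξ) {C : ℝ}
  (hC : ∀ ω i, |ξ ω i| ≤ C)
include hξ hC

lemma memLp_dotProduct : MemLp (fun ω => ξ ω ⬝ᵥ (W t ω - W s ω)) 2 P := by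
  simp only [dotProduct]
  refine memLp_finsetSum _ fun i _ => ?_
  have h1 : MemLp (fun ω => ξ ω i) ∞ P := by
    refine memLp_top_of_bound ?_ C (ae_of_all _ fun ω => hC ω i)
    exact ((measurable_pi_apply i).comp (hξ.mono (F.le s)).measurable).aestronglyMeasurable
  exact MemLp.mul (hW.memLp_coord hst htT i) h1

/-- Increments of the integral are orthogonal to the past. -/
lemma integral_mul_dotProduct {Y : Ω → ℝ} (hY : StronglyMeasurable[F s] Y) (hY2 : MemLp Y 2 P) :
    ∫ ω, Y ω * (ξ ω ⬝ᵥ (W t ω - W s ω)) ∂P = 0 := by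
  have hm : ∀ i, Measurable[F s] fun ω => ξ ω i := fun i =>
    (measurable_pi_apply i).comp hξ.measurable
  have h1 : ∀ i, MemLp (fun ω => Y ω * ξ ω i) 2 P := fun i => by
    have h1 : MemLp (fun ω => ξ ω i) ∞ P :=
      memLp_top_of_bound ((hm i).mono (F.le s) le_rfl).aestronglyMeasurable C
        (ae_of_all _ fun ω => hC ω i)
    exact MemLp.mul h1 hY2
  have h2 : ∀ ω, Y ω * (ξ ω ⬝ᵥ (W t ω - W s ω)) = ∑ i, (Y ω * ξ ω i) * (W t ω i - W s ω i) := by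
    intro ω
    simp only [dotProduct, Finset.mul_sum, Pi.sub_apply, mul_assoc]
  simp only [h2]
  rw [integral_finsetSum]
  · refine Finset.sum_eq_zero fun i _ => ?_
    have hYm : Measurable[F s] fun ω => Y ω * ξ ω i := hY.measurable.mul (hm i)
    rw [(hW.indepFun_coord hst htT hYm i).integral_fun_mul_eq_mul_integral (h1 i).1
      (hW.memLp_coord hst htT i).1, hW.integral_coord hst htT, mul_zero]
  · intro i _
    exact (h1 i).integrable_mul (hW.memLp_coord hst htT i)

lemma integral_dotProduct_sq [IsProbabilityMeasure P] :
    ∫ ω, (ξ ω ⬝ᵥ (W t ω - W s ω)) ^ 2 ∂P = ∫ ω, (ξ ω ⬝ᵥ ξ ω) * ((t : ℝ) - s) ∂P := by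
  have hm : ∀ i, Measurable[F s] fun ω => ξ ω i := fun i =>
    (measurable_pi_apply i).comp hξ.measurable
  have hb : ∀ i j, Integrable (fun ω => ξ ω i * ξ ω j) P := fun i j => by
    refine Integrable.of_bound (((hm i).mul (hm j)).mono (F.le s) le_rfl).aestronglyMeasurable
      (C * C) (ae_of_all _ fun ω => ?_)
    rw [Real.norm_eq_abs, abs_mul]
    exact mul_le_mul (hC ω i) (hC ω j) (abs_nonneg _) ((abs_nonneg _).trans (hC ω i))
  have hWm : ∀ i, AEMeasurable (fun ω => W t ω i - W s ω i) P := fun i =>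
    (hW.memLp_coord hst htT i).1.aemeasurable
  have hind : ∀ i j, IndepFun (fun ω => ξ ω i * ξ ω j)
      (fun ω => (W t ω i - W s ω i) * (W t ω j - W s ω j)) P := by
    intro i j
    have h := hW.indep s t hst htT
    refine (IndepFun_iff_Indep _ _ _).2 ?_
    refine indep_of_indep_of_le_left (indep_of_indep_of_le_right h.symm ?_)
      ((hm i).mul (hm j)).comap_le
    have : (fun ω => (W t ω i - W s ω i) * (W t ω j - W s ω j))
        = (fun x : Fin n → ℝ => x i * x j) ∘ fun ω => W t ω - W s ω := rfl
    rw [this, ← MeasurableSpace.comap_comp]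
    exact MeasurableSpace.comap_mono (Measurable.comap_le (by fun_prop))
  have h2 : ∀ ω, (ξ ω ⬝ᵥ (W t ω - W s ω)) ^ 2 = ∑ i, ∑ j,
      (ξ ω i * ξ ω j) * ((W t ω i - W s ω i) * (W t ω j - W s ω j)) := by
    intro ω
    rw [pow_two, dotProduct, Finset.sum_mul_sum]
    refine Finset.sum_congr rfl fun i _ => Finset.sum_congr rfl fun j _ => ?_
    simp only [Pi.sub_apply]
    ring
  have hint : ∀ i j, Integrable
      (fun ω => (ξ ω i * ξ ω j) * ((W t ω i - W s ω i) * (W t ω j - W s ω j))) P := fun i j =>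
    (hind i j).integrable_mul (hb i j)
      ((hW.memLp_coord hst htT i).integrable_mul (hW.memLp_coord hst htT j))
  simp only [h2]
  rw [integral_finsetSum _ fun i _ => integrable_finsetSum _ fun j _ => hint i j]
  simp only [dotProduct, Finset.sum_mul]
  rw [integral_finsetSum _ fun i _ => (hb i i).mul_const _]
  refine Finset.sum_congr rfl fun i _ => ?_
  rw [integral_finsetSum _ fun j _ => hint i j, Finset.sum_eq_single i]
  · rw [(hind i i).integral_fun_mul_eq_mul_integral (hb i i).1 ((hWm i).mul (hWm i)).aestronglyMeasurable,
      hW.integral_coord_mul hst htT, if_pos rfl, integral_mul_const]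
  · intro j _ hj
    rw [(hind i j).integral_fun_mul_eq_mul_integral (hb i j).1 ((hWm i).mul (hWm j)).aestronglyMeasurable,
      hW.integral_coord_mul hst htT, if_neg hj.symm, mul_zero]
  · simp

end IsBrownianMotion

section Sum

variable [IsProbabilityMeasure P] {ξ : ℕ → Ω → Fin n → ℝ} {τ : ℕ → ℝ≥0}

/-- The Itô isometry for simple integrands, together with square integrability. -/
lemma IsBrownianMotion.memLp_integral_and_sq (hW : IsBrownianMotion P F T W) (hτ : Monotone τ)
    (hξ : ∀ j, StronglyMeasurable[F (τ j)] (ξ j)) {C : ℝ} (hC : ∀ j ω i, |ξ j ω i| ≤ C)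
    {t : ℝ≥0} (ht : t ≤ T) (k : ℕ) :
    StronglyMeasurable[F (min (τ k) t)] (fun ω => ∑ j ∈ Finset.range k,
      ξ j ω ⬝ᵥ (W (min (τ (j + 1)) t) ω - W (min (τ j) t) ω)) ∧
    MemLp (fun ω => ∑ j ∈ Finset.range k,
      ξ j ω ⬝ᵥ (W (min (τ (j + 1)) t) ω - W (min (τ j) t) ω)) 2 P ∧
    ∫ ω, (∑ j ∈ Finset.range k,
      ξ j ω ⬝ᵥ (W (min (τ (j + 1)) t) ω - W (min (τ j) t) ω)) ^ 2 ∂P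
      = ∑ j ∈ Finset.range k,
        ∫ ω, (ξ j ω ⬝ᵥ ξ j ω) * (((min (τ (j + 1)) t : ℝ≥0) : ℝ) - (min (τ j) t : ℝ≥0)) ∂P := by
  classical
  induction k with
  | zero => simp [stronglyMeasurable_const]
  | succ k ih =>
    obtain ⟨ih1, ih2, ih3⟩ := ih
    simp only [Finset.sum_range_succ]
    have hst : min (τ k) t ≤ min (τ (k + 1)) t := min_le_min_right _ (hτ (Nat.le_succ k))
    have htT : min (τ (k + 1)) t ≤ T := (min_le_right _ _).trans ht
    -- after time `t` the increment vanishes, so that `ξ k` may be replaced by `0`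
    set ζ : Ω → Fin n → ℝ := fun ω => if τ k ≤ t then ξ k ω else 0 with hζ
    have hζm : StronglyMeasurable[F (min (τ k) t)] ζ := by
      by_cases h : τ k ≤ t
      · simp only [hζ, if_pos h]
        rw [min_eq_left h]
        exact hξ k
      · simp only [hζ, if_neg h]
        exact stronglyMeasurable_const
    have hζC : ∀ ω i, |ζ ω i| ≤ C := by
      intro ω i
      by_cases h : τ k ≤ t
      · simpa only [hζ, if_pos h] using hC k ω i
      · simpa only [hζ, if_neg h, Pi.zero_apply, abs_zero] using (abs_nonneg _).trans (hC k ω i)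
    have hmin : ¬ τ k ≤ t → min (τ (k + 1)) t = t ∧ min (τ k) t = t := fun h =>
      ⟨min_eq_right ((not_le.1 h).le.trans (hτ (Nat.le_succ k))), min_eq_right (not_le.1 h).le⟩
    have h1 : ∀ ω, ξ k ω ⬝ᵥ (W (min (τ (k + 1)) t) ω - W (min (τ k) t) ω)
        = ζ ω ⬝ᵥ (W (min (τ (k + 1)) t) ω - W (min (τ k) t) ω) := by
      intro ω
      by_cases h : τ k ≤ t
      · simp only [hζ, if_pos h]
      · simp [hmin h]
    have h2 : ∀ ω, (ξ k ω ⬝ᵥ ξ k ω) * (((min (τ (k + 1)) t : ℝ≥0) : ℝ) - (min (τ k) t : ℝ≥0))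
        = (ζ ω ⬝ᵥ ζ ω) * (((min (τ (k + 1)) t : ℝ≥0) : ℝ) - (min (τ k) t : ℝ≥0)) := by
      intro ω
      by_cases h : τ k ≤ t
      · simp only [hζ, if_pos h]
      · simp [hmin h]
    simp only [h1, h2]
    have hD := hW.memLp_dotProduct hst htT hζm hζC
    refine ⟨(ih1.mono (F.mono hst)).add ?_, ih2.add hD, ?_⟩
    · have hm1 := (hW.adapted _ htT)
      have hm2 := (hW.adapted _ (hst.trans htT)).mono (F.mono hst)
      simp only [dotProduct]
      refine Finset.stronglyMeasurable_fun_sum _ fun i _ => ?_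
      have hev : ∀ {g : Ω → Fin n → ℝ}, StronglyMeasurable[F (min (τ (k + 1)) t)] g →
          StronglyMeasurable[F (min (τ (k + 1)) t)] fun ω => g ω i := fun hg =>
        (measurable_pi_apply i).comp hg.measurable |>.stronglyMeasurable
      exact (hev (hζm.mono (F.mono hst))).mul (hev (hm1.sub hm2))
    · rw [← ih3, ← hW.integral_dotProduct_sq hst htT hζm hζC]
      have horth := hW.integral_mul_dotProduct hst htT hζm hζC ih1 ih2
      simp only [add_sq]
      rw [integral_add, integral_add, add_left_inj]
      · simp only [mul_assoc, integral_const_mul] at horth ⊢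
        rw [horth]
        simp
      · exact ih2.integrable_sq
      · simp only [mul_assoc]
        exact (ih2.integrable_mul hD).const_mul 2
      · refine ih2.integrable_sq.add ?_
        simp only [mul_assoc]
        exact (ih2.integrable_mul hD).const_mul 2
      · exact hD.integrable_sq

end Sum

end Isometry

/-! ### Uniqueness of the Itô integral -/

section Uniqueness

variable {Ω : Type*} [mΩ : MeasurableSpace Ω] {n : ℕ} {P : Measure Ω} {F : Filtration ℝ≥0 mΩ}
  {a b : ℝ≥0} {W : ℝ≥0 → Ω → Fin n → ℝ}

lemma dotProduct_self_nonneg' (x : Fin n → ℝ) : 0 ≤ x ⬝ᵥ x :=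
  Finset.sum_nonneg fun i _ => mul_self_nonneg (x i)

/-- The energy of a simple integrand dominates the sum of the energies of its terms. -/
lemma SimpleIntegrand.sum_le_lintegral (S : SimpleIntegrand n F a b) (ω : Ω) :
    ENNReal.ofReal (∑ j ∈ Finset.range S.k, (S.ξ j ω ⬝ᵥ S.ξ j ω) * ((S.τ (j + 1) : ℝ) - S.τ j))
      ≤ ∫⁻ s in Set.Ioc a b, ENNReal.ofReal (S.eval s ω ⬝ᵥ S.eval s ω) ∂timeVol := by
  have hdisj : Pairwise (Function.onFun Disjoint fun j => Set.Ioc (S.τ j) (S.τ (j + 1))) := by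
    simpa using S.τ_mono.pairwise_disjoint_on_Ioc_succ
  have hsub : ⋃ j ∈ Finset.range S.k, Set.Ioc (S.τ j) (S.τ (j + 1)) ⊆ Set.Ioc a b := by
    refine Set.iUnion₂_subset fun j _ => ?_
    exact Set.Ioc_subset_Ioc (S.τ_mem j).1 (S.τ_mem (j + 1)).2
  refine le_trans ?_ (lintegral_mono_set hsub)
  rw [lintegral_biUnion_finset (fun i _ j _ hij => hdisj hij) (fun _ _ => measurableSet_Ioc),
    ENNReal.ofReal_sum_of_nonneg]
  · refine Finset.sum_le_sum fun j hj => ?_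
    rw [setLIntegral_congr_fun (g := fun _ => ENNReal.ofReal (S.ξ j ω ⬝ᵥ S.ξ j ω))
      measurableSet_Ioc, setLIntegral_const, timeVol_Ioc,
      ENNReal.ofReal_mul (dotProduct_self_nonneg' _)]
    intro s hs
    have : S.eval s ω = S.ξ j ω := by
      rw [SimpleIntegrand.eval, Finset.sum_eq_single j, Set.indicator_of_mem hs]
      · intro i _ hij
        refine Set.indicator_of_notMem (fun h => ?_) _
        exact Set.disjoint_left.1 (hdisj hij) h hs
      · exact fun h => absurd hj h
    simp only [this]
  · intro j _
    exact mul_nonneg (dotProduct_self_nonneg' _)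
      (sub_nonneg.2 (NNReal.coe_le_coe.2 (S.τ_mono (Nat.le_succ j))))

/-- Stopping a sum of non-negative terms when it exceeds `δ`. -/
lemma sum_ite_partial_le {δ : ℝ} (hδ : 0 ≤ δ) {x : ℕ → ℝ} (hx : ∀ j, 0 ≤ x j) (k : ℕ) :
    ∑ j ∈ Finset.range k, (if ∑ i ∈ Finset.range (j + 1), x i ≤ δ then x j else 0) ≤ δ := by
  induction k with
  | zero => simpa
  | succ k ih =>
    rw [Finset.sum_range_succ]
    split_ifs with h
    · refine le_trans ?_ h
      rw [Finset.sum_range_succ]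
      gcongr with j _
      split_ifs
      · exact le_rfl
      · exact hx j
    · simpa using ih

/-- The integral of a simple integrand is small in probability if its energy is: stop the integrand
when its energy exceeds `δ` and apply the isometry. -/
lemma SimpleIntegrand.measure_integral_ge_le [IsProbabilityMeasure P]
    (hW : IsBrownianMotion P F b W) (S : SimpleIntegrand n F a b) {t : ℝ≥0} (ht : t ≤ b)
    {ε δ : ℝ} (hε : 0 < ε) (hδ : 0 < δ) :
    P {ω | ε ≤ |S.integral W t ω|} ≤ ENNReal.ofReal (δ / ε ^ 2)
      + P {ω | ENNReal.ofReal δ ≤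
          ∫⁻ s in Set.Ioc a b, ENNReal.ofReal (S.eval s ω ⬝ᵥ S.eval s ω) ∂timeVol} := by
  classical
  set x : Ω → ℕ → ℝ := fun ω j => (S.ξ j ω ⬝ᵥ S.ξ j ω) * ((S.τ (j + 1) : ℝ) - S.τ j) with hx
  have hx0 : ∀ ω j, 0 ≤ x ω j := fun ω j => mul_nonneg (dotProduct_self_nonneg' _)
      (sub_nonneg.2 (NNReal.coe_le_coe.2 (S.τ_mono (Nat.le_succ j))))
  set ζ : ℕ → Ω → Fin n → ℝ := fun j ω =>
    if ∑ i ∈ Finset.range (j + 1), x ω i ≤ δ then S.ξ j ω else 0 with hζ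
  obtain ⟨C, hC⟩ := S.ξ_bdd
  have hζC : ∀ j ω i, |ζ j ω i| ≤ C := by
    intro j ω i
    simp only [hζ]
    split_ifs
    · exact hC j ω i
    · simpa using (abs_nonneg _).trans (hC j ω i)
  have hζm : ∀ j, StronglyMeasurable[F (S.τ j)] (ζ j) := by
    intro j
    refine StronglyMeasurable.ite ?_ (S.ξ_meas j) stronglyMeasurable_const
    have hs : StronglyMeasurable[F (S.τ j)] fun ω => ∑ i ∈ Finset.range (j + 1), x ω i := by
      refine Finset.stronglyMeasurable_fun_sum _ fun i hi => ?_
      have hi' : S.τ i ≤ S.τ j := S.τ_mono (by have := Finset.mem_range.1 hi; omega)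
      have h1 := ((S.ξ_meas i).mono (F.mono hi')).measurable
      have h2 : Measurable fun y : Fin n → ℝ => y ⬝ᵥ y := by
        simp only [dotProduct]
        fun_prop
      exact ((h2.comp h1).mul_const _).stronglyMeasurable
    exact measurableSet_le hs.measurable measurable_const
  obtain ⟨-, hL2, hsq⟩ := hW.memLp_integral_and_sq S.τ_mono hζm hζC ht S.k
  set Y : Ω → ℝ := fun ω => ∑ j ∈ Finset.range S.k,
      ζ j ω ⬝ᵥ (W (min (S.τ (j + 1)) t) ω - W (min (S.τ j) t) ω) with hY
  have hle : ∫ ω, Y ω ^ 2 ∂P ≤ δ := by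
    have hzz : ∀ j ω, (ζ j ω ⬝ᵥ ζ j ω) * ((S.τ (j + 1) : ℝ) - S.τ j)
        = if ∑ i ∈ Finset.range (j + 1), x ω i ≤ δ then x ω j else 0 := by
      intro j ω
      simp only [hζ, hx]
      split_ifs <;> simp
    have hzm : ∀ j, Integrable (fun ω => ζ j ω ⬝ᵥ ζ j ω) P := by
      intro j
      have h2 : Measurable fun y : Fin n → ℝ => y ⬝ᵥ y := by
        simp only [dotProduct]
        fun_prop
      refine Integrable.of_bound (h2.comp ((hζm j).mono (F.le _)).measurable).aestronglyMeasurable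
        (∑ _i : Fin n, C * C) (ae_of_all _ fun ω => ?_)
      rw [Real.norm_eq_abs, dotProduct]
      refine (Finset.abs_sum_le_sum_abs _ _).trans (Finset.sum_le_sum fun i _ => ?_)
      rw [abs_mul]
      exact mul_le_mul (hζC j ω i) (hζC j ω i) (abs_nonneg _) ((abs_nonneg _).trans (hζC j ω i))
    rw [hsq, ← integral_finsetSum _ fun j _ => (hzm j).mul_const _]
    refine (integral_mono (g := fun _ => δ) (integrable_finsetSum _ fun j _ => (hzm j).mul_const _)
      (integrable_const _) fun ω => ?_).trans (by simp)
    refine le_trans (Finset.sum_le_sum fun j _ => ?_) (sum_ite_partial_le hδ.le (hx0 ω) S.k)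
    rw [← hzz]
    refine mul_le_mul_of_nonneg_left ?_ (dotProduct_self_nonneg' _)
    have := S.τ_mono (Nat.le_succ j)
    rcases le_total (S.τ (j + 1)) t with h | h
    · rw [min_eq_left h, min_eq_left (this.trans h)]
    · rw [min_eq_right h]
      rcases le_total (S.τ j) t with h' | h'
      · rw [min_eq_left h']
        exact sub_le_sub_right (NNReal.coe_le_coe.2 h) _
      · rw [min_eq_right h', sub_self]
        exact sub_nonneg.2 (NNReal.coe_le_coe.2 this)
  have hcheb : P {ω | ε ≤ |Y ω|} ≤ ENNReal.ofReal (δ / ε ^ 2) := by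
    have h := mul_meas_ge_le_integral_of_nonneg (μ := P) (f := fun ω => Y ω ^ 2)
      (ae_of_all _ fun ω => sq_nonneg _) hL2.integrable_sq (ε ^ 2)
    have hset : {ω | ε ≤ |Y ω|} = {ω | ε ^ 2 ≤ Y ω ^ 2} := by
      ext ω
      simp only [Set.mem_ofPred_eq]
      rw [sq_le_sq, abs_of_pos hε]
    rw [hset, ← ENNReal.ofReal_toReal (measure_ne_top P {ω | ε ^ 2 ≤ Y ω ^ 2})]
    refine ENNReal.ofReal_le_ofReal ?_
    rw [le_div_iff₀ (by positivity), mul_comm]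
    exact h.trans hle
  refine (measure_mono (t := {ω | ε ≤ |Y ω|} ∪ {ω | ENNReal.ofReal δ ≤
      ∫⁻ s in Set.Ioc a b, ENNReal.ofReal (S.eval s ω ⬝ᵥ S.eval s ω) ∂timeVol}) ?_).trans
    ((measure_union_le _ _).trans (add_le_add_left hcheb _))
  intro ω hω
  by_cases h : ∑ j ∈ Finset.range S.k, x ω j ≤ δ
  · left
    have : S.integral W t ω = Y ω := by
      refine Finset.sum_congr rfl fun j hj => ?_
      have : ∑ i ∈ Finset.range (j + 1), x ω i ≤ δ := by
        refine le_trans (Finset.sum_le_sum_of_subset_of_nonneg ?_ fun i _ _ => hx0 ω i) h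
        exact Finset.range_subset_range.2 (Finset.mem_range.1 hj)
      simp only [hζ, if_pos this]
    simpa [← this] using hω
  · right
    exact (ENNReal.ofReal_le_ofReal (not_le.1 h).le).trans (S.sum_le_lintegral ω)

lemma measurable_dotProduct_self : Measurable fun y : Fin n → ℝ => ENNReal.ofReal (y ⬝ᵥ y) := by
  simp only [dotProduct]
  fun_prop

lemma dotProduct_self_sub_le (x y : Fin n → ℝ) :
    (x - y) ⬝ᵥ (x - y) ≤ 2 * (x ⬝ᵥ x) + 2 * (y ⬝ᵥ y) := by
  simp only [dotProduct, Finset.mul_sum, ← Finset.sum_add_distrib]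
  refine Finset.sum_le_sum fun i _ => ?_
  simp only [Pi.sub_apply]
  nlinarith [sq_nonneg (x i + y i)]

/-- `|x - y|² ≤ 2 |x|² + 2 |y|²` for the energy of processes. -/
lemma lintegral_energy_sub_le {f g : ℝ≥0 → Fin n → ℝ} (hg : Measurable g) (s : Set ℝ≥0) :
    ∫⁻ v in s, ENNReal.ofReal ((f v - g v) ⬝ᵥ (f v - g v)) ∂timeVol
      ≤ 2 * ∫⁻ v in s, ENNReal.ofReal (f v ⬝ᵥ f v) ∂timeVol
        + 2 * ∫⁻ v in s, ENNReal.ofReal (g v ⬝ᵥ g v) ∂timeVol := by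
  have hm : Measurable fun v => ENNReal.ofReal (g v ⬝ᵥ g v) := measurable_dotProduct_self.comp hg
  rw [← lintegral_const_mul' _ _ (by simp), ← lintegral_const_mul' _ _ (by simp),
    ← lintegral_add_right _ (hm.const_mul _)]
  refine lintegral_mono fun v => ?_
  refine (ENNReal.ofReal_le_ofReal (dotProduct_self_sub_le (f v) (g v))).trans ?_
  rw [ENNReal.ofReal_add (mul_nonneg zero_le_two (dotProduct_self_nonneg' _))
      (mul_nonneg zero_le_two (dotProduct_self_nonneg' _)),
    ENNReal.ofReal_mul zero_le_two, ENNReal.ofReal_mul zero_le_two]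
  simp

/-- A simple integrand has finite energy on every path. -/
lemma SimpleIntegrand.lintegral_eval_lt_top (S : SimpleIntegrand n F a b) (ω : Ω) :
    ∫⁻ s in Set.Ioc a b, ENNReal.ofReal (S.eval s ω ⬝ᵥ S.eval s ω) ∂timeVol < ⊤ := by
  obtain ⟨C, hC⟩ := S.ξ_bdd
  refine (lintegral_mono (g := fun _ => ENNReal.ofReal (∑ _i : Fin n, (S.k * C) * (S.k * C)))
    fun s => ENNReal.ofReal_le_ofReal ?_).trans_lt ?_
  · refine Finset.sum_le_sum fun i _ => ?_
    have h := S.abs_eval_le hC s ω i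
    rw [← abs_mul_abs_self]
    exact mul_le_mul h h (abs_nonneg _) ((abs_nonneg _).trans h)
  · rw [setLIntegral_const, timeVol_Ioc]
    exact ENNReal.mul_lt_top ENNReal.ofReal_lt_top ENNReal.ofReal_lt_top

/-- An integrand that has an Itô integral has almost surely finite energy. -/
lemma IsItoIntegral.energy_lt_top {f : ℝ≥0 → Ω → Fin n → ℝ} {I : ℝ≥0 → Ω → ℝ}
    (h : IsItoIntegral P F W a b f I) :
    ∀ᵐ ω ∂P, ∫⁻ s in Set.Ioc a b, ENNReal.ofReal (f s ω ⬝ᵥ f s ω) ∂timeVol < ⊤ := by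
  obtain ⟨-, -, S, hS, -⟩ := h
  have h1 := hS 1 one_pos
  rw [ae_iff]
  refine le_antisymm (ge_of_tendsto' h1 fun k => measure_mono fun ω hω => ?_) zero_le
  by_contra hlt
  refine hω ?_
  have hlt' : ∫⁻ s in Set.Ioc a b, ENNReal.ofReal
    ((f s ω - (S k).eval s ω) ⬝ᵥ (f s ω - (S k).eval s ω)) ∂timeVol < 1 := not_le.1 hlt
  have := lintegral_energy_sub_le (f := fun s => f s ω - (S k).eval s ω)
    (g := fun s => - (S k).eval s ω) ((S k).measurable_eval ω).neg (Set.Ioc a b)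
  simp only [sub_neg_eq_add, sub_add_cancel, neg_dotProduct_neg] at this
  refine this.trans_lt (ENNReal.add_lt_top.2 ⟨ENNReal.mul_lt_top (by simp)
    (hlt'.trans (by simp)), ENNReal.mul_lt_top (by simp) ((S k).lintegral_eval_lt_top ω)⟩)

lemma tendstoInMeasure_sub {f g : ℕ → Ω → ℝ} {f' g' : Ω → ℝ}
    (hf : TendstoInMeasure P f atTop f') (hg : TendstoInMeasure P g atTop g') :
    TendstoInMeasure P (fun k => f k - g k) atTop (f' - g') := by
  rw [tendstoInMeasure_iff_norm] at hf hg ⊢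
  intro ε hε
  have hlim := (hf _ (half_pos hε)).add (hg _ (half_pos hε))
  rw [add_zero] at hlim
  refine tendsto_of_tendsto_of_tendsto_of_le_of_le tendsto_const_nhds hlim (fun _ => zero_le)
    fun k => le_trans (measure_mono fun ω hω => ?_) (measure_union_le _ _)
  by_contra hno
  simp only [Set.mem_union, Set.mem_ofPred_eq, not_or, not_le, Pi.sub_apply] at hno hω
  have h1 : f k ω - g k ω - (f' ω - g' ω) = (f k ω - f' ω) - (g k ω - g' ω) := by ring
  rw [h1] at hω
  have := norm_sub_le (f k ω - f' ω) (g k ω - g' ω)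
  linarith [hno.1, hno.2]

/-- The Itô integral is unique, up to null sets at each time: the difference of two approximating
sequences has vanishing energy, hence vanishing integral. -/
lemma IsItoIntegral.ae_eq [IsProbabilityMeasure P] (hW : IsBrownianMotion P F b W)
    {f : ℝ≥0 → Ω → Fin n → ℝ} (hf : ∀ ω, Measurable fun s => f s ω) {I I' : ℝ≥0 → Ω → ℝ}
    (h : IsItoIntegral P F W a b f I) (h' : IsItoIntegral P F W a b f I') {t : ℝ≥0}
    (ht : t ∈ Set.Icc a b) : I t =ᵐ[P] I' t := by
  obtain ⟨-, -, S, hS, hSI⟩ := h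
  obtain ⟨-, -, S', hS', hSI'⟩ := h'
  have hdiff : TendstoInMeasure P (fun k => ((S k).sub (S' k)).integral W t) atTop
      (fun _ => (0 : ℝ)) := by
    rw [tendstoInMeasure_iff_norm]
    intro ε hε
    simp only [sub_zero, Real.norm_eq_abs]
    rw [ENNReal.tendsto_nhds_zero]
    intro η hη
    obtain ⟨δ, hδ, hδη⟩ : ∃ δ : ℝ, 0 < δ ∧ ENNReal.ofReal (δ / ε ^ 2) ≤ η / 2 := by
      rcases eq_or_ne η ⊤ with rfl | hη'
      · exact ⟨1, one_pos, by simp [ENNReal.top_div]⟩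
      · refine ⟨(η / 2).toReal * ε ^ 2, ?_, ?_⟩
        · exact mul_pos (ENNReal.toReal_pos (ENNReal.half_pos hη.ne').ne'
            (ENNReal.div_ne_top hη' (by simp))) (by positivity)
        · rw [mul_div_cancel_right₀ _ (by positivity)]
          exact ENNReal.ofReal_toReal_le
    have hδ4 : (0 : ℝ≥0∞) < ENNReal.ofReal δ / 4 :=
      ENNReal.div_pos (by simpa using hδ) (by simp)
    have hη4 : (0 : ℝ≥0∞) < η / 2 / 2 := ENNReal.half_pos (ENNReal.half_pos hη.ne').ne'
    filter_upwards [(ENNReal.tendsto_nhds_zero.1 (hS _ hδ4)) _ hη4,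
      (ENNReal.tendsto_nhds_zero.1 (hS' _ hδ4)) _ hη4] with k h1 h2
    refine (((S k).sub (S' k)).measure_integral_ge_le hW ht.2 hε hδ).trans ?_
    have hsplit : P {ω | ENNReal.ofReal δ ≤ ∫⁻ s in Set.Ioc a b, ENNReal.ofReal
        (((S k).sub (S' k)).eval s ω ⬝ᵥ ((S k).sub (S' k)).eval s ω) ∂timeVol} ≤ η / 2 / 2 + η / 2 / 2 := by
      refine le_trans (measure_mono ?_) ((measure_union_le _ _).trans (add_le_add h1 h2))
      intro ω hω
      by_contra hno
      simp only [Set.mem_union, Set.mem_ofPred_eq, not_or, not_le] at hno hω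
      have := lintegral_energy_sub_le (f := fun s => f s ω - (S' k).eval s ω)
        (g := fun s => f s ω - (S k).eval s ω) ((hf ω).sub ((S k).measurable_eval ω)) (Set.Ioc a b)
      simp only [sub_sub_sub_cancel_left] at this
      simp only [SimpleIntegrand.eval_sub] at hω
      refine absurd (hω.trans this) (not_le.2 ?_)
      have h4 : 2 * (ENNReal.ofReal δ / 4) + 2 * (ENNReal.ofReal δ / 4) = ENNReal.ofReal δ := by
        rw [← two_mul, ← mul_assoc]
        norm_num
        rw [ENNReal.mul_div_cancel (by simp) (by simp)]
      rw [← h4]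
      exact ENNReal.add_lt_add ((ENNReal.mul_lt_mul_iff_right (by simp) (by simp)).2 hno.2)
        ((ENNReal.mul_lt_mul_iff_right (by simp) (by simp)).2 hno.1)
    refine (add_le_add hδη hsplit).trans (le_of_eq ?_)
    rw [ENNReal.add_halves, ENNReal.add_halves]
  have h2 := tendstoInMeasure_sub (hSI t ht) (hSI' t ht)
  have h3 : (fun k => ((S k).sub (S' k)).integral W t)
      = fun k => (S k).integral W t - (S' k).integral W t := by
    ext k ω
    exact SimpleIntegrand.integral_sub _ _ _ _ _
  rw [h3] at hdiff
  filter_upwards [tendstoInMeasure_ae_unique hdiff h2] with ω hω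
  exact (sub_eq_zero.1 hω.symm)

lemma IsItoIntegral.ae_eq_zero [IsProbabilityMeasure P]
    {f : ℝ≥0 → Ω → Fin n → ℝ} {I : ℝ≥0 → Ω → ℝ}
    (h : IsItoIntegral P F W a b f I) (hab : a ≤ b) : I a =ᵐ[P] 0 := by
  obtain ⟨-, -, S, -, hSI⟩ := h
  have h1 := hSI a ⟨le_rfl, hab⟩
  have h2 : (fun k => (S k).integral W a) = fun _ _ => (0 : ℝ) := by
    ext k ω
    refine Finset.sum_eq_zero fun j _ => ?_
    rw [min_eq_right ((S k).τ_mem _).1, min_eq_right ((S k).τ_mem _).1]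
    simp
  rw [h2] at h1
  refine tendstoInMeasure_ae_unique h1 ?_
  exact tendstoInMeasure_of_tendsto_ae (fun _ => aestronglyMeasurable_const)
    (ae_of_all _ fun _ => tendsto_const_nhds)

end Uniqueness

/-! ### Pasting of integrands -/

section Paste

variable {Ω : Type*} [mΩ : MeasurableSpace Ω] {n : ℕ} {P : Measure Ω} {F : Filtration ℝ≥0 mΩ}
  {a b : ℝ≥0} {W : ℝ≥0 → Ω → Fin n → ℝ}

open scoped Classical in
/-- The process that follows `f` up to time `t`, and after `t` follows `g` on the event `A` and `f`
off `A`. -/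
def pasteProc {E : Type*} (f g : ℝ≥0 → Ω → E) (t : ℝ≥0) (A : Set Ω) : ℝ≥0 → Ω → E :=
  fun s ω => if t < s ∧ ω ∈ A then g s ω else f s ω

/-- The stochastic integral of a pasted integrand: on `A`, the increments after `t` are those of
`I'`. -/
def pasteInt (I I' : ℝ≥0 → Ω → ℝ) (t : ℝ≥0) (A : Set Ω) : ℝ≥0 → Ω → ℝ :=
  fun s ω => I s ω + A.indicator (fun ω => (I' (max s t) ω - I (max s t) ω) - (I' t ω - I t ω)) ω

lemma IsItoIntegral.paste [IsProbabilityMeasure P] {f g : ℝ≥0 → Ω → Fin n → ℝ}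
    {I I' : ℝ≥0 → Ω → ℝ} (h : IsItoIntegral P F W a b f I) (h' : IsItoIntegral P F W a b g I')
    {t : ℝ≥0} (ht : t ∈ Set.Icc a b) {A : Set Ω} (hA : MeasurableSet[F t] A) :
    IsItoIntegral P F W a b (pasteProc f g t A) (pasteInt I I' t A) := by
  classical
  obtain ⟨hm, hc, S, hS, hSI⟩ := h
  obtain ⟨hm', hc', S', hS', hSI'⟩ := h'
  refine ⟨fun s hs => ?_, ?_, fun k => (S k).paste (S' k) ht hA, ?_, ?_⟩
  · rcases le_total s t with hst | hst
    · have : pasteInt I I' t A s = I s := by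
        ext ω
        simp [pasteInt, max_eq_right hst]
      rw [this]
      exact hm s hs
    · have : pasteInt I I' t A s
          = fun ω => I s ω + A.indicator (fun ω => (I' s ω - I s ω) - (I' t ω - I t ω)) ω := by
        ext ω
        simp [pasteInt, max_eq_left hst]
      rw [this]
      refine (hm s hs).add (StronglyMeasurable.indicator ?_ (F.mono hst _ hA))
      exact ((hm' s hs).sub (hm s hs)).sub
        (((hm' t ht).mono (F.mono hst)).sub ((hm t ht).mono (F.mono hst)))
  · filter_upwards [hc, hc'] with ω h1 h2
    refine h1.add ?_
    by_cases hω : ω ∈ A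
    · simp only [Set.indicator_of_mem hω]
      have hmax : ContinuousOn (fun s => max s t) (Set.Icc a b) := by fun_prop
      have hmaps : Set.MapsTo (fun s => max s t) (Set.Icc a b) (Set.Icc a b) := fun s hs =>
        ⟨hs.1.trans (le_max_left _ _), max_le hs.2 ht.2⟩
      exact ((h2.comp hmax hmaps).sub (h1.comp hmax hmaps)).sub continuousOn_const
    · simp only [Set.indicator_of_notMem hω]
      exact continuousOn_const
  · intro ε hε
    have hε2 : (0 : ℝ≥0∞) < ε / 2 := ENNReal.half_pos hε.ne'
    have hlim := (hS _ hε2).add (hS' _ hε2)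
    rw [add_zero] at hlim
    refine tendsto_of_tendsto_of_tendsto_of_le_of_le tendsto_const_nhds hlim (fun _ => zero_le)
      fun k => le_trans (measure_mono fun ω hω => ?_) (measure_union_le _ _)
    by_contra hno
    simp only [Set.mem_union, Set.mem_ofPred_eq, not_or, not_le] at hno hω
    refine absurd hω (not_le.2 ?_)
    rw [← ENNReal.add_halves ε]
    refine lt_of_le_of_lt ?_ (ENNReal.add_lt_add hno.1 hno.2)
    by_cases hω' : ω ∈ A
    · rw [← Set.Ioc_union_Ioc_eq_Ioc ht.1 ht.2]
      refine (lintegral_union_le _ _ _).trans (add_le_add ?_ ?_)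
      · rw [Set.Ioc_union_Ioc_eq_Ioc ht.1 ht.2]
        refine le_trans (le_of_eq (setLIntegral_congr_fun measurableSet_Ioc fun s hs => ?_))
          (lintegral_mono_set (Set.Ioc_subset_Ioc_right ht.2))
        simp only [SimpleIntegrand.eval_paste, pasteProc, hs.2.not_gt, false_and, if_false]
      · rw [Set.Ioc_union_Ioc_eq_Ioc ht.1 ht.2]
        refine le_trans (le_of_eq (setLIntegral_congr_fun measurableSet_Ioc fun s hs => ?_))
          (lintegral_mono_set (Set.Ioc_subset_Ioc_left ht.1))
        simp only [SimpleIntegrand.eval_paste, pasteProc, hs.1, hω', true_and, if_true]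
    · refine le_trans (le_of_eq (lintegral_congr fun s => ?_)) le_self_add
      simp only [SimpleIntegrand.eval_paste, pasteProc, hω', and_false, if_false]
  · intro s hs
    have hs' : max s t ∈ Set.Icc a b := ⟨hs.1.trans (le_max_left _ _), max_le hs.2 ht.2⟩
    have h1 := tendstoInMeasure_sub (hSI s hs) ((tendstoInMeasure_sub
      (tendstoInMeasure_sub (hSI _ hs') (hSI' _ hs'))
      (tendstoInMeasure_sub (hSI t ht) (hSI' t ht))).indicator A)
    refine (h1.congr_left fun k => ae_of_all _ fun ω => ?_).congr_right (ae_of_all _ fun ω => ?_)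
    · rw [SimpleIntegrand.integral_paste]
      by_cases hω : ω ∈ A
      · simp [hω]
        ring
      · simp [hω]
    · by_cases hω : ω ∈ A
      · simp [pasteInt, hω]
        ring
      · simp [pasteInt, hω]

end Paste

/-! ### Extended-real conditional expectations -/

section PosNeg

/-- The balance between the positive and negative parts of `x` and of `g + d x`. -/
lemma toENNReal_affine (g d : ℝ) (hd : 0 < d) (x : EReal) :
    ((g : EReal) + d * x).toENNReal + ENNReal.ofReal d * (-x).toENNReal + ENNReal.ofReal (-g)
      = (-((g : EReal) + d * x)).toENNReal + ENNReal.ofReal d * x.toENNReal + ENNReal.ofReal g := by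
  have hd' : ENNReal.ofReal d ≠ 0 := by simpa using hd
  induction x with
  | bot => simp [EReal.coe_mul_bot_of_pos hd, ENNReal.mul_top hd']
  | top => simp [EReal.coe_mul_top_of_pos hd, ENNReal.mul_top hd']
  | coe x =>
    rw [← EReal.coe_mul, ← EReal.coe_add, ← EReal.coe_neg, ← EReal.coe_neg]
    simp only [EReal.real_coe_toENNReal]
    rw [← ENNReal.ofReal_mul hd.le, ← ENNReal.ofReal_mul hd.le]
    simp only [ENNReal.ofReal]
    norm_cast
    ext
    push_cast
    simp only [Real.coe_toNNReal']
    simp only [max_def]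
    split_ifs <;> linarith

lemma toENNReal_affine_le (g d : ℝ) (hd : 0 < d) (x : EReal) :
    ((g : EReal) + d * x).toENNReal ≤ ENNReal.ofReal d * x.toENNReal + ENNReal.ofReal g := by
  refine EReal.toENNReal_add_le.trans ?_
  rw [EReal.toENNReal_mul (by exact_mod_cast hd.le), add_comm]
  simp

lemma neg_affine (g d : ℝ) (x : EReal) :
    -((g : EReal) + d * x) = ((-g : ℝ) : EReal) + d * -x := by
  rw [EReal.neg_add (by simp) (by simp), sub_eq_add_neg, EReal.coe_neg, mul_neg]

lemma le_toENNReal_affine (g d : ℝ) (hd : 0 < d) (x : EReal) :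
    ENNReal.ofReal d * x.toENNReal ≤ ((g : EReal) + d * x).toENNReal + ENNReal.ofReal (-g) := by
  have hx : (d : EReal) * x = ((g : EReal) + d * x) + ((-g : ℝ) : EReal) := by
    rw [EReal.coe_neg, add_comm (g : EReal), ← sub_eq_add_neg,
      EReal.add_sub_cancel_right]
  have h := EReal.toENNReal_add_le (x := (g : EReal) + d * x) (y := ((-g : ℝ) : EReal))
  rw [← hx, EReal.toENNReal_mul (by exact_mod_cast hd.le)] at h
  simpa using h

/-- The positive and negative parts of an affine image determine its value, infinite cases
included. -/
lemma coe_sub_coe_affine {g d : ℝ} (hd : 0 < d) {p q p' q' : ℝ≥0∞}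
    (h : p + ENNReal.ofReal d * q' + ENNReal.ofReal (-g)
      = q + ENNReal.ofReal d * p' + ENNReal.ofReal g)
    (hp : p ≤ ENNReal.ofReal d * p' + ENNReal.ofReal g)
    (hq : q ≤ ENNReal.ofReal d * q' + ENNReal.ofReal (-g))
    (hp' : ENNReal.ofReal d * p' ≤ p + ENNReal.ofReal (-g))
    (hq' : ENNReal.ofReal d * q' ≤ q + ENNReal.ofReal g) :
    (p : EReal) - q = g + d * ((p' : EReal) - q') := by
  have hd' : ENNReal.ofReal d ≠ 0 := by simpa using hd
  by_cases h1 : q' = ⊤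
  · have : q = ⊤ := by simpa [h1, ENNReal.mul_top hd'] using hq'
    simp [h1, this, EReal.coe_mul_bot_of_pos hd, sub_eq_add_neg]
  have h2 : q ≠ ⊤ := (hq.trans_lt (ENNReal.add_lt_top.2 ⟨ENNReal.mul_lt_top
    ENNReal.ofReal_lt_top (lt_top_iff_ne_top.2 h1), ENNReal.ofReal_lt_top⟩)).ne
  by_cases h3 : p' = ⊤
  · have : p = ⊤ := by simpa [h3, ENNReal.mul_top hd'] using hp'
    subst h3 this
    lift q to ℝ≥0 using h2
    lift q' to ℝ≥0 using h1
    have e : ∀ z : ℝ≥0, ((z : ℝ≥0∞) : EReal) = ((z : ℝ) : EReal) := fun z => rfl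
    rw [EReal.coe_ennreal_top, e, e, EReal.top_sub_coe, EReal.top_sub_coe,
      EReal.coe_mul_top_of_pos hd, EReal.coe_add_top]
  have h4 : p ≠ ⊤ := (hp.trans_lt (ENNReal.add_lt_top.2 ⟨ENNReal.mul_lt_top
    ENNReal.ofReal_lt_top (lt_top_iff_ne_top.2 h3), ENNReal.ofReal_lt_top⟩)).ne
  lift q to ℝ≥0 using h2
  lift q' to ℝ≥0 using h1
  lift p to ℝ≥0 using h4
  lift p' to ℝ≥0 using h3
  have e : ∀ z : ℝ≥0, ((z : ℝ≥0∞) : EReal) = ((z : ℝ) : EReal) := fun z => rfl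
  simp only [e, ← EReal.coe_sub, ← EReal.coe_mul, ← EReal.coe_add]
  congr 1
  simp only [ENNReal.ofReal] at h
  norm_cast at h
  have h' := congrArg NNReal.toReal h
  push_cast at h'
  simp only [Real.coe_toNNReal', max_eq_left hd.le] at h'
  rcases le_total 0 g with h3 | h3 <;> simp [h3] at h' <;> linarith

end PosNeg

section Cond

variable {Ω : Type*} {𝒢 : MeasurableSpace Ω} [mΩ : MeasurableSpace Ω] {Q : Measure Ω}

lemma lintegral_mul_condLExp (hm : 𝒢 ≤ mΩ) [IsFiniteMeasure Q] {f g : Ω → ℝ≥0∞}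
    (hf : Measurable[𝒢] f) (hg : AEMeasurable g Q) :
    ∫⁻ ω, f ω * condLExp 𝒢 Q g ω ∂Q = ∫⁻ ω, f ω * g ω ∂Q := by
  have hf' : Measurable f := hf.mono hm le_rfl
  have e : ∀ h : Ω → ℝ≥0∞, AEMeasurable h Q →
      ∫⁻ ω, f ω * h ω ∂Q = ∫⁻ ω, f ω ∂((Q.withDensity h).trim hm) := by
    intro h hh
    rw [lintegral_trim hm hf, lintegral_withDensity_eq_lintegral_mul₀ hh hf'.aemeasurable]
    simp [mul_comm]
  rw [e _ (measurable_condLExp' _ _ _).aemeasurable, e _ hg]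
  congr 1
  refine @Measure.ext _ 𝒢 _ _ fun s hs => ?_
  rw [trim_measurableSet_eq hm hs, trim_measurableSet_eq hm hs, withDensity_apply _ (hm s hs),
    withDensity_apply _ (hm s hs), setLIntegral_condLExp hm _ _ hs]

/-- Taking out what is known. -/
lemma condLExp_mul_left (hm : 𝒢 ≤ mΩ) [IsFiniteMeasure Q] {f g : Ω → ℝ≥0∞}
    (hf : Measurable[𝒢] f) (hg : AEMeasurable g Q) :
    condLExp 𝒢 Q (fun ω => f ω * g ω) =ᵐ[Q] fun ω => f ω * condLExp 𝒢 Q g ω := by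
  refine (ae_eq_condLExp hm Q _ (hf.mul (measurable_condLExp _ _ _)) fun s hs => ?_).symm
  have h := lintegral_mul_condLExp hm (hf.indicator hs) hg
  rw [← lintegral_indicator (hm s hs), ← lintegral_indicator (hm s hs)]
  have e : ∀ (k : Ω → ℝ≥0∞) (ω : Ω), s.indicator (fun ω => f ω * k ω) ω = s.indicator f ω * k ω :=
    fun k ω => Set.indicator_mul_left s f k
  simp only [← e] at h
  exact h

/-- The extended-real conditional expectation commutes with affine maps whose coefficients are
known. -/
lemma econdExp_affine (hm : 𝒢 ≤ mΩ) [IsFiniteMeasure Q] {Y : Ω → EReal} (hY : AEMeasurable Y Q)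
    {G D : Ω → ℝ} (hG : Measurable[𝒢] G) (hD : Measurable[𝒢] D) (hD0 : ∀ ω, 0 < D ω) :
    econdExp Q 𝒢 (fun ω => (G ω : EReal) + D ω * Y ω)
      =ᵐ[Q] fun ω => (G ω : EReal) + D ω * econdExp Q 𝒢 Y ω := by
  set Z : Ω → EReal := fun ω => (G ω : EReal) + D ω * Y ω with hZ
  have hZm : AEMeasurable Z Q := by
    have h1 : Measurable G := hG.mono hm le_rfl
    have h2 : Measurable D := hD.mono hm le_rfl
    exact (measurable_coe_real_ereal.comp h1).aemeasurable.add
      ((measurable_coe_real_ereal.comp h2).aemeasurable.mul hY)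
  have hYp : AEMeasurable (fun ω => (Y ω).toENNReal) Q :=
    measurable_ereal_toENNReal.comp_aemeasurable hY
  have hYn : AEMeasurable (fun ω => (-Y ω).toENNReal) Q :=
    measurable_ereal_toENNReal.comp_aemeasurable hY.neg
  have hZp : AEMeasurable (fun ω => (Z ω).toENNReal) Q :=
    measurable_ereal_toENNReal.comp_aemeasurable hZm
  have hZn : AEMeasurable (fun ω => (-Z ω).toENNReal) Q :=
    measurable_ereal_toENNReal.comp_aemeasurable hZm.neg
  have hd : Measurable[𝒢] fun ω => ENNReal.ofReal (D ω) := hD.ennreal_ofReal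
  have hgp : Measurable[𝒢] fun ω => ENNReal.ofReal (G ω) := hG.ennreal_ofReal
  have hgn : Measurable[𝒢] fun ω => ENNReal.ofReal (-G ω) := hG.neg.ennreal_ofReal
  -- conditional expectations of the sums that occur in the pointwise relations
  have key : ∀ {a b g : Ω → ℝ≥0∞}, AEMeasurable a Q → AEMeasurable b Q → Measurable[𝒢] g →
      condLExp 𝒢 Q (fun ω => a ω + ENNReal.ofReal (D ω) * b ω + g ω)
        =ᵐ[Q] fun ω => condLExp 𝒢 Q a ω + ENNReal.ofReal (D ω) * condLExp 𝒢 Q b ω + g ω := by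
    intro a b g ha hb hg
    have h1 := condLExp_add_right (P := Q) (mΩ := 𝒢) (fun ω => a ω + ENNReal.ofReal (D ω) * b ω)
      (hg.mono hm le_rfl).aemeasurable
    have h2 := condLExp_add_left (P := Q) (mΩ := 𝒢) (fun ω => ENNReal.ofReal (D ω) * b ω) ha
    have h3 := condLExp_mul_left (Q := Q) hm hd hb
    have h4 := condLExp_eq_self hm Q hg
    filter_upwards [h1, h2, h3] with ω e1 e2 e3
    have e1' : condLExp 𝒢 Q (fun ω => a ω + ENNReal.ofReal (D ω) * b ω + g ω) ω = _ := e1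
    have e2' : condLExp 𝒢 Q (fun ω => a ω + ENNReal.ofReal (D ω) * b ω) ω = _ := e2
    rw [e1', Pi.add_apply, e2', Pi.add_apply, e3, h4]
  have key1 : ∀ {a g : Ω → ℝ≥0∞}, AEMeasurable a Q → Measurable[𝒢] g →
      condLExp 𝒢 Q (fun ω => a ω + g ω) =ᵐ[Q] fun ω => condLExp 𝒢 Q a ω + g ω := by
    intro a g ha hg
    filter_upwards [condLExp_add_left (P := Q) (mΩ := 𝒢) g ha] with ω e1
    have e1' : condLExp 𝒢 Q (fun ω => a ω + g ω) ω = _ := e1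
    rw [e1', Pi.add_apply, condLExp_eq_self hm Q hg]
  have key2 : ∀ {b g : Ω → ℝ≥0∞}, AEMeasurable b Q → Measurable[𝒢] g →
      condLExp 𝒢 Q (fun ω => ENNReal.ofReal (D ω) * b ω + g ω)
        =ᵐ[Q] fun ω => ENNReal.ofReal (D ω) * condLExp 𝒢 Q b ω + g ω := by
    intro b g hb hg
    have := key1 ((hd.mono hm le_rfl).aemeasurable.mul hb) hg
    filter_upwards [this, condLExp_mul_left (Q := Q) hm hd hb] with ω e1 e2
    have e1' : condLExp 𝒢 Q (fun ω => ENNReal.ofReal (D ω) * b ω + g ω) ω = _ := e1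
    have e2' : condLExp 𝒢 Q ((fun ω => ENNReal.ofReal (D ω)) * b) ω = _ := e2
    rw [e1', e2']
  have l0 : (fun ω => (Z ω).toENNReal + ENNReal.ofReal (D ω) * (-Y ω).toENNReal
        + ENNReal.ofReal (-G ω))
      = fun ω => (-Z ω).toENNReal + ENNReal.ofReal (D ω) * (Y ω).toENNReal + ENNReal.ofReal (G ω) :=
    funext fun ω => toENNReal_affine (G ω) (D ω) (hD0 ω) (Y ω)
  have l1 := condLExp_mono (P := Q) (mΩ := 𝒢) (X := fun ω => (Z ω).toENNReal)
    (ae_of_all Q fun ω => toENNReal_affine_le (G ω) (D ω) (hD0 ω) (Y ω))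
  have l2 := condLExp_mono (P := Q) (mΩ := 𝒢) (X := fun ω => (-Z ω).toENNReal)
    (Y := fun ω => ENNReal.ofReal (D ω) * (-Y ω).toENNReal + ENNReal.ofReal (-G ω))
    (ae_of_all Q fun ω => by
      have := toENNReal_affine_le (-G ω) (D ω) (hD0 ω) (-Y ω)
      rw [← neg_affine] at this
      exact this)
  have l3 := condLExp_mono (P := Q) (mΩ := 𝒢)
    (ae_of_all Q fun ω => le_toENNReal_affine (G ω) (D ω) (hD0 ω) (Y ω))
  have l4 := condLExp_mono (P := Q) (mΩ := 𝒢)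
    (X := fun ω => ENNReal.ofReal (D ω) * (-Y ω).toENNReal)
    (Y := fun ω => (-Z ω).toENNReal + ENNReal.ofReal (G ω)) (ae_of_all Q fun ω => by
      have := le_toENNReal_affine (-G ω) (D ω) (hD0 ω) (-Y ω)
      rw [← neg_affine, neg_neg] at this
      exact this)
  have l5 := key hZp hYn hgn
  rw [l0] at l5
  filter_upwards [l1, l2, l3, l4, l5, key hZn hYp hgp, key2 hYp hgp, key2 hYn hgn, key1 hZp hgn,
    key1 hZn hgp, condLExp_mul_left (Q := Q) hm hd hYp, condLExp_mul_left (Q := Q) hm hd hYn]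
    with ω e1 e2 e3 e4 e5 e6 e7 e8 e9 e10 e11 e12
  refine coe_sub_coe_affine (hD0 ω) ?_ ?_ ?_ ?_ ?_
  · rw [← e5, ← e6]
  · rw [← e7]
    exact e1
  · rw [← e8]
    exact e2
  · rw [← e11, ← e9]
    exact e3
  · rw [← e12, ← e10]
    exact e4

lemma measurable_econdExp (Y : Ω → EReal) : Measurable[𝒢] (econdExp Q 𝒢 Y) :=
  (measurable_condLExp _ _ _).coe_ereal_ennreal.sub (measurable_condLExp _ _ _).coe_ereal_ennreal

lemma econdExp_congr_ae {Y Y' : Ω → EReal} (h : Y =ᵐ[Q] Y') :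
    econdExp Q 𝒢 Y =ᵐ[Q] econdExp Q 𝒢 Y' := by
  filter_upwards [condLExp_congr_ae (mΩ := 𝒢) (h.fun_comp EReal.toENNReal),
    condLExp_congr_ae (mΩ := 𝒢) (h.fun_comp fun y => (-y).toENNReal)] with ω h1 h2
  have h1' : condLExp 𝒢 Q (fun ω => (Y ω).toENNReal) ω = condLExp 𝒢 Q (fun ω => (Y' ω).toENNReal) ω := h1
  have h2' : condLExp 𝒢 Q (fun ω => (-Y ω).toENNReal) ω
    = condLExp 𝒢 Q (fun ω => (-Y' ω).toENNReal) ω := h2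
  simp only [econdExp, h1', h2']

/-- On integrable random variables the extended-real conditional expectation is the usual one. -/
lemma econdExp_coe {f : Ω → ℝ} (hf : Integrable f Q) :
    econdExp Q 𝒢 (fun ω => (f ω : EReal)) =ᵐ[Q] fun ω => ((Q[f|𝒢] ω : ℝ) : EReal) := by
  have hp : ∫⁻ ω, ENNReal.ofReal (f ω) ∂Q ≠ ⊤ := hf.lintegral_lt_top.ne
  have hn : ∫⁻ ω, ENNReal.ofReal (-f ω) ∂Q ≠ ⊤ := hf.neg.lintegral_lt_top.ne
  have hpm : AEMeasurable (fun ω => ENNReal.ofReal (f ω)) Q := hf.1.aemeasurable.ennreal_ofReal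
  have hnm : AEMeasurable (fun ω => ENNReal.ofReal (-f ω)) Q := hf.1.aemeasurable.neg.ennreal_ofReal
  have hsub : Q[fun ω => (ENNReal.ofReal (f ω)).toReal - (ENNReal.ofReal (-f ω)).toReal|𝒢]
      =ᵐ[Q] Q[fun ω => (ENNReal.ofReal (f ω)).toReal|𝒢]
        - Q[fun ω => (ENNReal.ofReal (-f ω)).toReal|𝒢] :=
    condExp_sub (integrable_toReal_of_lintegral_ne_top hpm hp)
      (integrable_toReal_of_lintegral_ne_top hnm hn) 𝒢
  have heq : (fun ω => (ENNReal.ofReal (f ω)).toReal - (ENNReal.ofReal (-f ω)).toReal) = f := by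
    ext ω
    rw [ENNReal.toReal_ofReal', ENNReal.toReal_ofReal']
    rcases le_total 0 (f ω) with h | h <;> simp [h]
  rw [heq] at hsub
  filter_upwards [hsub, toReal_condLExp 𝒢 hpm hp, toReal_condLExp 𝒢 hnm hn,
    condLExp_ne_top (mΩ := 𝒢) hp, condLExp_ne_top (mΩ := 𝒢) hn] with ω h1 h2 h3 h4 h5
  have e : ∀ z : ℝ≥0∞, z ≠ ⊤ → (z : EReal) = ((z.toReal : ℝ) : EReal) := fun z hz =>
    (EReal.coe_toReal (by simpa using hz) (by simp)).symm.trans (by simp)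
  have hneg : ∀ ω, (-(f ω : EReal)).toENNReal = ENNReal.ofReal (-f ω) := fun ω => by
    rw [← EReal.coe_neg, EReal.real_coe_toENNReal]
  simp only [econdExp, hneg, EReal.real_coe_toENNReal]
  rw [e _ h4, e _ h5, h2, h3, h1, ← EReal.coe_sub, Pi.sub_apply]

end Cond

/-! ### Existence of essential infima -/

section EssInf

variable {Ω : Type*} {𝒢 : MeasurableSpace Ω} [mΩ : MeasurableSpace Ω] {P : Measure Ω}

/-- The logistic function on the extended reals: a bounded, strictly increasing scale. -/
def scale (x : EReal) : ℝ≥0∞ := (1 + EReal.exp (-x))⁻¹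

lemma scale_strictMono : StrictMono scale := by
  intro x y hxy
  refine ENNReal.inv_lt_inv.2 ?_
  exact (ENNReal.add_lt_add_iff_left (by simp)).2 (EReal.exp_strictMono (EReal.neg_lt_neg_iff.2 hxy))

lemma scale_le_one (x : EReal) : scale x ≤ 1 := by
  rw [scale, ENNReal.inv_le_one]
  exact le_self_add

lemma measurable_scale : Measurable scale :=
  (measurable_const.add (EReal.measurable_exp.comp measurable_neg)).inv

/-- Any family of `𝒢`-measurable extended-real functions has an essential infimum: it is the
infimum of a countable subfamily whose `scale` has the least mean. -/
lemma exists_isEssInf (hm : 𝒢 ≤ mΩ) [IsFiniteMeasure P] {S : Set (Ω → EReal)}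
    (hS : ∀ Y ∈ S, Measurable[𝒢] Y) : ∃ Z, IsEssInf P 𝒢 S Z := by
  rcases S.eq_empty_or_nonempty with rfl | ⟨Y₀, hY₀⟩
  · exact ⟨fun _ => ⊤, measurable_const, by simp, fun Z' _ _ => ae_of_all _ fun _ => le_top⟩
  set J : (ℕ → S) → ℝ≥0∞ := fun f => ∫⁻ ω, scale (⨅ k, (f k : Ω → EReal) ω) ∂P with hJ
  have hne : Nonempty (ℕ → S) := ⟨fun _ => ⟨Y₀, hY₀⟩⟩
  obtain ⟨u, -, hu, huR⟩ := exists_seq_tendsto_sInf (Set.range_nonempty J) (OrderBot.bddBelow _)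
  choose f hf using huR
  -- merge the minimizing sequence into one countable family
  set g : ℕ → S := fun k => f (Nat.unpair k).1 (Nat.unpair k).2 with hg
  have hgle : ∀ j ω, ⨅ k, (g k : Ω → EReal) ω ≤ ⨅ k, (f j k : Ω → EReal) ω := by
    intro j ω
    refine le_iInf fun k => (iInf_le _ (Nat.pair j k)).trans ?_
    simp [hg]
  have hgmin : J g ≤ sInf (Set.range J) := by
    refine ge_of_tendsto' hu fun j => ?_
    rw [← hf j]
    exact lintegral_mono fun ω => scale_strictMono.monotone (hgle j ω)
  have hmeas : ∀ f : ℕ → S, Measurable[𝒢] fun ω => ⨅ k, (f k : Ω → EReal) ω := fun f =>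
    Measurable.iInf fun k => hS _ (f k).2
  refine ⟨fun ω => ⨅ k, (g k : Ω → EReal) ω, hmeas g, fun Y hY => ?_, fun Z' _ hZ' => ?_⟩
  · by_contra hnot
    set g' : ℕ → S := fun k => Nat.casesOn k ⟨Y, hY⟩ g with hg'
    have hg'eq : ∀ ω, ⨅ k, (g' k : Ω → EReal) ω = Y ω ⊓ ⨅ k, (g k : Ω → EReal) ω := by
      intro ω
      refine le_antisymm (le_inf (iInf_le _ 0) (le_iInf fun k => iInf_le _ (k + 1))) ?_
      refine le_iInf fun k => ?_
      cases k with
      | zero => exact inf_le_left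
      | succ k => exact inf_le_right.trans (iInf_le _ k)
    have hlt : J g' < J g := by
      refine lintegral_strict_mono_of_ae_le_of_frequently_ae_lt
        (measurable_scale.comp ((hmeas g).mono hm le_rfl)).aemeasurable ?_ ?_ ?_
      · exact ((lintegral_mono fun ω => scale_le_one _).trans_lt (by simp)).ne
      · refine ae_of_all _ fun ω => scale_strictMono.monotone ?_
        rw [hg'eq]
        exact inf_le_right
      · intro h
        refine hnot ?_
        filter_upwards [h] with ω hω
        by_contra hlt
        refine hω (scale_strictMono ?_).ne
        rw [hg'eq]
        exact inf_lt_right.2 hlt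
    exact absurd (hgmin.trans (sInf_le ⟨g', rfl⟩)) (not_le.2 hlt)
  · have : ∀ᵐ ω ∂P, ∀ k, Z' ω ≤ (g k : Ω → EReal) ω := ae_all_iff.2 fun k => hZ' _ (g k).2
    filter_upwards [this] with ω hω using le_iInf hω

end EssInf

/-! ### Predictable processes and martingales -/

section Predictable

variable {Ω : Type*} [mΩ : MeasurableSpace Ω] {F : Filtration ℝ≥0 mΩ}
  {E : Type*} [TopologicalSpace E] {f : ℝ≥0 → Ω → E}

lemma _root_.MeasureTheory.IsStronglyPredictable.stronglyMeasurable_uncurry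
    (hf : IsStronglyPredictable F f) : StronglyMeasurable (Function.uncurry f) := by
  refine StronglyMeasurable.mono hf (measurableSpace_le_predictable_of_measurableSet ?_ ?_)
  · exact fun A hA => (measurableSet_singleton _).prod (F.le _ _ hA)
  · exact fun i A hA => measurableSet_Ioi.prod (F.le _ _ hA)

lemma _root_.MeasureTheory.IsStronglyPredictable.stronglyMeasurable_path
    (hf : IsStronglyPredictable F f) (ω : Ω) : StronglyMeasurable fun s => f s ω :=
  hf.stronglyMeasurable_uncurry.comp_measurable measurable_prodMk_right

/-- A predictable process stopped at `t` is measurable with respect to `ℬ ⊗ F t`. -/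
lemma _root_.MeasureTheory.IsStronglyPredictable.stronglyMeasurable_min
    (hf : IsStronglyPredictable F f) (t : ℝ≥0) :
    @StronglyMeasurable (ℝ≥0 × Ω) E _ (@Prod.instMeasurableSpace _ _ _ (F t))
      fun p => f (min p.1 t) p.2 := by
  let _ : MeasurableSpace Ω := F t
  have h := hf.isStronglyProgressive t
  have hm : Measurable fun p : ℝ≥0 × Ω =>
      ((⟨min p.1 t, Set.mem_Iic.2 (min_le_right _ _)⟩ : Set.Iic t), p.2) :=
    (Measurable.subtype_mk (measurable_fst.min measurable_const)).prodMk measurable_snd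
  exact h.comp_measurable hm

lemma stronglyMeasurable_setIntegral {f : ℝ≥0 → Ω → ℝ} (hf : IsStronglyPredictable F f)
    (a t : ℝ≥0) : StronglyMeasurable[F t] fun ω => ∫ v in Set.Ioc a t, f v ω ∂timeVol := by
  have h := hf.stronglyMeasurable_min t
  have e : (fun ω => ∫ v in Set.Ioc a t, f v ω ∂timeVol)
      = fun ω => ∫ v in Set.Ioc a t, f (min v t) ω ∂timeVol := by
    ext ω
    refine setIntegral_congr_fun measurableSet_Ioc fun v hv => ?_
    simp only [min_eq_left hv.2]
  rw [e]
  exact @StronglyMeasurable.integral_prod_left' _ _ _ _ (F t) _ _ _ _ _ h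

lemma measurable_setLIntegral {f : ℝ≥0 → Ω → ℝ≥0∞} (hf : IsStronglyPredictable F f)
    (a t : ℝ≥0) : Measurable[F t] fun ω => ∫⁻ v in Set.Ioc a t, f v ω ∂timeVol := by
  have h := hf.stronglyMeasurable_min t
  have e : (fun ω => ∫⁻ v in Set.Ioc a t, f v ω ∂timeVol)
      = fun ω => ∫⁻ v in Set.Ioc a t, f (min v t) ω ∂timeVol := by
    ext ω
    refine setLIntegral_congr_fun measurableSet_Ioc fun v hv => ?_
    simp only [min_eq_left hv.2]
  rw [e]
  exact @Measurable.lintegral_prod_left' _ _ _ (F t) _ _ _ h.measurable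

lemma isStronglyPredictable_paste {f g : ℝ≥0 → Ω → E} (hf : IsStronglyPredictable F f)
    (hg : IsStronglyPredictable F g) {t : ℝ≥0} {A : Set Ω} (hA : MeasurableSet[F t] A) :
    IsStronglyPredictable F (pasteProc f g t A) := by
  classical
  have e : Function.uncurry (pasteProc f g t A)
      = fun p => if p ∈ Set.Ioi t ×ˢ A then Function.uncurry g p else Function.uncurry f p := by
    ext p
    simp only [Function.uncurry, pasteProc, Set.mem_prod, Set.mem_Ioi]
  unfold IsStronglyPredictable
  rw [e]
  exact StronglyMeasurable.ite (measurableSet_predictable_Ioi_prod hA) hg hf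

lemma measurable_of_ae_eq {P : Measure Ω} (hc : ∀ s : Set Ω, P s = 0 → MeasurableSet[F 0] s)
    {β : Type*} [MeasurableSpace β] {t : ℝ≥0} {f g : Ω → β} (hg : Measurable[F t] g)
    (h : f =ᵐ[P] g) : Measurable[F t] f := by
  intro B hB
  have hN : P {ω | f ω ≠ g ω} = 0 := h
  have e : f ⁻¹' B = (g ⁻¹' B \ {ω | f ω ≠ g ω}) ∪ (f ⁻¹' B ∩ {ω | f ω ≠ g ω}) := by
    ext ω
    by_cases hω : f ω = g ω <;> simp [hω]
  rw [e]
  exact ((hg hB).diff (F.mono zero_le _ (hc _ hN))).union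
    (F.mono zero_le _ (hc _ (measure_mono_null Set.inter_subset_right hN)))

end Predictable

section Martingale

variable {Ω ι : Type*} [mΩ : MeasurableSpace Ω] {P : Measure Ω} [LinearOrder ι]
  {𝒢 : Filtration ι mΩ} {X : ι → Ω → ℝ}

/-- The increments of a martingale after time `t`, multiplied by a bounded random variable known at
time `t`. -/
lemma _root_.MeasureTheory.Martingale.mul_increment [IsFiniteMeasure P] (hX : Martingale X 𝒢 P)
    (t : ι) {ζ : Ω → ℝ} (hζ : StronglyMeasurable[𝒢 t] ζ) {C : ℝ} (hC : ∀ ω, |ζ ω| ≤ C) :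
    Martingale (fun r ω => ζ ω * (X (max r t) ω - X t ω)) 𝒢 P := by
  have hint : ∀ r, Integrable (fun ω => ζ ω * (X r ω - X t ω)) P := fun r =>
    ((hX.integrable r).sub (hX.integrable t)).bdd_mul (c := C) (hζ.mono (𝒢.le t)).aestronglyMeasurable
      (ae_of_all _ hC)
  have hpull : ∀ i j, t ≤ i → i ≤ j →
      P[fun ω => ζ ω * (X j ω - X t ω)|𝒢 i] =ᵐ[P] fun ω => ζ ω * (X i ω - X t ω) := by
    intro i j hti hij
    have h1 : P[ζ * (X j - X t)|𝒢 i] =ᵐ[P] ζ * P[X j - X t|𝒢 i] :=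
      condExp_mul_of_stronglyMeasurable_left (hζ.mono (𝒢.mono hti)) (hint j)
        ((hX.integrable j).sub (hX.integrable t))
    have h2 := condExp_sub (hX.integrable j) (hX.integrable t) (𝒢 i)
    have h3 := condExp_of_stronglyMeasurable (𝒢.le i) ((hX.1 t).mono (𝒢.mono hti))
      (hX.integrable t)
    filter_upwards [h1, h2, hX.2 i j hij] with ω e1 e2 e3
    refine e1.trans ?_
    rw [Pi.mul_apply, e2, Pi.sub_apply, e3, h3]
  refine ⟨fun r => ?_, fun i j hij => ?_⟩
  · rcases le_total r t with h | h
    · simp only [max_eq_right h, sub_self, mul_zero]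
      exact stronglyMeasurable_const
    · simp only [max_eq_left h]
      exact (hζ.mono (𝒢.mono h)).mul ((hX.1 r).sub ((hX.1 t).mono (𝒢.mono h)))
  · rcases le_total t i with h | h
    · simp only [max_eq_left h, max_eq_left (h.trans hij)]
      exact hpull i j h hij
    · simp only [max_eq_right h]
      have h1 := hpull t (max j t) le_rfl (le_max_right _ _)
      have h2 : P[P[fun ω => ζ ω * (X (max j t) ω - X t ω)|𝒢 t]|𝒢 i]
          =ᵐ[P] P[fun ω => ζ ω * (X (max j t) ω - X t ω)|𝒢 i] :=
        condExp_condExp_of_le (𝒢.mono h) (𝒢.le t)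
      refine h2.symm.trans ((condExp_congr_ae h1).trans ?_)
      simp

lemma _root_.MeasureTheory.Martingale.congr_ae {Y : ι → Ω → ℝ} (hX : Martingale X 𝒢 P)
    (hY : StronglyAdapted 𝒢 Y) (h : ∀ i, Y i =ᵐ[P] X i) : Martingale Y 𝒢 P :=
  ⟨hY, fun i j hij => (condExp_congr_ae (h j)).trans ((hX.2 i j hij).trans (h i).symm)⟩

end Martingale

/-! ### Wealth processes do not depend on the distortion -/

namespace Market

variable {Ω : Type*} [mΩ : MeasurableSpace Ω] {m n : ℕ} {M : Market Ω m n}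
  {t₀ : ℝ≥0} {x₀ : ℝ} {u : Strategy Ω n} {φ φ' : ℝ≥0 → Ω → Fin n → ℝ}

lemma measurable_path (h : IsStronglyPredictable M.F φ) (ω : Ω) : Measurable fun s => φ s ω :=
  (h.stronglyMeasurable_path ω).measurable

/-- Pairings of square integrable paths are integrable. -/
lemma integrableOn_dotProduct {f g : ℝ≥0 → Fin n → ℝ} {s : Set ℝ≥0}
    (hf : AEMeasurable f (timeVol.restrict s)) (hg : AEMeasurable g (timeVol.restrict s))
    (hf2 : ∫⁻ v in s, ENNReal.ofReal (f v ⬝ᵥ f v) ∂timeVol < ⊤)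
    (hg2 : ∫⁻ v in s, ENNReal.ofReal (g v ⬝ᵥ g v) ∂timeVol < ⊤) :
    IntegrableOn (fun v => f v ⬝ᵥ g v) s timeVol := by
  have hm : Measurable fun p : (Fin n → ℝ) × (Fin n → ℝ) => p.1 ⬝ᵥ p.2 := by
    simp only [dotProduct]
    fun_prop
  refine ⟨(hm.comp_aemeasurable (hf.prodMk hg)).aestronglyMeasurable, ?_⟩
  refine (lintegral_mono (g := fun v => ENNReal.ofReal (f v ⬝ᵥ f v) + ENNReal.ofReal (g v ⬝ᵥ g v))
    fun v => ?_).trans_lt ?_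
  · beta_reduce
    rw [Real.enorm_eq_ofReal_abs, ← ENNReal.ofReal_add (dotProduct_self_nonneg' _)
      (dotProduct_self_nonneg' _)]
    refine ENNReal.ofReal_le_ofReal ?_
    simp only [dotProduct, ← Finset.sum_add_distrib]
    refine (Finset.abs_sum_le_sum_abs _ _).trans (Finset.sum_le_sum fun i _ => ?_)
    rw [abs_le]
    constructor <;> nlinarith [sq_nonneg (f v i + g v i), sq_nonneg (f v i - g v i),
      sq_nonneg (f v i), sq_nonneg (g v i)]
  · have := measurable_dotProduct_self.comp_aemeasurable hf
    simp only [Function.comp_def] at this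
    rw [lintegral_add_left' this]
    exact ENNReal.add_lt_top.2 ⟨hf2, hg2⟩

/-- The distortion cancels in the wealth equation, so a solution for one distortion is also a
solution for any other distortion of finite energy. -/
lemma IsWealth.change_distortion (hp : IsStronglyPredictable M.F u.p)
    (hφ' : IsStronglyPredictable M.F φ')
    (hE' : ∀ᵐ ω ∂M.P, ∫⁻ s in Set.Ioc t₀ M.T, ENNReal.ofReal (φ' s ω ⬝ᵥ φ' s ω) ∂timeVol < ⊤)
    {X : ℝ≥0 → Ω → ℝ} (hX : M.IsWealth t₀ x₀ u φ X) : M.IsWealth t₀ x₀ u φ' X := by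
  obtain ⟨J, ⟨hJi, I, hI, hJ⟩, heq⟩ := hX.equation
  have hint : ∀ᵐ ω ∂M.P, IntegrableOn (fun s => (X s ω • u.p s ω) ⬝ᵥ φ' s ω) (Set.Ioc t₀ M.T)
      timeVol := by
    filter_upwards [hI.energy_lt_top, hE', hX.continuous] with ω h1 h2 h3
    refine integrableOn_dotProduct ?_ (measurable_path hφ' ω).aemeasurable h1 h2
    have hXm : AEMeasurable (fun s => X s ω) (timeVol.restrict (Set.Ioc t₀ M.T)) :=
      (h3.mono Set.Ioc_subset_Icc_self).aemeasurable measurableSet_Ioc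
    exact hXm.smul (measurable_path hp ω).aemeasurable
  have hdrift : ∀ s ω, X s ω * (M.r s ω + u.p s ω ⬝ᵥ (M.θ s ω + φ' s ω) - u.c s ω)
      = X s ω * (M.r s ω + u.p s ω ⬝ᵥ (M.θ s ω + φ s ω) - u.c s ω)
        - (X s ω • u.p s ω) ⬝ᵥ φ s ω + (X s ω • u.p s ω) ⬝ᵥ φ' s ω := by
    intro s ω
    simp only [dotProduct_add, smul_dotProduct, smul_eq_mul]
    ring
  refine ⟨hX.adapted, hX.continuous, hX.nonneg, ?_, _, ⟨hint, I, hI, fun t ω => rfl⟩, ?_⟩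
  · filter_upwards [hX.drift_integrable, hJi, hint] with ω h1 h2 h3
    simp only [hdrift]
    exact (h1.sub h2).add h3
  · filter_upwards [hX.drift_integrable, hJi, hint, heq] with ω h1 h2 h3 h4 t ht
    have hsub : Set.Ioc t₀ t ⊆ Set.Ioc t₀ M.T := Set.Ioc_subset_Ioc_right ht.2
    simp only [hdrift]
    have e1 := integral_add (Integrable.sub (h1.mono_set hsub) (h2.mono_set hsub))
      (h3.mono_set hsub)
    have e2 := integral_sub (h1.mono_set hsub) (h2.mono_set hsub)
    simp only [Pi.sub_apply] at e1 e2
    rw [h4 t ht, hJ, e1, e2]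
    ring

lemma Admissible.isWealth (h : M.Admissible t₀ x₀ u φ) :
    M.IsWealth t₀ x₀ u φ (M.wealth t₀ x₀ u φ) := by
  rw [wealth, dif_pos h.wealth_exists]
  exact h.wealth_exists.choose_spec

/-! ### The distorted measures -/

lemma Admissible.integrable_density (h : M.Admissible t₀ x₀ u φ) {t : ℝ≥0}
    (ht : t ∈ Set.Icc t₀ M.T) : Integrable (M.density t₀ φ t) M.P :=
  h.density_martingale.integrable ⟨t, ht⟩

lemma density_pos (t : ℝ≥0) (ω : Ω) : 0 < M.density t₀ φ t ω := Real.exp_pos _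

lemma Q_ac : M.Q t₀ φ ≪ M.P := withDensity_absolutelyContinuous _ _

lemma Admissible.ac_Q (h : M.Admissible t₀ x₀ u φ) (ht₀ : t₀ ≤ M.T) : M.P ≪ M.Q t₀ φ :=
  withDensity_absolutelyContinuous' (h.integrable_density ⟨ht₀, le_rfl⟩).1.aemeasurable.ennreal_ofReal
    (ae_of_all _ fun ω => by simpa using density_pos _ ω)

lemma Admissible.isFiniteMeasure_Q (h : M.Admissible t₀ x₀ u φ) (ht₀ : t₀ ≤ M.T) :
    IsFiniteMeasure (M.Q t₀ φ) :=
  isFiniteMeasure_withDensity_ofReal (h.integrable_density ⟨ht₀, le_rfl⟩).2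

lemma measurable_energy (hφ : IsStronglyPredictable M.F φ) (a t : ℝ≥0) : Measurable[M.F t] fun ω =>
    ∫⁻ s in Set.Ioc a t, ENNReal.ofReal (φ s ω ⬝ᵥ φ s ω) ∂timeVol := by
  refine measurable_setLIntegral (f := fun s ω => ENNReal.ofReal (φ s ω ⬝ᵥ φ s ω)) ?_ a t
  exact Measurable.stronglyMeasurable (measurable_dotProduct_self.comp hφ.measurable)

lemma Admissible.lintegral_energy (h : M.Admissible t₀ x₀ u φ) :
    ∫⁻ ω, ∫⁻ s in Set.Ioc t₀ M.T, ENNReal.ofReal (φ s ω ⬝ᵥ φ s ω) ∂timeVol ∂(M.Q t₀ φ) < ⊤ := by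
  simpa using h.φ_mem.2

lemma Admissible.energy_lt_top (h : M.Admissible t₀ x₀ u φ) (ht₀ : t₀ ≤ M.T) :
    ∀ᵐ ω ∂M.P, ∫⁻ s in Set.Ioc t₀ M.T, ENNReal.ofReal (φ s ω ⬝ᵥ φ s ω) ∂timeVol < ⊤ :=
  (h.ac_Q ht₀).ae_le (ae_lt_top ((measurable_energy h.φ_pred t₀ M.T).mono (M.F.le _) le_rfl)
    h.lintegral_energy.ne)

/-- The wealth of a strategy is the same for all admissible distortions. -/
lemma Admissible.wealth_eq (ht₀ : t₀ ≤ M.T) (h : M.Admissible t₀ x₀ u φ)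
    (h' : M.Admissible t₀ x₀ u φ') :
    ∀ᵐ ω ∂M.P, ∀ t ∈ Set.Icc t₀ M.T, M.wealth t₀ x₀ u φ t ω = M.wealth t₀ x₀ u φ' t ω :=
  h.wealth_unique _ _ h.isWealth
    (h'.isWealth.change_distortion h.p_pred h.φ_pred (h.energy_lt_top ht₀))

lemma IsWealth.initial (hP : IsProbabilityMeasure M.P) (ht₀ : t₀ ≤ M.T) {X : ℝ≥0 → Ω → ℝ}
    (hX : M.IsWealth t₀ x₀ u φ X) : X t₀ =ᵐ[M.P] fun _ => x₀ := by
  obtain ⟨J, ⟨-, I, hI, hJ⟩, heq⟩ := hX.equation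
  filter_upwards [heq, hI.ae_eq_zero ht₀] with ω h1 h2
  rw [h1 t₀ ⟨le_rfl, ht₀⟩, hJ, h2]
  simp

/-- Admissible wealth is strictly positive, by the moment condition with `q = -1`. -/
lemma Admissible.wealth_pos (h : M.Admissible t₀ x₀ u φ) (ht₀ : t₀ ≤ M.T) :
    ∀ᵐ ω ∂M.P, ∀ t ∈ Set.Icc t₀ M.T, 0 < M.wealth t₀ x₀ u φ t ω := by
  set X := M.wealth t₀ x₀ u φ
  have hX := h.isWealth
  obtain ⟨D, hDc, hD⟩ := TopologicalSpace.exists_countable_dense (Set.Icc t₀ M.T)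
  have hlt : ∀ᵐ ω ∂M.P, ⨆ t ∈ D, ENNReal.ofReal |X t ω| ^ (-1 : ℝ) < ⊤ := by
    refine (h.ac_Q ht₀).ae_le (ae_lt_top ?_ ?_)
    · refine Measurable.biSup _ hDc fun t _ => ?_
      have := ((hX.adapted t t.2).mono (M.F.le _)).measurable
      exact (measurable_norm.comp this).ennreal_ofReal.pow_const _
    · refine ne_top_of_le_ne_top (h.wealth_moments (-1) (by norm_num)).ne
        (lintegral_mono fun ω => iSup₂_le fun t _ => ?_)
      exact le_iSup₂_of_le (t : ℝ≥0) t.2 le_rfl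
  filter_upwards [hlt, hX.continuous, hX.nonneg] with ω h1 h2 h3 t ht
  refine (h3 t ht).lt_of_ne' fun h0 => ?_
  set c := ⨆ t ∈ D, ENNReal.ofReal |X t ω| ^ (-1 : ℝ) with hc
  have hcl : IsClosed {s : Set.Icc t₀ M.T | c⁻¹ ≤ ENNReal.ofReal |X s ω|} := by
    refine isClosed_le continuous_const ?_
    exact ENNReal.continuous_ofReal.comp (continuous_abs.comp h2.domRestrict)
  have hsub : closure D ⊆ {s : Set.Icc t₀ M.T | c⁻¹ ≤ ENNReal.ofReal |X s ω|} := by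
    refine hcl.closure_subset_iff.2 fun s hs => ?_
    rw [Set.mem_ofPred_eq, ENNReal.inv_le_iff_inv_le, ← ENNReal.rpow_neg_one]
    exact le_iSup₂_of_le (f := fun (t : Set.Icc t₀ M.T) (_ : t ∈ D) =>
      ENNReal.ofReal |X t ω| ^ (-1 : ℝ)) s hs le_rfl
  have h4 : c⁻¹ ≤ ENNReal.ofReal |X t ω| := hsub (hD ⟨t, ht⟩)
  have h0' : X t ω = 0 := h0
  rw [h0', abs_zero, ENNReal.ofReal_zero, nonpos_iff_eq_zero, ENNReal.inv_eq_zero] at h4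
  exact h1.ne h4

end Market

/-! ### Pasting of distortions -/

namespace Market

variable {Ω : Type*} [mΩ : MeasurableSpace Ω] {m n : ℕ} {M : Market Ω m n}
  {t₀ : ℝ≥0} {x₀ : ℝ} {u : Strategy Ω n} {φ φ' : ℝ≥0 → Ω → Fin n → ℝ} {t : ℝ≥0} {A : Set Ω}

lemma Admissible.isItoIntegral (h : M.Admissible t₀ x₀ u φ) :
    IsItoIntegral M.P M.F M.W t₀ M.T φ (itoIntegral M.P M.F M.W t₀ M.T φ) := by
  rw [itoIntegral, dif_pos h.ito_exists]
  exact h.ito_exists.choose_spec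

lemma isItoIntegral_paste (hP : IsProbabilityMeasure M.P) (h : M.Admissible t₀ x₀ u φ)
    (h' : M.Admissible t₀ x₀ u φ') (ht : t ∈ Set.Icc t₀ M.T) (hA : MeasurableSet[M.F t] A) :
    IsItoIntegral M.P M.F M.W t₀ M.T (pasteProc φ φ' t A) (pasteInt
      (itoIntegral M.P M.F M.W t₀ M.T φ) (itoIntegral M.P M.F M.W t₀ M.T φ') t A) :=
  h.isItoIntegral.paste h'.isItoIntegral ht hA

/-- The density process of a pasted distortion: after the switch it goes on with the increments of
`Λ(φ')` in the multiplicative sense. -/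
lemma density_paste (hM : M.Standing) (h : M.Admissible t₀ x₀ u φ)
    (h' : M.Admissible t₀ x₀ u φ') (ht : t ∈ Set.Icc t₀ M.T) (hA : MeasurableSet[M.F t] A)
    {r : ℝ≥0} (hr : r ∈ Set.Icc t₀ M.T) [∀ ω, Decidable (t < r ∧ ω ∈ A)] :
    M.density t₀ (pasteProc φ φ' t A) r =ᵐ[M.P] fun ω => if t < r ∧ ω ∈ A then
      M.density t₀ φ t ω * (M.density t₀ φ' r ω / M.density t₀ φ' t ω) else M.density t₀ φ r ω := by
  have hP := hM.prob
  have ht₀ := hr.1.trans hr.2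
  have hpath : ∀ ω, Measurable fun s => pasteProc φ φ' t A s ω :=
    measurable_path (isStronglyPredictable_paste h.φ_pred h'.φ_pred hA)
  have hpi := isItoIntegral_paste hP h h' ht hA
  have hI : IsItoIntegral M.P M.F M.W t₀ M.T (pasteProc φ φ' t A)
      (itoIntegral M.P M.F M.W t₀ M.T (pasteProc φ φ' t A)) := by
    have hex : ∃ I, IsItoIntegral M.P M.F M.W t₀ M.T (pasteProc φ φ' t A) I := ⟨_, hpi⟩
    rw [itoIntegral, dif_pos hex]
    exact hex.choose_spec
  have hsq : ∀ {ψ}, M.Admissible t₀ x₀ u ψ → ∀ ω,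
      ∫⁻ s in Set.Ioc t₀ M.T, ENNReal.ofReal (ψ s ω ⬝ᵥ ψ s ω) ∂timeVol < ⊤ →
      IntegrableOn (fun s => ψ s ω ⬝ᵥ ψ s ω) (Set.Ioc t₀ M.T) timeVol := fun hψ ω hlt =>
    integrableOn_dotProduct (measurable_path hψ.φ_pred ω).aemeasurable
      (measurable_path hψ.φ_pred ω).aemeasurable hlt hlt
  filter_upwards [hI.ae_eq hM.brownian hpath hpi hr, h.energy_lt_top ht₀, h'.energy_lt_top ht₀]
    with ω e1 e2 e3
  have i1 := hsq h ω e2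
  have i2 := hsq h' ω e3
  simp only [density, e1]
  split_ifs with hc
  · obtain ⟨htr, hω⟩ := hc
    have s1 : ∫ s in Set.Ioc t₀ r, pasteProc φ φ' t A s ω ⬝ᵥ pasteProc φ φ' t A s ω ∂timeVol
        = (∫ s in Set.Ioc t₀ t, φ s ω ⬝ᵥ φ s ω ∂timeVol)
          + ∫ s in Set.Ioc t r, φ' s ω ⬝ᵥ φ' s ω ∂timeVol := by
      have c1 : Set.EqOn (fun s => pasteProc φ φ' t A s ω ⬝ᵥ pasteProc φ φ' t A s ω)
          (fun s => φ s ω ⬝ᵥ φ s ω) (Set.Ioc t₀ t) := fun s hs => by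
        simp only [pasteProc, hs.2.not_gt, false_and, if_false]
      have c2 : Set.EqOn (fun s => pasteProc φ φ' t A s ω ⬝ᵥ pasteProc φ φ' t A s ω)
          (fun s => φ' s ω ⬝ᵥ φ' s ω) (Set.Ioc t r) := fun s hs => by
        simp only [pasteProc, hs.1, hω, true_and, if_true]
      rw [← Set.Ioc_union_Ioc_eq_Ioc ht.1 htr.le, setIntegral_union
        (Set.Ioc_disjoint_Ioc_of_le le_rfl) measurableSet_Ioc,
        setIntegral_congr_fun measurableSet_Ioc c1, setIntegral_congr_fun measurableSet_Ioc c2]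
      · exact (i1.mono_set (Set.Ioc_subset_Ioc_right ht.2)).congr_fun c1.symm measurableSet_Ioc
      · exact (i2.mono_set (Set.Ioc_subset_Ioc ht.1 hr.2)).congr_fun c2.symm measurableSet_Ioc
    have s2 : ∫ s in Set.Ioc t₀ r, φ' s ω ⬝ᵥ φ' s ω ∂timeVol
        = (∫ s in Set.Ioc t₀ t, φ' s ω ⬝ᵥ φ' s ω ∂timeVol)
          + ∫ s in Set.Ioc t r, φ' s ω ⬝ᵥ φ' s ω ∂timeVol := by
      rw [← Set.Ioc_union_Ioc_eq_Ioc ht.1 htr.le, setIntegral_union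
        (Set.Ioc_disjoint_Ioc_of_le le_rfl) measurableSet_Ioc
        (i2.mono_set (Set.Ioc_subset_Ioc_right ht.2)) (i2.mono_set (Set.Ioc_subset_Ioc ht.1 hr.2))]
    rw [s1, s2, ← Real.exp_sub, ← Real.exp_add]
    congr 1
    simp only [pasteInt, Set.indicator_of_mem hω, max_eq_left htr.le]
    ring
  · have s1 : ∫ s in Set.Ioc t₀ r, pasteProc φ φ' t A s ω ⬝ᵥ pasteProc φ φ' t A s ω ∂timeVol
        = ∫ s in Set.Ioc t₀ r, φ s ω ⬝ᵥ φ s ω ∂timeVol := by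
      refine setIntegral_congr_fun measurableSet_Ioc fun s hs => ?_
      have : ¬ (t < s ∧ ω ∈ A) := fun h => hc ⟨h.1.trans_le hs.2, h.2⟩
      simp only [pasteProc, this, if_false]
    have s2 : pasteInt (itoIntegral M.P M.F M.W t₀ M.T φ) (itoIntegral M.P M.F M.W t₀ M.T φ') t A r ω
        = itoIntegral M.P M.F M.W t₀ M.T φ r ω := by
      by_cases hω : ω ∈ A
      · have hrt : r ≤ t := not_lt.1 fun h => hc ⟨h, hω⟩
        simp [pasteInt, max_eq_right hrt]
      · simp [pasteInt, hω]
    rw [s1, s2]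

/-- The density process of a pasted distortion is a martingale, if the ratio of the two densities is
bounded on the event where the distortion is switched. -/
lemma density_paste_martingale (hM : M.Standing) (h : M.Admissible t₀ x₀ u φ)
    (h' : M.Admissible t₀ x₀ u φ') (ht : t ∈ Set.Icc t₀ M.T) (hA : MeasurableSet[M.F t] A)
    {K : ℝ≥0} (hK : ∀ ω ∈ A, M.density t₀ φ t ω / M.density t₀ φ' t ω ≤ K) :
    Martingale (fun (s : Set.Icc t₀ M.T) ω => M.density t₀ (pasteProc φ φ' t A) s ω)
      (filtrationOn M.F t₀ M.T) M.P := by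
  classical
  have hP := hM.prob
  have m1 := h.density_martingale.1 ⟨t, ht⟩
  have m2 := h'.density_martingale.1 ⟨t, ht⟩
  have hζ₁ := (m1.measurable.div m2.measurable).stronglyMeasurable.indicator hA
  have hζ₂ : StronglyMeasurable[filtrationOn M.F t₀ M.T ⟨t, ht⟩] (A.indicator fun _ => (1 : ℝ)) :=
    StronglyMeasurable.indicator stronglyMeasurable_const hA
  have key : ∀ {Z : Set.Icc t₀ M.T → Ω → ℝ}, Martingale Z (filtrationOn M.F t₀ M.T) M.P →
      (∀ (s : Set.Icc t₀ M.T) ω, (if t < (s : ℝ≥0) ∧ ω ∈ A then M.density t₀ φ t ω *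
        (M.density t₀ φ' s ω / M.density t₀ φ' t ω) else M.density t₀ φ s ω) = Z s ω) →
      Martingale (fun (s : Set.Icc t₀ M.T) ω => M.density t₀ (pasteProc φ φ' t A) s ω)
        (filtrationOn M.F t₀ M.T) M.P := by
    intro Z hZ heq
    have hae : ∀ s : Set.Icc t₀ M.T, M.density t₀ (pasteProc φ φ' t A) s =ᵐ[M.P] Z s := fun s =>
      (density_paste hM h h' ht hA s.2).trans (ae_of_all _ (heq s))
    exact hZ.congr_ae (fun s => (measurable_of_ae_eq hM.complete (hZ.1 s).measurable
      (hae s)).stronglyMeasurable) hae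
  refine key ((h.density_martingale.add (h'.density_martingale.mul_increment ⟨t, ht⟩ hζ₁ (C := K)
    fun ω => ?_)).sub (h.density_martingale.mul_increment ⟨t, ht⟩ hζ₂ (C := 1) fun ω => ?_))
    fun s ω => ?_
  · by_cases hω : ω ∈ A
    · simp only [Set.indicator_of_mem hω]
      have : 0 < (M.density t₀ φ t ω) / (M.density t₀ φ' t ω) :=
        div_pos (density_pos _ _) (density_pos _ _)
      exact (abs_of_pos this).trans_le (hK ω hω)
    · simp [hω]
  · by_cases hω : ω ∈ A <;> simp [hω]
  · simp only [Pi.sub_apply, Pi.add_apply]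
    have hpos := (density_pos (M := M) (t₀ := t₀) (φ := φ') t ω).ne'
    split_ifs with hc
    · have hmax : max s (⟨t, ht⟩ : Set.Icc t₀ M.T) = s := max_eq_left hc.1.le
      rw [hmax]
      simp only [Set.indicator_of_mem hc.2, Pi.div_apply]
      field_simp
      ring
    · by_cases hω : ω ∈ A
      · have hst : (s : ℝ≥0) ≤ t := not_lt.1 fun h => hc ⟨h, hω⟩
        have hmax : max s (⟨t, ht⟩ : Set.Icc t₀ M.T) = ⟨t, ht⟩ := max_eq_right hst
        simp [hmax]
      · simp [hω]

/-- Expectations under the measure of a pasted distortion: off `A` it is `Q(φ)`, and on `A` it is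
`Q(φ')` reweighted by the ratio of the densities at the time of the switch. -/
lemma lintegral_Q_paste (hM : M.Standing) (h : M.Admissible t₀ x₀ u φ)
    (h' : M.Admissible t₀ x₀ u φ') (ht : t ∈ Set.Icc t₀ M.T) (hA : MeasurableSet[M.F t] A)
    {f : Ω → ℝ≥0∞} (hf : AEMeasurable f M.P) :
    ∫⁻ ω, f ω ∂(M.Q t₀ (pasteProc φ φ' t A))
      = ∫⁻ ω in A, ENNReal.ofReal (M.density t₀ φ t ω / M.density t₀ φ' t ω) * f ω ∂(M.Q t₀ φ')
        + ∫⁻ ω in Aᶜ, f ω ∂(M.Q t₀ φ) := by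
  classical
  have ht₀ : t₀ ≤ M.T := ht.1.trans ht.2
  have hT : M.T ∈ Set.Icc t₀ M.T := ⟨ht₀, le_rfl⟩
  have hA' : MeasurableSet A := M.F.le t _ hA
  have d : ∀ {ψ}, M.Admissible t₀ x₀ u ψ → ∀ {s}, s ∈ Set.Icc t₀ M.T →
      AEMeasurable (M.density t₀ ψ s) M.P := fun hψ s hs => (hψ.integrable_density hs).1.aemeasurable
  have hp := density_paste hM h h' ht hA hT
  have dp : AEMeasurable (M.density t₀ (pasteProc φ φ' t A) M.T) M.P := by
    refine AEMeasurable.congr ?_ hp.symm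
    by_cases htT : t < M.T
    · simp only [htT, true_and]
      refine ((((d h ht).mul ((d h' hT).div (d h' ht))).indicator hA').add
        ((d h hT).indicator hA'.compl)).congr (ae_of_all _ fun ω => ?_)
      by_cases hω : ω ∈ A <;> simp [hω]
    · simp only [htT, false_and, if_false]
      exact d h hT
  have dw : AEMeasurable (fun ω => ENNReal.ofReal (M.density t₀ φ t ω / M.density t₀ φ' t ω)) M.P :=
    ((d h ht).div (d h' ht)).ennreal_ofReal
  have dwf : AEMeasurable (fun ω =>
      ENNReal.ofReal (M.density t₀ φ t ω / M.density t₀ φ' t ω) * f ω) M.P := dw.mul hf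
  rw [← lintegral_indicator hA', ← lintegral_indicator hA'.compl, Q, Q, Q,
    lintegral_withDensity_eq_lintegral_mul₀ dp.ennreal_ofReal hf,
    lintegral_withDensity_eq_lintegral_mul₀ (d h' hT).ennreal_ofReal (dwf.indicator hA'),
    lintegral_withDensity_eq_lintegral_mul₀ (d h hT).ennreal_ofReal (hf.indicator hA'.compl),
    ← lintegral_add_left' ((d h' hT).ennreal_ofReal.mul (dwf.indicator hA'))]
  refine lintegral_congr_ae ?_
  filter_upwards [hp] with ω e
  simp only [Pi.mul_apply]
  rw [e]
  by_cases hω : ω ∈ A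
  · have hpos := density_pos (M := M) (t₀ := t₀) (φ := φ') t ω
    simp only [hω, and_true, Set.indicator_of_mem, Set.mem_compl_iff, not_true_eq_false,
      not_false_eq_true, Set.indicator_of_notMem, mul_zero, add_zero]
    rw [← mul_assoc, ← ENNReal.ofReal_mul (density_pos _ _).le]
    congr 2
    split_ifs with htT
    · ring
    · have : M.T = t := le_antisymm (not_lt.1 htT) ht.2
      rw [this]
      field_simp
  · simp [hω]

lemma Q_paste_le (hM : M.Standing) (h : M.Admissible t₀ x₀ u φ)
    (h' : M.Admissible t₀ x₀ u φ') (ht : t ∈ Set.Icc t₀ M.T) (hA : MeasurableSet[M.F t] A)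
    {K : ℝ≥0} (hK : ∀ ω ∈ A, M.density t₀ φ t ω / M.density t₀ φ' t ω ≤ K) :
    M.Q t₀ (pasteProc φ φ' t A) ≤ K • M.Q t₀ φ' + M.Q t₀ φ := by
  refine Measure.le_iff.2 fun s hs => ?_
  have hA' : MeasurableSet A := M.F.le t _ hA
  have hK' : ∀ ω ∈ A, ENNReal.ofReal (M.density t₀ φ t ω / M.density t₀ φ' t ω) ≤ K := fun ω hω =>
    (ENNReal.ofReal_le_ofReal (hK ω hω)).trans (by simp)
  rw [← lintegral_indicator_one hs, lintegral_Q_paste hM h h' ht hA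
    (measurable_one.indicator hs).aemeasurable, Measure.add_apply]
  refine add_le_add ?_ ?_
  · refine (setLIntegral_mono_ae' hA' (g := fun ω => K * s.indicator 1 ω) (ae_of_all _ fun ω hω =>
      mul_le_mul_left (hK' ω hω) _)).trans ((setLIntegral_le_lintegral _ _).trans ?_)
    rw [lintegral_const_mul' _ _ (by simp), lintegral_indicator_one hs]
    rfl
  · refine (setLIntegral_le_lintegral _ _).trans ?_
    rw [lintegral_indicator_one hs]

/-- Admissibility is preserved by pasting at time `t` on an event `A` known at time `t`, if on `A` the
ratio of the densities and the energy spent up to time `t` are bounded. -/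
lemma Admissible.paste (hM : M.Standing) (h : M.Admissible t₀ x₀ u φ)
    (h' : M.Admissible t₀ x₀ u φ') (ht : t ∈ Set.Icc t₀ M.T) (hA : MeasurableSet[M.F t] A)
    {K : ℝ≥0} (hK : ∀ ω ∈ A, M.density t₀ φ t ω / M.density t₀ φ' t ω ≤ K)
    (hE : ∀ ω ∈ A, ∫⁻ s in Set.Ioc t₀ t, ENNReal.ofReal (φ s ω ⬝ᵥ φ s ω) ∂timeVol ≤ K) :
    M.Admissible t₀ x₀ u (pasteProc φ φ' t A) := by
  classical
  have hP := hM.prob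
  have ht₀ : t₀ ≤ M.T := ht.1.trans ht.2
  set ψ := pasteProc φ φ' t A with hψ
  have hpred : IsStronglyPredictable M.F ψ := isStronglyPredictable_paste h.φ_pred h'.φ_pred hA
  have hQ := Q_paste_le hM h h' ht hA hK
  have hfin' := h'.isFiniteMeasure_Q ht₀
  -- the energy of the pasted distortion
  have hen : ∀ ω, ω ∈ A → ∫⁻ s in Set.Ioc t₀ M.T, ENNReal.ofReal (ψ s ω ⬝ᵥ ψ s ω) ∂timeVol
      ≤ K + ∫⁻ s in Set.Ioc t₀ M.T, ENNReal.ofReal (φ' s ω ⬝ᵥ φ' s ω) ∂timeVol := by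
    intro ω hω
    rw [← Set.Ioc_union_Ioc_eq_Ioc ht.1 ht.2]
    refine (lintegral_union_le _ _ _).trans (add_le_add ?_ ?_)
    · refine le_trans (le_of_eq (setLIntegral_congr_fun measurableSet_Ioc fun s hs => ?_)) (hE ω hω)
      simp only [hψ, pasteProc, hs.2.not_gt, false_and, if_false]
    · rw [Set.Ioc_union_Ioc_eq_Ioc ht.1 ht.2]
      refine le_trans (le_of_eq (setLIntegral_congr_fun measurableSet_Ioc fun s hs => ?_))
          (lintegral_mono_set (Set.Ioc_subset_Ioc_left ht.1))
      simp only [hψ, pasteProc, hs.1, hω, true_and, if_true]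
  have hen' : ∀ ω, ω ∉ A → ∫⁻ s in Set.Ioc t₀ M.T, ENNReal.ofReal (ψ s ω ⬝ᵥ ψ s ω) ∂timeVol
      = ∫⁻ s in Set.Ioc t₀ M.T, ENNReal.ofReal (φ s ω ⬝ᵥ φ s ω) ∂timeVol := by
    intro ω hω
    simp only [hψ, pasteProc, hω, and_false, if_false]
  have hfinE : ∀ᵐ ω ∂M.P,
      ∫⁻ s in Set.Ioc t₀ M.T, ENNReal.ofReal (ψ s ω ⬝ᵥ ψ s ω) ∂timeVol < ⊤ := by
    filter_upwards [h.energy_lt_top ht₀, h'.energy_lt_top ht₀] with ω e1 e2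
    by_cases hω : ω ∈ A
    · exact (hen ω hω).trans_lt (ENNReal.add_lt_top.2 ⟨by simp, e2⟩)
    · rw [hen' ω hω]
      exact e1
  have hW₁ : ∀ X, M.IsWealth t₀ x₀ u φ X → M.IsWealth t₀ x₀ u ψ X := fun X hX =>
    hX.change_distortion h.p_pred hpred hfinE
  have hW₂ : ∀ X, M.IsWealth t₀ x₀ u ψ X → M.IsWealth t₀ x₀ u φ X := fun X hX =>
    hX.change_distortion h.p_pred h.φ_pred (h.energy_lt_top ht₀)
  have hex : ∃ X, M.IsWealth t₀ x₀ u ψ X := ⟨_, hW₁ _ h.isWealth⟩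
  have hXψ : M.IsWealth t₀ x₀ u ψ (M.wealth t₀ x₀ u ψ) := by
    rw [wealth, dif_pos hex]
    exact hex.choose_spec
  have hXeq : ∀ᵐ ω ∂M.P, ∀ s ∈ Set.Icc t₀ M.T, M.wealth t₀ x₀ u ψ s ω = M.wealth t₀ x₀ u φ s ω :=
    h.wealth_unique _ _ (hW₂ _ hXψ) h.isWealth
  have hXeq' : ∀ᵐ ω ∂M.P, ∀ s ∈ Set.Icc t₀ M.T,
      M.wealth t₀ x₀ u ψ s ω = M.wealth t₀ x₀ u φ' s ω := by
    filter_upwards [hXeq, h.wealth_eq ht₀ h'] with ω e1 e2 s hs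
    rw [e1 s hs, e2 s hs]
  -- transfer of finite expectations
  have hfin : ∀ {f f₁ f₂ : Ω → ℝ≥0∞}, f =ᵐ[M.P] f₁ → f =ᵐ[M.P] f₂ →
      ∫⁻ ω, f₁ ω ∂(M.Q t₀ φ) < ⊤ → ∫⁻ ω, f₂ ω ∂(M.Q t₀ φ') < ⊤ →
      ∫⁻ ω, f ω ∂(M.Q t₀ ψ) < ⊤ := by
    intro f f₁ f₂ e1 e2 h1 h2
    refine (lintegral_mono' hQ le_rfl).trans_lt ?_
    rw [lintegral_add_measure, lintegral_smul_measure,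
      lintegral_congr_ae (μ := M.Q t₀ φ) (Q_ac.ae_le e1),
      lintegral_congr_ae (μ := M.Q t₀ φ') (Q_ac.ae_le e2)]
    exact ENNReal.add_lt_top.2 ⟨ENNReal.mul_lt_top (by simp) h2, h1⟩
  have hadX : ∀ s ∈ Set.Icc t₀ M.T, Measurable[M.F s] (M.wealth t₀ x₀ u ψ s) := fun s hs =>
    (hXψ.adapted s hs).measurable
  refine ⟨h.p_pred, h.c_pred, hpred, h.p_mem, h.c_mem, hex, fun X Y hX hY =>
    h.wealth_unique X Y (hW₂ X hX) (hW₂ Y hY), fun q hq => ?_, ⟨_, isItoIntegral_paste hP h h' ht hA⟩,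
    density_paste_martingale hM h h' ht hA hK, ⟨fun s hs => ?_, ?_⟩, ⟨fun s hs => ?_, ?_⟩,
    ⟨fun s _ => hpred.stronglyAdapted s, ?_⟩⟩
  · refine hfin ?_ ?_ (h.wealth_moments q hq) (h'.wealth_moments q hq)
    · filter_upwards [hXeq] with ω e
      exact iSup_congr fun s => iSup_congr fun hs => by rw [e s hs]
    · filter_upwards [hXeq'] with ω e
      exact iSup_congr fun s => iSup_congr fun hs => by rw [e s hs]
  · exact ((hadX s hs).smul (h.p_pred.stronglyAdapted s).measurable).stronglyMeasurable
  · refine hfin ?_ ?_ h.pX_mem.2 h'.pX_mem.2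
    · filter_upwards [hXeq] with ω e
      congr 1
      exact setLIntegral_congr_fun measurableSet_Ioc fun s hs => by
        simp only [e s (Set.Ioc_subset_Icc_self hs)]
    · filter_upwards [hXeq'] with ω e
      congr 1
      exact setLIntegral_congr_fun measurableSet_Ioc fun s hs => by
        simp only [e s (Set.Ioc_subset_Icc_self hs)]
  · exact (@measurable_pi_lambda Ω (Fin 1) (fun _ => ℝ) (M.F s) _ _ fun _ =>
      ((h.c_pred.stronglyAdapted s).measurable.mul (hadX s hs))).stronglyMeasurable
  · refine hfin ?_ ?_ h.cX_mem.2 h'.cX_mem.2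
    · filter_upwards [hXeq] with ω e
      congr 1
      exact setLIntegral_congr_fun measurableSet_Ioc fun s hs => by
        simp only [e s (Set.Ioc_subset_Icc_self hs)]
    · filter_upwards [hXeq'] with ω e
      congr 1
      exact setLIntegral_congr_fun measurableSet_Ioc fun s hs => by
        simp only [e s (Set.Ioc_subset_Icc_self hs)]
  · have hm : Measurable fun ω => ∫⁻ s in Set.Ioc t₀ M.T, ENNReal.ofReal (ψ s ω ⬝ᵥ ψ s ω) ∂timeVol :=
      (measurable_energy hpred t₀ M.T).mono (M.F.le _) le_rfl
    have hA' : MeasurableSet A := M.F.le t _ hA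
    norm_num only [div_self, ENNReal.rpow_one]
    rw [lintegral_Q_paste hM h h' ht hA hm.aemeasurable]
    refine ENNReal.add_lt_top.2 ⟨?_, ?_⟩
    · refine (setLIntegral_mono_ae' hA' (g := fun ω => K * (K + ∫⁻ s in Set.Ioc t₀ M.T,
        ENNReal.ofReal (φ' s ω ⬝ᵥ φ' s ω) ∂timeVol)) (ae_of_all _ fun ω hω =>
        mul_le_mul' ?_ (hen ω hω))).trans_lt ((setLIntegral_le_lintegral _ _).trans_lt ?_)
      · exact (ENNReal.ofReal_le_ofReal (hK ω hω)).trans (by simp)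
      · rw [lintegral_const_mul' _ _ (by simp), lintegral_add_left measurable_const, lintegral_const]
        exact ENNReal.mul_lt_top (by simp) (ENNReal.add_lt_top.2
          ⟨ENNReal.mul_lt_top (by simp) (measure_lt_top _ _), h'.lintegral_energy⟩)
    · refine lt_of_le_of_lt ?_ h.lintegral_energy
      refine le_trans (le_of_eq (setLIntegral_congr_fun hA'.compl fun ω hω => ?_))
        (setLIntegral_le_lintegral _ _)
      exact hen' ω hω

end Market

/-! ### Measurability of the payoff -/

/-- Composition of a random field, continuous in the space variable, with a random variable. -/
lemma measurable_randomField_comp {α : Type*} {mα : MeasurableSpace α} {g : α → ℝ → ℝ}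
    (hc : ∀ a, Continuous (g a)) (hm : ∀ q : ℚ, Measurable fun a => g a q) {y : α → ℝ}
    (hy : Measurable y) : Measurable fun a => g a (y a) := by
  have hall : ∀ x : ℝ, Measurable fun a => g a x := by
    intro x
    obtain ⟨r, -, -, hr⟩ := Real.exists_seq_rat_strictMono_tendsto x
    exact measurable_of_tendsto_metrizable (fun k => hm (r k))
      (tendsto_pi_nhds.2 fun a => ((hc a).tendsto x).comp hr)
  exact (measurable_uncurry_of_continuous_of_measurable (u := fun x a => g a x) hc hall).comp
    (hy.prodMk measurable_id)

namespace Market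

variable {Ω : Type*} [mΩ : MeasurableSpace Ω] {m n : ℕ} {M : Market Ω m n}
  {t₀ : ℝ≥0} {x₀ : ℝ} {u : Strategy Ω n} {φ φ' : ℝ≥0 → Ω → Fin n → ℝ} {t : ℝ≥0}
  {v : ℝ≥0 → Ω → ℝ → ℝ}

/-- A path on which the random field `v` is continuous in both variables separately, the times being
tested at a countable dense set of wealths. -/
def RegularPath (M : Market Ω m n) (v : ℝ≥0 → Ω → ℝ → ℝ) (ω : Ω) : Prop :=
  (∀ t ≤ M.T, ContinuousOn (v t ω) (Set.Ioi 0)) ∧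
    ∀ q : ℚ, ContinuousOn (fun t => v t ω (Real.exp q)) (Set.Icc 0 M.T)

lemma Regular.ae_regularPath (hv : M.Regular v) : ∀ᵐ ω ∂M.P, M.RegularPath v ω := by
  filter_upwards [hv.smooth, ae_all_iff.2 fun q : ℚ => hv.continuous (Real.exp q) (Real.exp_pos _)]
    with ω h1 h2 using ⟨fun t ht => (h1 t ht).continuousOn, h2⟩

open scoped Classical in
/-- A modification of `v` in logarithmic coordinates, continuous in each variable on every path. -/
def logField (M : Market Ω m n) (v : ℝ≥0 → Ω → ℝ → ℝ) (t : ℝ≥0) (ω : Ω) (y : ℝ) : ℝ :=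
  if M.RegularPath v ω then v (min t M.T) ω (Real.exp y) else 0

lemma continuous_logField (t : ℝ≥0) (ω : Ω) : Continuous (M.logField v t ω) := by
  unfold logField
  split_ifs with h
  · exact (h.1 _ (min_le_right _ _)).comp_continuous Real.continuous_exp fun y => Real.exp_pos y
  · exact continuous_const

lemma logField_eq {ω : Ω} (h : M.RegularPath v ω) (ht : t ≤ M.T) {x : ℝ} (hx : 0 < x) :
    M.logField v t ω (Real.log x) = v t ω x := by
  rw [logField, if_pos h, min_eq_left ht, Real.exp_log hx]

lemma measurable_logField (hM : M.Standing) (hv : M.Regular v) (t : ℝ≥0) (y : ℝ) :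
    Measurable[M.F t] fun ω => M.logField v t ω y := by
  classical
  have hset : MeasurableSet[M.F t] {ω | M.RegularPath v ω} := by
    have h0 : MeasurableSet[M.F 0] {ω | M.RegularPath v ω}ᶜ := hM.complete _ hv.ae_regularPath
    have h1 : MeasurableSet[M.F 0] {ω | M.RegularPath v ω} := by simpa using h0.compl
    exact M.F.mono zero_le _ h1
  refine Measurable.ite hset ?_ measurable_const
  exact ((hv.adapted _ (Real.exp_pos y) _ (min_le_right t M.T)).mono
    (M.F.mono (min_le_left _ _))).measurable

lemma measurable_logField_uncurry (hM : M.Standing) (hv : M.Regular v) {Y : ℝ≥0 × Ω → ℝ}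
    (hY : Measurable Y) : Measurable fun p : ℝ≥0 × Ω => M.logField v p.1 p.2 (Y p) := by
  refine measurable_randomField_comp (g := fun p : ℝ≥0 × Ω => M.logField v p.1 p.2)
    (fun p => continuous_logField _ _) (fun q => ?_) hY
  refine measurable_uncurry_of_continuous_of_measurable (u := fun t ω => M.logField v t ω q)
    (fun ω => ?_) fun t => (measurable_logField hM hv t q).mono (M.F.le t) le_rfl
  unfold logField
  split_ifs with h
  · exact (h.2 q).comp_continuous (continuous_id.min continuous_const)
      fun t => ⟨zero_le, min_le_right _ _⟩
  · exact continuous_const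

/-- An adapted process with almost surely continuous paths agrees on `[t₀, T]` with a jointly
measurable process. -/
lemma IsWealth.exists_measurable (hM : M.Standing) (ht₀ : t₀ ≤ M.T) {X : ℝ≥0 → Ω → ℝ}
    (hX : M.IsWealth t₀ x₀ u φ X) : ∃ Z : ℝ≥0 × Ω → ℝ, Measurable Z ∧
      ∀ᵐ ω ∂M.P, ∀ s ∈ Set.Icc t₀ M.T, X s ω = Z (s, ω) := by
  classical
  have hset : MeasurableSet {ω | ContinuousOn (fun t => X t ω) (Set.Icc t₀ M.T)} := by
    have h0 : MeasurableSet[M.F 0] {ω | ContinuousOn (fun t => X t ω) (Set.Icc t₀ M.T)}ᶜ :=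
      hM.complete _ hX.continuous
    have h1 : MeasurableSet[M.F 0] {ω | ContinuousOn (fun t => X t ω) (Set.Icc t₀ M.T)} := by
      simpa using h0.compl
    exact M.F.le _ _ h1
  refine ⟨Function.uncurry fun s ω => if ContinuousOn (fun t => X t ω) (Set.Icc t₀ M.T) then
    X (max t₀ (min s M.T)) ω else 0, ?_, ?_⟩
  · have hmem : ∀ s, max t₀ (min s M.T) ∈ Set.Icc t₀ M.T := fun s =>
      ⟨le_max_left _ _, max_le ht₀ (min_le_right _ _)⟩
    refine measurable_uncurry_of_continuous_of_measurable (fun ω => ?_) fun s => ?_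
    · split_ifs with h
      · exact h.comp_continuous (by fun_prop) hmem
      · exact continuous_const
    · exact Measurable.ite hset ((hX.adapted _ (hmem s)).mono (M.F.le _)).measurable measurable_const
  · filter_upwards [hX.continuous] with ω h s hs
    simp only [Function.uncurry, if_pos h, min_eq_left hs.2, max_eq_right hs.1]

/-- The random field evaluated at a positive wealth known at time `t` is known at time `t`. -/
lemma measurable_field_wealth (hM : M.Standing) (hv : M.Regular v)
    (h : M.Admissible t₀ x₀ u φ) (ht : t ∈ Set.Icc t₀ M.T) :
    Measurable[M.F t] fun ω => v t ω (M.wealth t₀ x₀ u φ t ω) := by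
  have hlog : Measurable[M.F t] fun ω => Real.log (M.wealth t₀ x₀ u φ t ω) :=
    Real.measurable_log.comp (h.isWealth.adapted t ht).measurable
  refine measurable_of_ae_eq hM.complete (measurable_randomField_comp (mα := M.F t)
    (g := M.logField v t) (fun ω => continuous_logField t ω)
    (fun q => measurable_logField hM hv t q) hlog) ?_
  filter_upwards [hv.ae_regularPath, h.wealth_pos (ht.1.trans ht.2)] with ω h1 h2
  exact (logField_eq h1 ht.2 (h2 t ht)).symm

lemma measurable_U₁ : Measurable M.U₁ := by
  unfold U₁
  refine Measurable.ite ?_ measurable_const ?_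
  · by_cases h : 1 < M.γ
    · simp [h]
    · simp [h]
  · exact measurable_coe_real_ereal.comp ((measurable_id.pow_const _).div_const _)

lemma measurable_U₂ : Measurable M.U₂ := measurable_const.mul measurable_U₁

lemma U₂_of_pos {x : ℝ} (hx : 0 < x) :
    M.U₂ x = ((M.β * (x ^ (1 - M.γ) / (1 - M.γ)) : ℝ) : EReal) := by
  rw [U₂, U₁, if_neg (fun h => hx.ne' h.1), EReal.coe_mul]

/-- The terminal condition, assumed almost surely for each fixed wealth, holds at the random terminal
wealth: on a regular path it extends from a countable dense set of wealths by continuity. -/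
lemma field_terminal (hv : M.Regular v) (h : M.Admissible t₀ x₀ u φ) (ht₀ : t₀ ≤ M.T) :
    ∀ᵐ ω ∂M.P, ((v M.T ω (M.wealth t₀ x₀ u φ M.T ω) : ℝ) : EReal)
      = M.U₂ (M.wealth t₀ x₀ u φ M.T ω) := by
  filter_upwards [hv.ae_regularPath, h.wealth_pos ht₀,
    ae_all_iff.2 fun q : ℚ => hv.terminal (Real.exp q) (Real.exp_pos _)] with ω h1 h2 h3
  have hx := h2 M.T ⟨ht₀, le_rfl⟩
  set x := M.wealth t₀ x₀ u φ M.T ω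
  have c1 : Continuous fun y => v M.T ω (Real.exp y) :=
    (h1.1 _ le_rfl).comp_continuous Real.continuous_exp fun y => Real.exp_pos y
  have c2 : Continuous fun y => M.β * (Real.exp y ^ (1 - M.γ) / (1 - M.γ)) :=
    ((Real.continuous_exp.rpow_const fun y => Or.inl (Real.exp_pos y).ne').div_const _).const_mul _
  have heq : (fun y => v M.T ω (Real.exp y))
      = fun y => M.β * (Real.exp y ^ (1 - M.γ) / (1 - M.γ)) := by
    refine Continuous.ext_on Rat.denseRange_cast c1 c2 ?_
    rintro _ ⟨q, rfl⟩
    have := h3 q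
    rw [U₂_of_pos (Real.exp_pos _)] at this
    exact_mod_cast this
  have := congrFun heq (Real.log x)
  simp only [Real.exp_log hx] at this
  rw [this, U₂_of_pos hx]

lemma measurable_disc_uncurry (hM : M.Standing) (t : ℝ≥0) :
    Measurable fun p : ℝ≥0 × Ω => M.disc t p.1 p.2 := by
  have h : StronglyMeasurable fun q : (ℝ≥0 × Ω) × ℝ≥0 =>
      (Set.Ioc t q.1.1).indicator (fun v => M.ρ v q.1.2) q.2 := by
    have h1 : MeasurableSet {q : (ℝ≥0 × Ω) × ℝ≥0 | t < q.2} :=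
      measurableSet_lt measurable_const measurable_snd
    have h2 : MeasurableSet {q : (ℝ≥0 × Ω) × ℝ≥0 | q.2 ≤ q.1.1} :=
      measurableSet_le measurable_snd measurable_fst.fst
    have hset : MeasurableSet {q : (ℝ≥0 × Ω) × ℝ≥0 | q.2 ∈ Set.Ioc t q.1.1} := h1.inter h2
    have hρ : StronglyMeasurable fun q : (ℝ≥0 × Ω) × ℝ≥0 => M.ρ q.2 q.1.2 :=
      hM.ρ_pred.stronglyMeasurable_uncurry.comp_measurable
        (measurable_snd.prodMk measurable_fst.snd)
    exact hρ.indicator hset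
  have h2 := (h.integral_prod_right' (ν := timeVol)).measurable
  have e : ∀ p : ℝ≥0 × Ω, ∫ v, (Set.Ioc t p.1).indicator (fun v => M.ρ v p.2) v ∂timeVol
      = ∫ v in Set.Ioc t p.1, M.ρ v p.2 ∂timeVol := fun p => integral_indicator measurableSet_Ioc
  simp only [e] at h2
  exact Real.measurable_exp.comp h2.neg

lemma measurable_disc (hM : M.Standing) (a t : ℝ≥0) : Measurable[M.F t] (M.disc a t) :=
  Real.measurable_exp.comp (stronglyMeasurable_setIntegral hM.ρ_pred a t).measurable.neg

lemma disc_pos (a t : ℝ≥0) (ω : Ω) : 0 < M.disc a t ω := Real.exp_pos _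

lemma disc_mul (hM : M.Standing) {a b c : ℝ≥0} (hab : a ≤ b) (hbc : b ≤ c) (hc : c ≤ M.T) (ω : Ω) :
    M.disc a c ω = M.disc a b ω * M.disc b c ω := by
  obtain ⟨C, hC⟩ := hM.bounded
  have hint : IntegrableOn (fun v => M.ρ v ω) (Set.Ioc a c) timeVol := by
    refine Measure.integrableOn_of_bounded (M := C) ?_
      (hM.ρ_pred.stronglyMeasurable_path ω).aestronglyMeasurable
      ((ae_restrict_iff' measurableSet_Ioc).2 (ae_of_all _ fun v hv => ?_))
    · rw [timeVol_Ioc]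
      exact ENNReal.ofReal_ne_top
    · exact (hC v (hv.2.trans hc) ω).2.1
  rw [disc, disc, disc, ← Real.exp_add, ← Set.Ioc_union_Ioc_eq_Ioc hab hbc, setIntegral_union
    (Set.Ioc_disjoint_Ioc_of_le le_rfl) measurableSet_Ioc
    (hint.mono_set (Set.Ioc_subset_Ioc_right hbc)) (hint.mono_set (Set.Ioc_subset_Ioc_left hab))]
  congr 1
  ring

/-- The payoff of an admissible pair is measurable up to a null set; the field and the wealth are
replaced by jointly measurable versions. -/
lemma aemeasurable_payoff (hM : M.Standing) (hv : M.Regular v) (h : M.Admissible t₀ x₀ u φ)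
    (ht : t ∈ Set.Icc t₀ M.T) : AEMeasurable
      (M.payoff (M.R v u φ (M.wealth t₀ x₀ u φ)) (M.wealth t₀ x₀ u φ) t) M.P := by
  have ht₀ := ht.1.trans ht.2
  obtain ⟨Z, hZ, hZe⟩ := h.isWealth.exists_measurable hM ht₀
  set q : ℝ≥0 × Ω → EReal := fun p => (M.disc t p.1 p.2 : EReal) *
    ((((1 - M.γ) / 2 * (φ p.1 p.2 ⬝ᵥ (M.H⁻¹ *ᵥ φ p.1 p.2))
        * M.logField v p.1 p.2 (Real.log (Z p)) : ℝ) : EReal)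
      + M.U₁ (u.c p.1 p.2 * Z p)) with hq
  have hφm : Measurable fun p : ℝ≥0 × Ω => φ p.1 p.2 :=
    h.φ_pred.stronglyMeasurable_uncurry.measurable
  have hcm : Measurable fun p : ℝ≥0 × Ω => u.c p.1 p.2 :=
    h.c_pred.stronglyMeasurable_uncurry.measurable
  have hquad : Measurable fun y : Fin n → ℝ => y ⬝ᵥ (M.H⁻¹ *ᵥ y) := by
    simp only [dotProduct, Matrix.mulVec]
    fun_prop
  have hqm : Measurable q := by
    refine (measurable_coe_real_ereal.comp (measurable_disc_uncurry hM t)).mul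
      (Measurable.add ?_ (measurable_U₁.comp (hcm.mul hZ)))
    exact measurable_coe_real_ereal.comp (((hquad.comp hφm).const_mul _).mul
      (measurable_logField_uncurry hM hv (Real.measurable_log.comp hZ)))
  have hp : Measurable fun ω =>
      ∫⁻ s, (q (s, ω)).toENNReal ∂(timeVol.restrict (Set.Ioc t M.T)) :=
    Measurable.lintegral_prod_left' (f := fun p => (q p).toENNReal) hqm.ereal_toENNReal
  have hn : Measurable fun ω =>
      ∫⁻ s, (-q (s, ω)).toENNReal ∂(timeVol.restrict (Set.Ioc t M.T)) :=
    Measurable.lintegral_prod_left' (f := fun p => (-q p).toENNReal) hqm.neg.ereal_toENNReal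
  have hG : Measurable fun ω => eintegral (timeVol.restrict (Set.Ioc t M.T)) (fun s => q (s, ω))
      + (M.disc t M.T ω : EReal) * M.U₂ (M.wealth t₀ x₀ u φ M.T ω) := by
    refine (hp.coe_ereal_ennreal.sub hn.coe_ereal_ennreal).add (Measurable.mul ?_ ?_)
    · exact measurable_coe_real_ereal.comp ((measurable_disc hM t M.T).mono (M.F.le _) le_rfl)
    · exact measurable_U₂.comp
        ((h.isWealth.adapted _ ⟨ht₀, le_rfl⟩).mono (M.F.le _)).measurable
  refine ⟨_, hG, ?_⟩
  filter_upwards [hZe, hv.ae_regularPath, h.wealth_pos ht₀] with ω e1 e2 e3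
  rw [payoff]
  congr 1
  have hval : ∀ s ∈ Set.Ioc t M.T,
      (M.disc t s ω : EReal) * M.R v u φ (M.wealth t₀ x₀ u φ) s ω = q (s, ω) := by
    intro s hs
    have hs' : s ∈ Set.Icc t₀ M.T := ⟨ht.1.trans hs.1.le, hs.2⟩
    simp only [hq, R, ← e1 s hs', logField_eq e2 hs.2 (e3 s hs')]
  rw [eintegral, eintegral]
  congr 2
  · exact setLIntegral_congr_fun measurableSet_Ioc fun s hs => by simp only [hval s hs]
  · exact setLIntegral_congr_fun measurableSet_Ioc fun s hs => by simp only [hval s hs]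

/-! ### Splitting the payoff at an intermediate time -/

lemma reward_eq_R (hM : M.Standing) (X : ℝ≥0 → Ω → ℝ) : M.reward v u φ X = M.R v u φ X := by
  ext s ω
  rw [reward, R, add_comm]
  congr 2
  have hH : M.H⁻¹ = Matrix.diagonal fun i => (M.η i)⁻¹ := by
    refine Matrix.inv_eq_right_inv ?_
    rw [H, Matrix.diagonal_mul_diagonal, ← Matrix.diagonal_one]
    congr 1
    ext i
    exact mul_inv_cancel₀ (hM.η_pos i).ne'
  simp only [hH, dotProduct, Matrix.mulVec_diagonal, Finset.mul_sum, Finset.sum_mul, Ψ]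
  refine Finset.sum_congr rfl fun i _ => ?_
  have hη := (hM.η_pos i).ne'
  by_cases h0 : (1 - M.γ) * v s ω (X s ω) = 0
  · have : (1 - M.γ) / 2 * (φ s ω i * ((M.η i)⁻¹ * φ s ω i)) * v s ω (X s ω)
        = ((1 - M.γ) * v s ω (X s ω)) * (φ s ω i * ((M.η i)⁻¹ * φ s ω i)) / 2 := by ring
    rw [this, h0]
    simp
  · have h1 : 1 - M.γ ≠ 0 := left_ne_zero_of_mul h0
    have h2 : v s ω (X s ω) ≠ 0 := right_ne_zero_of_mul h0
    field_simp

lemma coe_add_mul_sub {a b p q : ℝ≥0∞} (ha : a ≠ ⊤) (hb : b ≠ ⊤) {d : ℝ} (hd : 0 < d) :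
    ((a + ENNReal.ofReal d * p : ℝ≥0∞) : EReal) - ((b + ENNReal.ofReal d * q : ℝ≥0∞) : EReal)
      = ((a.toReal - b.toReal : ℝ) : EReal) + d * ((p : EReal) - q) := by
  have hd' : ENNReal.ofReal d ≠ 0 := by simpa using hd
  have e : ∀ z : ℝ≥0, ((z : ℝ≥0∞) : EReal) = ((z : ℝ) : EReal) := fun z => rfl
  lift a to ℝ≥0 using ha
  lift b to ℝ≥0 using hb
  by_cases hq : q = ⊤
  · simp [hq, ENNReal.mul_top hd', EReal.coe_mul_bot_of_pos hd, sub_eq_add_neg]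
  lift q to ℝ≥0 using hq
  have hbq : ((b + ENNReal.ofReal d * q : ℝ≥0∞)) = ((b + d.toNNReal * q : ℝ≥0) : ℝ≥0∞) := by
    rw [ENNReal.ofReal]; norm_cast
  by_cases hp : p = ⊤
  · rw [hp, ENNReal.mul_top hd', hbq, e, e, add_top, EReal.coe_ennreal_top, EReal.top_sub_coe,
      EReal.top_sub_coe, EReal.coe_mul_top_of_pos hd, EReal.coe_add_top]
  lift p to ℝ≥0 using hp
  have hap : ((a + ENNReal.ofReal d * p : ℝ≥0∞)) = ((a + d.toNNReal * p : ℝ≥0) : ℝ≥0∞) := by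
    rw [ENNReal.ofReal]; norm_cast
  rw [hbq, hap, e, e, e, e]
  simp only [← EReal.coe_sub, ← EReal.coe_mul, ← EReal.coe_add]
  congr 1
  push_cast
  rw [Real.coe_toNNReal _ hd.le]
  simp
  ring

lemma coe_ennreal_sub_finite {p q : ℝ≥0∞} (h1 : (p : EReal) - q ≠ ⊤) (h2 : (p : EReal) - q ≠ ⊥) :
    p ≠ ⊤ ∧ q ≠ ⊤ ∧ (p : EReal) - q = ((p.toReal - q.toReal : ℝ) : EReal) := by
  have e : ∀ z : ℝ≥0, ((z : ℝ≥0∞) : EReal) = ((z : ℝ) : EReal) := fun z => rfl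
  have hq : q ≠ ⊤ := by
    rintro rfl
    simp [sub_eq_add_neg] at h2
  lift q to ℝ≥0 using hq
  have hp : p ≠ ⊤ := by
    rintro rfl
    exact h1 (by rw [e, EReal.coe_ennreal_top, EReal.top_sub_coe])
  lift p to ℝ≥0 using hp
  refine ⟨by simp, by simp, ?_⟩
  rw [e, e, ← EReal.coe_sub]
  simp

/-- If the discounted reward up to time `t` is finite on a path, then the payoff is that reward plus the
discounted payoff from `t` on. -/
lemma payoff_split (hM : M.Standing) (ht : t ∈ Set.Icc t₀ M.T) {q : ℝ≥0 → Ω → EReal}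
    {X : ℝ≥0 → Ω → ℝ} {ω : Ω} {g : ℝ}
    (hg : eintegral (timeVol.restrict (Set.Ioc t₀ t)) (fun s => (M.disc t₀ s ω : EReal) * q s ω)
      = g) :
    M.payoff q X t₀ ω = g + M.disc t₀ t ω * M.payoff q X t ω := by
  have hd := disc_pos (M := M) t₀ t ω
  have hd0 : (0 : EReal) ≤ (M.disc t₀ t ω : EReal) := by exact_mod_cast hd.le
  obtain ⟨h1, h2, h3⟩ := coe_ennreal_sub_finite (hg.trans_ne (EReal.coe_ne_top g))
    (hg.trans_ne (EReal.coe_ne_bot g))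
  have hsplit : ∀ (f f' : ℝ≥0 → ℝ≥0∞),
      (∀ s ∈ Set.Ioc t M.T, f s = ENNReal.ofReal (M.disc t₀ t ω) * f' s) →
      ∫⁻ s in Set.Ioc t₀ M.T, f s ∂timeVol = ∫⁻ s in Set.Ioc t₀ t, f s ∂timeVol
        + ENNReal.ofReal (M.disc t₀ t ω) * ∫⁻ s in Set.Ioc t M.T, f' s ∂timeVol := by
    intro f f' hf
    rw [← lintegral_const_mul' _ _ ENNReal.ofReal_ne_top, ← Set.Ioc_union_Ioc_eq_Ioc ht.1 ht.2,
      lintegral_union measurableSet_Ioc (Set.Ioc_disjoint_Ioc_of_le le_rfl)]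
    congr 1
    exact setLIntegral_congr_fun measurableSet_Ioc hf
  have hmul : ∀ s ∈ Set.Ioc t M.T, ∀ y : EReal,
      (M.disc t₀ s ω : EReal) * y = (M.disc t₀ t ω : EReal) * ((M.disc t s ω : EReal) * y) := by
    intro s hs y
    rw [disc_mul hM ht.1 hs.1.le hs.2, EReal.coe_mul, mul_assoc]
  rw [payoff, payoff, EReal.left_distrib_of_nonneg_of_ne_top hd0 (by simp), ← add_assoc, ← mul_assoc,
    ← EReal.coe_mul, ← disc_mul hM ht.1 ht.2 le_rfl]
  congr 1
  rw [eintegral, eintegral, hsplit _ (fun s => ((M.disc t s ω : EReal) * q s ω).toENNReal),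
    hsplit _ (fun s => (-((M.disc t s ω : EReal) * q s ω)).toENNReal), coe_add_mul_sub h1 h2 hd]
  · congr 1
    rw [← hg]
    exact h3.symm
  · intro s hs
    rw [hmul s hs, ← mul_neg, EReal.toENNReal_mul hd0, EReal.real_coe_toENNReal]
  · intro s hs
    rw [hmul s hs, EReal.toENNReal_mul hd0, EReal.real_coe_toENNReal]

end Market

/-! ### The objective along a (super)martingale -/

namespace Market

variable {Ω : Type*} [mΩ : MeasurableSpace Ω] {m n : ℕ} {M : Market Ω m n}
  {t₀ : ℝ≥0} {x₀ : ℝ} {u : Strategy Ω n} {φ φ' : ℝ≥0 → Ω → Fin n → ℝ} {t : ℝ≥0}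
  {v : ℝ≥0 → Ω → ℝ → ℝ} {A : Set Ω}

/-- The payoff from time `t` on of an admissible pair, with the penalty normalised by `v`. -/
def gain (M : Market Ω m n) (v : ℝ≥0 → Ω → ℝ → ℝ) (t₀ : ℝ≥0) (x₀ : ℝ) (u : Strategy Ω n)
    (φ : ℝ≥0 → Ω → Fin n → ℝ) (t : ℝ≥0) : Ω → EReal :=
  M.payoff (M.R v u φ (M.wealth t₀ x₀ u φ)) (M.wealth t₀ x₀ u φ) t

/-- The discounted reward accrued up to time `t`, as a real random variable: the cost process without
its terminal term. It is meaningful where the cost process is finite. -/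
def accrued (M : Market Ω m n) (v : ℝ≥0 → Ω → ℝ → ℝ) (t₀ : ℝ≥0) (x₀ : ℝ) (u : Strategy Ω n)
    (φ : ℝ≥0 → Ω → Fin n → ℝ) (t : ℝ≥0) (ω : Ω) : ℝ :=
  (M.N v t₀ x₀ u φ t ω).toReal - M.disc t₀ t ω * v t ω (M.wealth t₀ x₀ u φ t ω)

lemma objective_eq (hM : M.Standing) :
    M.objective v t₀ x₀ u φ t = econdExp (M.Q t₀ φ) (M.F t) (M.gain v t₀ x₀ u φ t) := by
  rw [objective, reward_eq_R hM, gain]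

lemma coe_accrued {ω : Ω} (h : M.N v t₀ x₀ u φ t ω ≠ ⊤ ∧ M.N v t₀ x₀ u φ t ω ≠ ⊥) :
    eintegral (timeVol.restrict (Set.Ioc t₀ t))
      (fun s => (M.disc t₀ s ω : EReal) * M.R v u φ (M.wealth t₀ x₀ u φ) s ω)
      = (M.accrued v t₀ x₀ u φ t ω : EReal) := by
  obtain ⟨h1, h2⟩ := h
  have h3 := EReal.coe_toReal h1 h2
  rw [accrued, EReal.coe_sub, h3, N]
  exact EReal.add_sub_cancel_right.symm

lemma gain_eq_add (hM : M.Standing) (ht : t ∈ Set.Icc t₀ M.T) {ω : Ω}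
    (h : M.N v t₀ x₀ u φ t ω ≠ ⊤ ∧ M.N v t₀ x₀ u φ t ω ≠ ⊥) :
    M.gain v t₀ x₀ u φ t₀ ω
      = M.accrued v t₀ x₀ u φ t ω + M.disc t₀ t ω * M.gain v t₀ x₀ u φ t ω :=
  payoff_split hM ht (coe_accrued h)

/-- At the horizon, the cost process is the payoff of the whole period. -/
lemma N_terminal (hv : M.Regular v) (h : M.Admissible t₀ x₀ u φ) (ht₀ : t₀ ≤ M.T) :
    M.N v t₀ x₀ u φ M.T =ᵐ[M.P] M.gain v t₀ x₀ u φ t₀ := by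
  filter_upwards [field_terminal hv h ht₀] with ω e
  rw [N, gain, payoff, EReal.coe_mul, e]

lemma measurable_accrued (hM : M.Standing) (hv : M.Regular v) (h : M.Admissible t₀ x₀ u φ)
    (ht : t ∈ Set.Icc t₀ M.T) (hN : Measurable[M.F t] fun ω => (M.N v t₀ x₀ u φ t ω).toReal) :
    Measurable[M.F t] (M.accrued v t₀ x₀ u φ t) :=
  hN.sub ((measurable_disc hM t₀ t).mul (measurable_field_wealth hM hv h ht))

/-- The conditional expectation of the final cost process is an affine image of the objective. -/
lemma condExp_N_terminal (hM : M.Standing) (hv : M.Regular v) (h : M.Admissible t₀ x₀ u φ)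
    (ht : t ∈ Set.Icc t₀ M.T) (hN : Measurable[M.F t] fun ω => (M.N v t₀ x₀ u φ t ω).toReal)
    (hfin : ∀ᵐ ω ∂(M.Q t₀ φ), M.N v t₀ x₀ u φ t ω ≠ ⊤ ∧ M.N v t₀ x₀ u φ t ω ≠ ⊥)
    (hfinT : ∀ᵐ ω ∂(M.Q t₀ φ), M.N v t₀ x₀ u φ M.T ω ≠ ⊤ ∧ M.N v t₀ x₀ u φ M.T ω ≠ ⊥)
    (hint : Integrable (fun ω => (M.N v t₀ x₀ u φ M.T ω).toReal) (M.Q t₀ φ)) :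
    ∀ᵐ ω ∂(M.Q t₀ φ), (((M.Q t₀ φ)[fun ω => (M.N v t₀ x₀ u φ M.T ω).toReal | M.F t] ω : ℝ) : EReal)
      = M.accrued v t₀ x₀ u φ t ω + M.disc t₀ t ω * M.objective v t₀ x₀ u φ t ω := by
  have ht₀ := ht.1.trans ht.2
  have := h.isFiniteMeasure_Q ht₀
  have e1 := econdExp_coe (𝒢 := M.F t) hint
  have e2 := econdExp_affine (Q := M.Q t₀ φ) (M.F.le t)
    ((aemeasurable_payoff hM hv h ht).mono_ac Q_ac) (measurable_accrued hM hv h ht hN)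
    (measurable_disc hM t₀ t) (fun ω => disc_pos t₀ t ω)
  have e3 : (fun ω => ((M.N v t₀ x₀ u φ M.T ω).toReal : EReal)) =ᵐ[M.Q t₀ φ] fun ω =>
      (M.accrued v t₀ x₀ u φ t ω : EReal) + M.disc t₀ t ω * M.gain v t₀ x₀ u φ t ω := by
    filter_upwards [hfin, hfinT, Q_ac.ae_le (N_terminal hv h ht₀)] with ω f1 f2 f3
    rw [← gain_eq_add hM ht f1, ← f3, EReal.coe_toReal f2.1 f2.2]
  filter_upwards [e1, e2, econdExp_congr_ae (𝒢 := M.F t) e3] with ω g1 g2 g3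
  rw [objective_eq hM, ← g1, g3]
  exact g2

lemma affine_le_iff {a d b : ℝ} {y : EReal} (hd : 0 < d) :
    (a : EReal) + d * y ≤ ((a + d * b : ℝ) : EReal) ↔ y ≤ b := by
  induction y with
  | bot => simp [EReal.coe_mul_bot_of_pos hd]
  | top =>
    rw [EReal.coe_mul_top_of_pos hd, EReal.coe_add_top]
    simp only [top_le_iff, EReal.coe_ne_top]
  | coe y =>
    norm_cast
    rw [add_le_add_iff_left, mul_le_mul_iff_right₀ hd]

lemma affine_lt_iff {a d b : ℝ} {y : EReal} (hd : 0 < d) :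
    (a : EReal) + d * y < ((a + d * b : ℝ) : EReal) ↔ y < b := by
  induction y with
  | bot =>
    simp only [EReal.coe_mul_bot_of_pos hd, EReal.add_bot, EReal.bot_lt_coe]
  | top =>
    rw [EReal.coe_mul_top_of_pos hd, EReal.coe_add_top]
    simp only [not_top_lt]
  | coe y =>
    norm_cast
    rw [add_lt_add_iff_left, mul_lt_mul_iff_right₀ hd]

lemma affine_eq_iff {a d b : ℝ} {y : EReal} (hd : 0 < d) :
    (a : EReal) + d * y = ((a + d * b : ℝ) : EReal) ↔ y = b := by
  rw [eq_iff_le_not_lt, eq_iff_le_not_lt, affine_le_iff hd, affine_lt_iff hd]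

lemma toReal_N (ω : Ω) : (M.N v t₀ x₀ u φ t ω).toReal
    = M.accrued v t₀ x₀ u φ t ω + M.disc t₀ t ω * v t ω (M.wealth t₀ x₀ u φ t ω) := by
  rw [accrued]
  ring

lemma objective_le_of_supermartingale (hM : M.Standing) (hv : M.Regular v)
    (h : M.Admissible t₀ x₀ u φ) (ht : t ∈ Set.Icc t₀ M.T)
    (hN : IsSupermartingaleOn (M.Q t₀ φ) M.F t₀ M.T (M.N v t₀ x₀ u φ)) :
    M.objective v t₀ x₀ u φ t
      ≤ᵐ[M.P] fun ω => (v t ω (M.wealth t₀ x₀ u φ t ω) : EReal) := by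
  have ht₀ := ht.1.trans ht.2
  have hT : M.T ∈ Set.Icc t₀ M.T := ⟨ht₀, le_rfl⟩
  refine (h.ac_Q ht₀).ae_le ?_
  filter_upwards [condExp_N_terminal hM hv h ht (hN.2.1 ⟨t, ht⟩).measurable (hN.1 t ht)
    (hN.1 _ hT) (hN.2.2.2 ⟨_, hT⟩), hN.2.2.1 ⟨t, ht⟩ ⟨_, hT⟩ ht.2] with ω e1 e2
  rw [← affine_le_iff (disc_pos t₀ t ω), ← e1, EReal.coe_le_coe_iff, ← toReal_N]
  exact e2

lemma objective_eq_of_martingale (hM : M.Standing) (hv : M.Regular v)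
    (h : M.Admissible t₀ x₀ u φ) (ht : t ∈ Set.Icc t₀ M.T)
    (hN : IsMartingaleOn (M.Q t₀ φ) M.F t₀ M.T (M.N v t₀ x₀ u φ)) :
    M.objective v t₀ x₀ u φ t
      =ᵐ[M.P] fun ω => (v t ω (M.wealth t₀ x₀ u φ t ω) : EReal) := by
  have ht₀ := ht.1.trans ht.2
  have hT : M.T ∈ Set.Icc t₀ M.T := ⟨ht₀, le_rfl⟩
  refine (h.ac_Q ht₀).ae_le ?_
  filter_upwards [condExp_N_terminal hM hv h ht (hN.2.1 ⟨t, ht⟩).measurable (hN.1 t ht)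
    (hN.1 _ hT) (hN.2.integrable ⟨_, hT⟩), hN.2.2 ⟨t, ht⟩ ⟨_, hT⟩ ht.2] with ω e1 e2
  rw [← affine_eq_iff (disc_pos t₀ t ω), ← e1, EReal.coe_eq_coe_iff, ← toReal_N]
  exact e2

/-! ### Change of measure on events known at an intermediate time -/

/-- On `F_t`, the measure `Q(φ)` has density `Λ(t)`. -/
lemma lintegral_Q_of_measurable (hM : M.Standing) (h : M.Admissible t₀ x₀ u φ)
    (ht : t ∈ Set.Icc t₀ M.T) {f : Ω → ℝ≥0∞} (hf : Measurable[M.F t] f) :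
    ∫⁻ ω, f ω ∂(M.Q t₀ φ) = ∫⁻ ω, f ω * ENNReal.ofReal (M.density t₀ φ t ω) ∂M.P := by
  have hP := hM.prob
  have hT : M.T ∈ Set.Icc t₀ M.T := ⟨ht.1.trans ht.2, le_rfl⟩
  have hint := h.integrable_density hT
  have hm : AEMeasurable (fun ω => ENNReal.ofReal (M.density t₀ φ M.T ω)) M.P :=
    hint.1.aemeasurable.ennreal_ofReal
  rw [Q, lintegral_withDensity_eq_lintegral_mul₀ hm
    (hf.mono (M.F.le t) le_rfl).aemeasurable]
  simp only [Pi.mul_apply, mul_comm _ (f _)]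
  rw [← lintegral_mul_condLExp (M.F.le t) hf hm]
  refine lintegral_congr_ae ?_
  filter_upwards [condLExp_ofReal (M.F t) hint (ae_of_all _ fun ω => (density_pos _ _).le),
    h.density_martingale.2 ⟨t, ht⟩ ⟨_, hT⟩ ht.2] with ω e1 e2
  rw [e1]
  congr 2

lemma setLIntegral_ratio_mul (hM : M.Standing) (h : M.Admissible t₀ x₀ u φ)
    (h' : M.Admissible t₀ x₀ u φ') (ht : t ∈ Set.Icc t₀ M.T) (hA : MeasurableSet[M.F t] A)
    {f : Ω → ℝ≥0∞} (hf : Measurable[M.F t] f) :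
    ∫⁻ ω in A, ENNReal.ofReal (M.density t₀ φ t ω / M.density t₀ φ' t ω) * f ω ∂(M.Q t₀ φ')
      = ∫⁻ ω in A, f ω ∂(M.Q t₀ φ) := by
  have hA' : MeasurableSet A := M.F.le t _ hA
  have m1 : Measurable[M.F t] fun ω =>
      ENNReal.ofReal (M.density t₀ φ t ω / M.density t₀ φ' t ω) * f ω :=
    ((h.density_martingale.1 ⟨t, ht⟩).measurable.div
      (h'.density_martingale.1 ⟨t, ht⟩).measurable).ennreal_ofReal.mul hf
  rw [← lintegral_indicator hA', ← lintegral_indicator hA',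
    lintegral_Q_of_measurable hM h' ht (m1.indicator hA),
    lintegral_Q_of_measurable hM h ht (hf.indicator hA)]
  refine lintegral_congr fun ω => ?_
  by_cases hω : ω ∈ A
  · simp only [Set.indicator_of_mem hω]
    rw [mul_right_comm, ← ENNReal.ofReal_mul (div_pos (density_pos _ _) (density_pos _ _)).le,
      div_mul_cancel₀ _ (density_pos _ _).ne', mul_comm]
  · simp [hω]

end Market

/-! ### A worse distortion obtained by pasting -/

/-- The defining property of a conditional expectation in terms of integrals of non-negative
functions. -/
lemma setLIntegral_condExp_balance {Ω : Type*} {𝒢 : MeasurableSpace Ω} [mΩ : MeasurableSpace Ω]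
    {Q : Measure Ω} [IsFiniteMeasure Q] (hm : 𝒢 ≤ mΩ) {f g : Ω → ℝ} (hf : Integrable f Q)
    (hg : Q[f | 𝒢] =ᵐ[Q] g) {A : Set Ω} (hA : MeasurableSet[𝒢] A) :
    ∫⁻ ω in A, ENNReal.ofReal (f ω) ∂Q + ∫⁻ ω in A, ENNReal.ofReal (-g ω) ∂Q
      = ∫⁻ ω in A, ENNReal.ofReal (-f ω) ∂Q + ∫⁻ ω in A, ENNReal.ofReal (g ω) ∂Q := by
  have hgi : Integrable g Q := integrable_condExp.congr hg
  have e : ∫ ω in A, g ω ∂Q = ∫ ω in A, f ω ∂Q :=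
    (integral_congr_ae (ae_restrict_of_ae hg.symm)).trans (setIntegral_condExp hm hf hA)
  rw [integral_eq_lintegral_pos_part_sub_lintegral_neg_part hgi.integrableOn,
    integral_eq_lintegral_pos_part_sub_lintegral_neg_part hf.integrableOn] at e
  have fin : ∀ {k : Ω → ℝ}, Integrable k Q → ∫⁻ ω in A, ENNReal.ofReal (k ω) ∂Q ≠ ⊤ := fun hk =>
    ((setLIntegral_le_lintegral _ _).trans_lt (hk.lintegral_lt_top)).ne
  have f1 := fin hf
  have f2 := fin hf.neg
  have f3 := fin hgi
  have f4 := fin hgi.neg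
  simp only [Pi.neg_apply] at f2 f4
  rw [← ENNReal.toReal_eq_toReal_iff' (ENNReal.add_ne_top.2 ⟨f1, f4⟩)
    (ENNReal.add_ne_top.2 ⟨f2, f3⟩), ENNReal.toReal_add f1 f4, ENNReal.toReal_add f2 f3]
  linarith

/-- An event of positive probability on which a random variable is finite has a part of positive
probability on which it is bounded. -/
lemma exists_measure_inter_le_ne_zero {Ω : Type*} [MeasurableSpace Ω] {P : Measure Ω} {B : Set Ω}
    (hB : P B ≠ 0) {f : Ω → ℝ≥0∞} (hf : ∀ᵐ ω ∂P, ω ∈ B → f ω < ⊤) :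
    ∃ K : ℝ≥0, P (B ∩ {ω | f ω ≤ K}) ≠ 0 := by
  by_contra! hK
  refine hB ?_
  have h0 : ∀ᵐ ω ∂P, ω ∉ B := by
    have hall : ∀ᵐ ω ∂P, ∀ k : ℕ, ω ∉ B ∩ {ω | f ω ≤ ((k : ℝ≥0) : ℝ≥0∞)} := by
      refine ae_all_iff.2 fun k => ?_
      rw [ae_iff]
      simpa only [not_not, Set.ofPred_mem_eq] using hK k
    filter_upwards [hf, hall] with ω h1 h2 hω
    obtain ⟨k, hk⟩ := ENNReal.exists_nat_gt (h1 hω).ne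
    exact h2 k ⟨hω, by simpa using hk.le⟩
  simpa [ae_iff] using h0

lemma add_ofReal_neg_lt {p q : ℝ≥0∞} {x : ℝ} (h : (p : EReal) - q < x) (hq : q ≠ ⊤) :
    p ≠ ⊤ ∧ p + ENNReal.ofReal (-x) < q + ENNReal.ofReal x := by
  have e : ∀ z : ℝ≥0, ((z : ℝ≥0∞) : EReal) = ((z : ℝ) : EReal) := fun z => rfl
  lift q to ℝ≥0 using hq
  have hp : p ≠ ⊤ := by
    rintro rfl
    rw [e, EReal.coe_ennreal_top, EReal.top_sub_coe] at h
    exact not_top_lt h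
  lift p to ℝ≥0 using hp
  refine ⟨by simp, ?_⟩
  rw [e, e, ← EReal.coe_sub, EReal.coe_lt_coe_iff] at h
  rw [ENNReal.ofReal, ENNReal.ofReal]
  norm_cast
  rw [← NNReal.coe_lt_coe]
  push_cast
  rw [Real.coe_toNNReal', Real.coe_toNNReal']
  rcases le_total x 0 with hx | hx
  · rw [max_eq_left (by linarith), max_eq_right hx]
    linarith
  · rw [max_eq_right (by linarith), max_eq_left hx]
    linarith

namespace Market

variable {Ω : Type*} [mΩ : MeasurableSpace Ω] {m n : ℕ} {M : Market Ω m n}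
  {t₀ : ℝ≥0} {x₀ : ℝ} {u : Strategy Ω n} {φ φ' : ℝ≥0 → Ω → Fin n → ℝ} {t : ℝ≥0}
  {v : ℝ≥0 → Ω → ℝ → ℝ} {A : Set Ω}

lemma R_congr {X X' : ℝ≥0 → Ω → ℝ} {s : ℝ≥0} {ω : Ω} (h1 : φ s ω = φ' s ω) (h2 : X s ω = X' s ω) :
    M.R v u φ X s ω = M.R v u φ' X' s ω := by
  rw [R, R, h1, h2]

lemma payoff_congr {q q' : ℝ≥0 → Ω → EReal} {X X' : ℝ≥0 → Ω → ℝ} {ω : Ω}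
    (hq : ∀ s ∈ Set.Ioc t M.T, q s ω = q' s ω) (hX : X M.T ω = X' M.T ω) :
    M.payoff q X t ω = M.payoff q' X' t ω := by
  rw [payoff, payoff, hX, eintegral, eintegral]
  congr 3
  · exact setLIntegral_congr_fun measurableSet_Ioc fun s hs => by simp only [hq s hs]
  · exact setLIntegral_congr_fun measurableSet_Ioc fun s hs => by simp only [hq s hs]

lemma gain_paste_of_notMem (ht₀ : t₀ ≤ M.T) (h : M.Admissible t₀ x₀ u φ)
    (hψ : M.Admissible t₀ x₀ u (pasteProc φ φ' t A)) :
    ∀ᵐ ω ∂M.P, ω ∉ A → M.gain v t₀ x₀ u (pasteProc φ φ' t A) t₀ ω = M.gain v t₀ x₀ u φ t₀ ω := by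
  classical
  filter_upwards [hψ.wealth_eq ht₀ h] with ω e hω
  refine payoff_congr (fun s hs => R_congr ?_ (e s ⟨hs.1.le, hs.2⟩)) (e _ ⟨ht₀, le_rfl⟩)
  simp only [pasteProc, hω, and_false, if_false]

lemma gain_paste_of_mem (hM : M.Standing) (ht : t ∈ Set.Icc t₀ M.T) (h : M.Admissible t₀ x₀ u φ)
    (h' : M.Admissible t₀ x₀ u φ') (hψ : M.Admissible t₀ x₀ u (pasteProc φ φ' t A))
    (hfin : ∀ᵐ ω ∂M.P, M.N v t₀ x₀ u φ t ω ≠ ⊤ ∧ M.N v t₀ x₀ u φ t ω ≠ ⊥) :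
    ∀ᵐ ω ∂M.P, ω ∈ A → M.gain v t₀ x₀ u (pasteProc φ φ' t A) t₀ ω
      = M.accrued v t₀ x₀ u φ t ω + M.disc t₀ t ω * M.gain v t₀ x₀ u φ' t ω := by
  classical
  have ht₀ := ht.1.trans ht.2
  filter_upwards [hψ.wealth_eq ht₀ h, hψ.wealth_eq ht₀ h', hfin] with ω e e' hN hω
  have h1 : M.gain v t₀ x₀ u (pasteProc φ φ' t A) t ω = M.gain v t₀ x₀ u φ' t ω := by
    refine payoff_congr (fun s hs => R_congr ?_ (e' s ⟨ht.1.trans hs.1.le, hs.2⟩))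
      (e' _ ⟨ht₀, le_rfl⟩)
    simp only [pasteProc, hs.1, hω, and_self, if_true]
  rw [← h1]
  refine payoff_split hM ht ?_
  rw [← coe_accrued hN, eintegral, eintegral]
  have h2 : ∀ s ∈ Set.Ioc t₀ t, M.R v u (pasteProc φ φ' t A)
      (M.wealth t₀ x₀ u (pasteProc φ φ' t A)) s ω = M.R v u φ (M.wealth t₀ x₀ u φ) s ω := by
    refine fun s hs => R_congr ?_ (e s ⟨hs.1.le, hs.2.trans ht.2⟩)
    simp only [pasteProc, hs.2.not_gt, false_and, if_false]
  congr 2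
  · exact setLIntegral_congr_fun measurableSet_Ioc fun s hs => by simp only [h2 s hs]
  · exact setLIntegral_congr_fun measurableSet_Ioc fun s hs => by simp only [h2 s hs]

/-- Expected payoff (through a non-negative function, in practice the positive or the negative part) of
the distortion that follows `φ` and switches to `φ'` at time `t` on the event `A`. -/
lemma lintegral_gain_paste (hM : M.Standing) (hv : M.Regular v) (ht : t ∈ Set.Icc t₀ M.T)
    (h : M.Admissible t₀ x₀ u φ) (h' : M.Admissible t₀ x₀ u φ')
    (hψ : M.Admissible t₀ x₀ u (pasteProc φ φ' t A)) (hA : MeasurableSet[M.F t] A)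
    (hN : Measurable[M.F t] fun ω => (M.N v t₀ x₀ u φ t ω).toReal)
    (hfin : ∀ᵐ ω ∂M.P, M.N v t₀ x₀ u φ t ω ≠ ⊤ ∧ M.N v t₀ x₀ u φ t ω ≠ ⊥)
    {p : EReal → ℝ≥0∞} (hp : Measurable p) :
    ∫⁻ ω, p (M.gain v t₀ x₀ u (pasteProc φ φ' t A) t₀ ω) ∂(M.Q t₀ (pasteProc φ φ' t A))
      = ∫⁻ ω in A, condLExp (M.F t) (M.Q t₀ φ') (fun ω => p (M.accrued v t₀ x₀ u φ t ω
          + M.disc t₀ t ω * M.gain v t₀ x₀ u φ' t ω)) ω ∂(M.Q t₀ φ)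
        + ∫⁻ ω in Aᶜ, p (M.gain v t₀ x₀ u φ t₀ ω) ∂(M.Q t₀ φ) := by
  have ht₀ := ht.1.trans ht.2
  have := h'.isFiniteMeasure_Q ht₀
  have hA' : MeasurableSet A := M.F.le t _ hA
  have mψ : AEMeasurable (fun ω => p (M.gain v t₀ x₀ u (pasteProc φ φ' t A) t₀ ω)) M.P :=
    hp.comp_aemeasurable (aemeasurable_payoff hM hv hψ ⟨le_rfl, ht₀⟩)
  have mZ : AEMeasurable (fun ω => (M.accrued v t₀ x₀ u φ t ω : EReal)
      + M.disc t₀ t ω * M.gain v t₀ x₀ u φ' t ω) M.P :=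
    (measurable_coe_real_ereal.comp
      ((measurable_accrued hM hv h ht hN).mono (M.F.le t) le_rfl)).aemeasurable.add
    ((measurable_coe_real_ereal.comp
      ((measurable_disc hM t₀ t).mono (M.F.le t) le_rfl)).aemeasurable.mul
        (aemeasurable_payoff hM hv h' ht))
  have mw : Measurable[M.F t] (A.indicator fun ω =>
      ENNReal.ofReal (M.density t₀ φ t ω / M.density t₀ φ' t ω)) :=
    ((h.density_martingale.1 ⟨t, ht⟩).measurable.div
      (h'.density_martingale.1 ⟨t, ht⟩).measurable).ennreal_ofReal.indicator hA
  rw [lintegral_Q_paste hM h h' ht hA mψ,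
    ← setLIntegral_ratio_mul hM h h' ht hA (measurable_condLExp _ _ _)]
  congr 1
  · have e1 := lintegral_mul_condLExp (M.F.le t) mw
      ((hp.comp_aemeasurable mZ).mono_ac (Q_ac (t₀ := t₀) (φ := φ')))
    simp only [← Set.indicator_mul_left, lintegral_indicator hA'] at e1
    refine Eq.trans ?_ e1.symm
    refine setLIntegral_congr_fun_ae hA' ?_
    filter_upwards [Q_ac.ae_le (gain_paste_of_mem hM ht h h' hψ hfin)] with ω e hω
    simp only [Function.comp_apply, e hω]
  · refine setLIntegral_congr_fun_ae hA'.compl ?_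
    filter_upwards [Q_ac.ae_le (gain_paste_of_notMem (v := v) ht₀ h hψ)] with ω e hω
    rw [e hω]

end Market

/-! ### Time consistency of the worst case -/

namespace Market

variable {Ω : Type*} [mΩ : MeasurableSpace Ω] {m n : ℕ} {M : Market Ω m n}
  {t₀ : ℝ≥0} {x₀ : ℝ} {u : Strategy Ω n} {φ φ' : ℝ≥0 → Ω → Fin n → ℝ} {t : ℝ≥0}
  {v : ℝ≥0 → Ω → ℝ → ℝ} {A : Set Ω}

/-- If the cost process of `φ` is a martingale and `φ` minimises the unconditional cost, then it also
minimises the objective conditional on `F_t`, up to null sets: otherwise switching at time `t`, on the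
event where another distortion does better, would decrease the cost. -/
lemma field_le_objective (hM : M.Standing) (hv : M.Regular v) (h : M.Admissible t₀ x₀ u φ)
    (hN : IsMartingaleOn (M.Q t₀ φ) M.F t₀ M.T (M.N v t₀ x₀ u φ))
    (hmin : ∀ ψ, M.Admissible t₀ x₀ u ψ → M.cost v t₀ x₀ u φ ≤ M.cost v t₀ x₀ u ψ)
    (h' : M.Admissible t₀ x₀ u φ') (ht : t ∈ Set.Icc t₀ M.T) :
    (fun ω => (v t ω (M.wealth t₀ x₀ u φ t ω) : EReal)) ≤ᵐ[M.P] M.objective v t₀ x₀ u φ' t := by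
  have hP := hM.prob
  have ht₀ := ht.1.trans ht.2
  have hT : M.T ∈ Set.Icc t₀ M.T := ⟨ht₀, le_rfl⟩
  have hfQ := h.isFiniteMeasure_Q ht₀
  have hfQ' := h'.isFiniteMeasure_Q ht₀
  have hac := h.ac_Q ht₀
  have hac' := h'.ac_Q ht₀
  have hm := M.F.le t
  set x : Ω → ℝ := fun ω => (M.N v t₀ x₀ u φ t ω).toReal with hx
  set y : Ω → ℝ := fun ω => (M.N v t₀ x₀ u φ M.T ω).toReal with hy
  have mx : Measurable[M.F t] x := (hN.2.1 ⟨t, ht⟩).measurable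
  have hyi : Integrable y (M.Q t₀ φ) := hN.2.integrable ⟨_, hT⟩
  have hxy : (M.Q t₀ φ)[y | M.F t] =ᵐ[M.Q t₀ φ] x := hN.2.2 ⟨t, ht⟩ ⟨_, hT⟩ ht.2
  have hfin : ∀ᵐ ω ∂M.P, M.N v t₀ x₀ u φ t ω ≠ ⊤ ∧ M.N v t₀ x₀ u φ t ω ≠ ⊥ :=
    hac.ae_le (hN.1 t ht)
  have hgain : M.gain v t₀ x₀ u φ t₀ =ᵐ[M.Q t₀ φ] fun ω => (y ω : EReal) := by
    filter_upwards [hN.1 _ hT, Q_ac.ae_le (N_terminal hv h ht₀)] with ω e1 e2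
    rw [← e2, hy, EReal.coe_toReal e1.1 e1.2]
  set Z : Ω → EReal := fun ω => M.accrued v t₀ x₀ u φ t ω
    + M.disc t₀ t ω * M.gain v t₀ x₀ u φ' t ω with hZ
  set cp := condLExp (M.F t) (M.Q t₀ φ') fun ω => (Z ω).toENNReal with hcp
  set cn := condLExp (M.F t) (M.Q t₀ φ') fun ω => (-Z ω).toENNReal with hcn
  have mcp : Measurable[M.F t] cp := measurable_condLExp _ _ _
  have mcn : Measurable[M.F t] cn := measurable_condLExp _ _ _
  -- `B` is the event where switching to `φ'` lowers the conditional cost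
  set B : Set Ω := {ω | (cp ω : EReal) - cn ω < x ω} with hB
  have mB : MeasurableSet[M.F t] B := measurableSet_lt
    (mcp.coe_ereal_ennreal.sub mcn.coe_ereal_ennreal) (measurable_coe_real_ereal.comp mx)
  have haff := econdExp_affine (Q := M.Q t₀ φ') hm
    ((aemeasurable_payoff hM hv h' ht).mono_ac Q_ac) (measurable_accrued hM hv h ht mx)
    (measurable_disc hM t₀ t) (fun ω => disc_pos t₀ t ω)
  suffices hB0 : M.P B = 0 by
    have : ∀ᵐ ω ∂M.P, ω ∉ B := by simpa [ae_iff] using hB0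
    filter_upwards [this, hac'.ae_le haff] with ω e1 e2
    refine not_lt.1 fun hlt => e1 ?_
    rw [← affine_lt_iff (a := M.accrued v t₀ x₀ u φ t ω) (disc_pos t₀ t ω), ← toReal_N,
      objective_eq hM] at hlt
    exact e2.trans_lt hlt
  by_contra hBne
  -- on parts of `B` where `w` is bounded the switched distortion is admissible
  set w : Ω → ℝ≥0∞ := fun ω => ENNReal.ofReal (M.density t₀ φ t ω / M.density t₀ φ' t ω)
    + ∫⁻ s in Set.Ioc t₀ t, ENNReal.ofReal (φ s ω ⬝ᵥ φ s ω) ∂timeVol with hw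
  have mw : Measurable[M.F t] w := ((h.density_martingale.1 ⟨t, ht⟩).measurable.div
      (h'.density_martingale.1 ⟨t, ht⟩).measurable).ennreal_ofReal.add
    (measurable_energy h.φ_pred t₀ t)
  have hwfin : ∀ᵐ ω ∂M.P, w ω < ⊤ := by
    filter_upwards [h.energy_lt_top ht₀] with ω e
    exact ENNReal.add_lt_top.2 ⟨ENNReal.ofReal_lt_top,
      (lintegral_mono_set (Set.Ioc_subset_Ioc_right ht.2)).trans_lt e⟩
  have hpaste : ∀ {A : Set Ω} {K : ℝ≥0}, MeasurableSet[M.F t] A → (∀ ω ∈ A, w ω ≤ K) →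
      M.cost v t₀ x₀ u φ ≤
        ((∫⁻ ω in A, cp ω ∂(M.Q t₀ φ) + ∫⁻ ω in Aᶜ, ENNReal.ofReal (y ω) ∂(M.Q t₀ φ) : ℝ≥0∞) : EReal)
        - ((∫⁻ ω in A, cn ω ∂(M.Q t₀ φ) + ∫⁻ ω in Aᶜ, ENNReal.ofReal (-y ω) ∂(M.Q t₀ φ) : ℝ≥0∞)
          : EReal) := by
    intro A K hA hK
    have hK1 : ∀ ω ∈ A, M.density t₀ φ t ω / M.density t₀ φ' t ω ≤ K := fun ω hω => by
      have := le_self_add.trans (hK ω hω)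
      rwa [ENNReal.ofReal_le_iff_le_toReal (by simp), ENNReal.coe_toReal] at this
    have hψ := h.paste hM h' ht hA hK1 fun ω hω => le_add_self.trans (hK ω hω)
    refine (hmin _ hψ).trans (le_of_eq ?_)
    have e1 := lintegral_gain_paste hM hv ht h h' hψ hA mx hfin
      (p := EReal.toENNReal) measurable_id.ereal_toENNReal
    have e2 := lintegral_gain_paste hM hv ht h h' hψ hA mx hfin
      (p := fun z => (-z).toENNReal) measurable_neg.ereal_toENNReal
    have e3 : ∫⁻ ω in Aᶜ, (M.gain v t₀ x₀ u φ t₀ ω).toENNReal ∂(M.Q t₀ φ)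
        = ∫⁻ ω in Aᶜ, ENNReal.ofReal (y ω) ∂(M.Q t₀ φ) := by
      refine lintegral_congr_ae (ae_restrict_of_ae ?_)
      filter_upwards [hgain] with ω e
      rw [e, EReal.real_coe_toENNReal]
    have e4 : ∫⁻ ω in Aᶜ, (-M.gain v t₀ x₀ u φ t₀ ω).toENNReal ∂(M.Q t₀ φ)
        = ∫⁻ ω in Aᶜ, ENNReal.ofReal (-y ω) ∂(M.Q t₀ φ) := by
      refine lintegral_congr_ae (ae_restrict_of_ae ?_)
      filter_upwards [hgain] with ω e
      rw [e, ← EReal.coe_neg, EReal.real_coe_toENNReal]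
    rw [cost, eintegral, ← e3, ← e4]
    exact congrArg₂ (fun a b : ℝ≥0∞ => (a : EReal) - b) e1 e2
  have hcost : M.cost v t₀ x₀ u φ = ((∫⁻ ω, ENNReal.ofReal (y ω) ∂(M.Q t₀ φ) : ℝ≥0∞) : EReal)
      - ((∫⁻ ω, ENNReal.ofReal (-y ω) ∂(M.Q t₀ φ) : ℝ≥0∞) : EReal) := by
    rw [cost, eintegral]
    congr 2
    · refine lintegral_congr_ae ?_
      filter_upwards [hgain] with ω e
      rw [← EReal.real_coe_toENNReal, ← e, gain]
    · refine lintegral_congr_ae ?_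
      filter_upwards [hgain] with ω e
      rw [← EReal.real_coe_toENNReal, EReal.coe_neg, ← e, gain]
  have hyp : ∫⁻ ω, ENNReal.ofReal (y ω) ∂(M.Q t₀ φ) ≠ ⊤ := hyi.lintegral_lt_top.ne
  have hyn : ∫⁻ ω, ENNReal.ofReal (-y ω) ∂(M.Q t₀ φ) ≠ ⊤ := hyi.neg.lintegral_lt_top.ne
  have hQA : ∀ {A : Set Ω}, M.P A ≠ 0 → M.Q t₀ φ A ≠ 0 := fun hA h0 => hA (hac h0)
  by_cases hcase : M.P (B ∩ {ω | cn ω = ⊤}) = 0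
  · -- the conditional payoff is finite on `B`: integrate the strict inequality over a bounded part
    have hcnB : ∀ᵐ ω ∂M.P, ω ∈ B → cn ω ≠ ⊤ := by
      have : ∀ᵐ ω ∂M.P, ω ∉ B ∩ {ω | cn ω = ⊤} := by
        simpa only [ae_iff, not_not, Set.ofPred_mem_eq] using hcase
      filter_upwards [this] with ω e1 e2 e3 using e1 ⟨e2, e3⟩
    obtain ⟨K, hK⟩ := exists_measure_inter_le_ne_zero hBne
      (f := fun ω => w ω + (cp ω + cn ω + ENNReal.ofReal (x ω) + ENNReal.ofReal (-x ω))) (by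
        filter_upwards [hwfin, hcnB] with ω e1 e2 hω
        have := (add_ofReal_neg_lt hω (e2 hω)).1
        simp [e1, (e2 hω).lt_top, this.lt_top])
    set A := B ∩ {ω | w ω + (cp ω + cn ω + ENNReal.ofReal (x ω) + ENNReal.ofReal (-x ω)) ≤ K}
      with hA
    have mA : MeasurableSet[M.F t] A := mB.inter (measurableSet_le (mw.add
      (((mcp.add mcn).add mx.ennreal_ofReal).add mx.neg.ennreal_ofReal)) measurable_const)
    have hle := hpaste mA fun ω hω => le_self_add.trans hω.2
    have hfinA : ∀ {f : Ω → ℝ≥0∞}, (∀ ω ∈ A, f ω ≤ K) → ∫⁻ ω in A, f ω ∂(M.Q t₀ φ) ≠ ⊤ := by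
      intro f hf
      refine ((setLIntegral_mono_ae' (hm _ mA) (ae_of_all _ hf)).trans_lt ?_).ne
      rw [setLIntegral_const]
      exact ENNReal.mul_lt_top (by simp) (measure_lt_top _ _)
    have bA : ∀ ω ∈ A, cp ω ≤ K ∧ cn ω ≤ K ∧ ENNReal.ofReal (x ω) ≤ K ∧ ENNReal.ofReal (-x ω) ≤ K := by
      intro ω hω
      have h0 : cp ω + cn ω + ENNReal.ofReal (x ω) + ENNReal.ofReal (-x ω) ≤ K :=
        le_add_self.trans hω.2
      have h1 := le_self_add.trans h0
      have h2 := le_self_add.trans h1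
      exact ⟨le_self_add.trans h2, le_add_self.trans h2, le_add_self.trans h1, le_add_self.trans h0⟩
    have hstrict : ∫⁻ ω in A, (cp ω + ENNReal.ofReal (-x ω)) ∂(M.Q t₀ φ)
        < ∫⁻ ω in A, (cn ω + ENNReal.ofReal (x ω)) ∂(M.Q t₀ φ) := by
      refine setLIntegral_strict_mono (hm _ mA) (hQA hK)
        ((mcn.add mx.ennreal_ofReal).mono hm le_rfl) ?_ (ae_of_all _ fun ω hω =>
          (add_ofReal_neg_lt hω.1 (ne_top_of_le_ne_top (by simp) (bA ω hω).2.1)).2)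
      rw [lintegral_add_left (mcp.mono hm le_rfl)]
      exact ENNReal.add_ne_top.2 ⟨hfinA fun ω hω => (bA ω hω).1, hfinA fun ω hω => (bA ω hω).2.2.2⟩
    rw [lintegral_add_left (mcp.mono hm le_rfl), lintegral_add_left (mcn.mono hm le_rfl)] at hstrict
    have hbal := setLIntegral_condExp_balance hm hyi hxy mA
    rw [hcost, ← lintegral_add_compl _ (hm _ mA),
      ← lintegral_add_compl (fun ω => ENNReal.ofReal (-y ω)) (hm _ mA)] at hle
    have i1 := hfinA fun ω hω => (bA ω hω).1
    have i2 := hfinA fun ω hω => (bA ω hω).2.1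
    have i3 := hfinA fun ω hω => (bA ω hω).2.2.1
    have i4 := hfinA fun ω hω => (bA ω hω).2.2.2
    have i5 := ne_top_of_le_ne_top hyp (setLIntegral_le_lintegral A _)
    have i6 := ne_top_of_le_ne_top hyn (setLIntegral_le_lintegral A _)
    have i7 := ne_top_of_le_ne_top hyp (setLIntegral_le_lintegral Aᶜ _)
    have i8 := ne_top_of_le_ne_top hyn (setLIntegral_le_lintegral Aᶜ _)
    have e : ∀ z : ℝ≥0, ((z : ℝ≥0∞) : EReal) = ((z : ℝ) : EReal) := fun z => rfl
    generalize ∫⁻ ω in A, cp ω ∂(M.Q t₀ φ) = a1 at *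
    generalize ∫⁻ ω in A, cn ω ∂(M.Q t₀ φ) = a2 at *
    generalize ∫⁻ ω in A, ENNReal.ofReal (x ω) ∂(M.Q t₀ φ) = a3 at *
    generalize ∫⁻ ω in A, ENNReal.ofReal (-x ω) ∂(M.Q t₀ φ) = a4 at *
    generalize ∫⁻ ω in A, ENNReal.ofReal (y ω) ∂(M.Q t₀ φ) = a5 at *
    generalize ∫⁻ ω in A, ENNReal.ofReal (-y ω) ∂(M.Q t₀ φ) = a6 at *
    generalize ∫⁻ ω in Aᶜ, ENNReal.ofReal (y ω) ∂(M.Q t₀ φ) = a7 at *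
    generalize ∫⁻ ω in Aᶜ, ENNReal.ofReal (-y ω) ∂(M.Q t₀ φ) = a8 at *
    lift a1 to ℝ≥0 using i1
    lift a2 to ℝ≥0 using i2
    lift a3 to ℝ≥0 using i3
    lift a4 to ℝ≥0 using i4
    lift a5 to ℝ≥0 using i5
    lift a6 to ℝ≥0 using i6
    lift a7 to ℝ≥0 using i7
    lift a8 to ℝ≥0 using i8
    simp only [← ENNReal.coe_add, e, ← EReal.coe_sub, EReal.coe_le_coe_iff, ENNReal.coe_lt_coe,
      ENNReal.coe_inj, ← NNReal.coe_lt_coe, ← NNReal.coe_inj, NNReal.coe_add] at hle hstrict hbal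
    linarith
  · -- the conditional payoff is `-∞` on part of `B`: switching there makes the cost `-∞`
    obtain ⟨K, hK⟩ := exists_measure_inter_le_ne_zero hcase (f := w) (by
      filter_upwards [hwfin] with ω e _ using e)
    have mA : MeasurableSet[M.F t] (B ∩ {ω | cn ω = ⊤} ∩ {ω | w ω ≤ K}) :=
      (mB.inter (mcn (measurableSet_singleton ⊤))).inter (measurableSet_le mw measurable_const)
    have hle := hpaste mA fun ω hω => hω.2
    have htop : ∫⁻ ω in B ∩ {ω | cn ω = ⊤} ∩ {ω | w ω ≤ K}, cn ω ∂(M.Q t₀ φ) = ⊤ := by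
      rw [setLIntegral_congr_fun (hm _ mA) (g := fun _ => ⊤) fun ω hω => hω.1.2, setLIntegral_const,
        ENNReal.top_mul (hQA hK)]
    rw [htop, top_add, EReal.coe_ennreal_top, EReal.sub_top, le_bot_iff, hcost] at hle
    lift ∫⁻ ω, ENNReal.ofReal (y ω) ∂(M.Q t₀ φ) to ℝ≥0 using hyp with a
    lift ∫⁻ ω, ENNReal.ofReal (-y ω) ∂(M.Q t₀ φ) to ℝ≥0 using hyn with b
    have e : ∀ z : ℝ≥0, ((z : ℝ≥0∞) : EReal) = ((z : ℝ) : EReal) := fun z => rfl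
    rw [e, e, ← EReal.coe_sub] at hle
    exact EReal.coe_ne_bot _ hle

/-! ### The robust value -/

lemma measurable_objective : Measurable[M.F t] (M.objective v t₀ x₀ u φ t) :=
  measurable_econdExp _

/-- The inner infimum for `uStar`. The wealth `ξ` at time `t` is any version of the optimal one, so
that the constant `x₀` is included at `t = t₀`. -/
lemma isWorstCase_of_optimality (hM : M.Standing) (hv : M.Regular v) {uStar : Strategy Ω n}
    {φStar : ℝ≥0 → Ω → Fin n → ℝ} (hopt : M.OptimalityConditions v t₀ x₀ uStar φStar)
    (ht : t ∈ Set.Icc t₀ M.T) {ξ : Ω → ℝ} (hξ : M.wealth t₀ x₀ uStar φStar t =ᵐ[M.P] ξ)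
    (hm : Measurable[M.F t] fun ω => v t ω (ξ ω)) :
    M.IsWorstCase v t₀ x₀ t ξ uStar fun ω => (v t ω (ξ ω) : EReal) := by
  have hvξ : (fun ω => (v t ω (M.wealth t₀ x₀ uStar φStar t ω) : EReal))
      =ᵐ[M.P] fun ω => (v t ω (ξ ω) : EReal) := by
    filter_upwards [hξ] with ω e
    rw [e]
  refine ⟨measurable_coe_real_ereal.comp hm, ?_, fun Z' _ hZ' =>
    (hZ' _ ⟨φStar, ⟨hopt.uStar_mem, hopt.φStar_mem, hξ⟩, rfl⟩).trans
      ((objective_eq_of_martingale hM hv hopt.φStar_mem ht hopt.martingale).trans hvξ).le⟩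
  rintro _ ⟨φ, ⟨-, hφ, -⟩, rfl⟩
  refine hvξ.symm.le.trans (field_le_objective hM hv hopt.φStar_mem hopt.martingale
    (fun ψ hψ => ?_) hφ ht)
  rw [← hopt.attained]
  exact iInf₂_le ψ hψ

lemma isRobustValue_of_optimality (hM : M.Standing) (hv : M.Regular v) {uStar : Strategy Ω n}
    {φStar : ℝ≥0 → Ω → Fin n → ℝ} (hopt : M.OptimalityConditions v t₀ x₀ uStar φStar)
    (ht : t ∈ Set.Icc t₀ M.T) {ξ : Ω → ℝ} (hξ : M.wealth t₀ x₀ uStar φStar t =ᵐ[M.P] ξ)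
    (hm : Measurable[M.F t] fun ω => v t ω (ξ ω)) :
    M.IsRobustValue v t₀ x₀ t ξ fun ω => (v t ω (ξ ω) : EReal) := by
  have hP := hM.prob
  have ht₀ := ht.1.trans ht.2
  have hex : ∀ u, ∃ Z, M.IsWorstCase v t₀ x₀ t ξ u Z := fun u =>
    exists_isEssInf (M.F.le t) (by rintro _ ⟨φ, -, rfl⟩; exact measurable_objective)
  choose I hI using hex
  refine ⟨I, fun u _ _ => hI u, measurable_coe_real_ereal.comp hm, ?_, ?_⟩
  · rintro _ ⟨u, φ, ⟨hu, hφ, hφξ⟩, rfl⟩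
    obtain ⟨φ', hφ', hsup⟩ := hopt.supermartingale u hu
    have hw : M.wealth t₀ x₀ u φ' t =ᵐ[M.P] ξ := by
      filter_upwards [hφ'.wealth_eq ht₀ hφ, hφξ] with ω e1 e2
      rw [e1 t ht, e2]
    refine ((hI u).le _ ⟨φ', ⟨hu, hφ', hw⟩, rfl⟩).trans
      ((objective_le_of_supermartingale hM hv hφ' ht hsup).trans ?_)
    filter_upwards [hw] with ω e
    rw [e]
  · intro Z' _ hle
    have hw := isWorstCase_of_optimality hM hv hopt ht hξ hm
    exact ((hI uStar).greatest _ hw.measurable hw.le).trans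
      (hle _ ⟨uStar, φStar, ⟨hopt.uStar_mem, hopt.φStar_mem, hξ⟩, rfl⟩)

end Market
end RobustMerton

end

/-- Martingale optimality principle for the robust investment-consumption problem. -/
theorem proposition2 {Ω : Type*} [mΩ : MeasurableSpace Ω] {m n : ℕ}
    (M : RobustMerton.Market Ω m n) (hM : M.Standing)
    (v : ℝ≥0 → Ω → ℝ → ℝ) (hv : M.Regular v) :
    (∀ t₀ ≤ M.T, ∀ x₀ : ℝ, 0 < x₀ →
      ∀ (uStar : RobustMerton.Strategy Ω n) (φStar : ℝ≥0 → Ω → Fin n → ℝ),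
      M.OptimalityConditions v t₀ x₀ uStar φStar →
      (M.wealth t₀ x₀ uStar φStar t₀ =ᵐ[M.P] fun _ => x₀) ∧
      ∀ t ∈ Set.Icc t₀ M.T,
        M.IsRobustValue v t₀ x₀ t (M.wealth t₀ x₀ uStar φStar t)
          (fun ω => (v t ω (M.wealth t₀ x₀ uStar φStar t ω) : EReal)) ∧
        M.IsWorstCase v t₀ x₀ t (M.wealth t₀ x₀ uStar φStar t) uStar
          (fun ω => (v t ω (M.wealth t₀ x₀ uStar φStar t ω) : EReal)) ∧
        M.objective v t₀ x₀ uStar φStar t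
          =ᵐ[M.P] fun ω => (v t ω (M.wealth t₀ x₀ uStar φStar t ω) : EReal)) ∧
    ((∀ t₀ ≤ M.T, ∀ x₀ : ℝ, 0 < x₀ → ∃ uStar φStar,
      M.OptimalityConditions v t₀ x₀ uStar φStar) → M.IsValueFunction v) := by
  constructor
  · intro t₀ ht₀ x₀ _ uStar φStar hopt
    refine ⟨RobustMerton.Market.IsWealth.initial hM.prob ht₀ hopt.φStar_mem.isWealth,
      fun t ht => ?_⟩
    have hm := RobustMerton.Market.measurable_field_wealth hM hv hopt.φStar_mem ht
    exact ⟨RobustMerton.Market.isRobustValue_of_optimality hM hv hopt ht .rfl hm,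
      RobustMerton.Market.isWorstCase_of_optimality hM hv hopt ht .rfl hm,
      RobustMerton.Market.objective_eq_of_martingale hM hv hopt.φStar_mem ht hopt.martingale⟩
  · intro hex t ht x hx
    obtain ⟨uStar, φStar, hopt⟩ := hex t ht x hx
    exact RobustMerton.Market.isRobustValue_of_optimality hM hv hopt ⟨le_rfl, ht⟩
      (RobustMerton.Market.IsWealth.initial hM.prob ht hopt.φStar_mem.isWealth)
      (hv.adapted x hx t ht).measurable
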